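/- **Setting.** Let $n\ge 1$, let $\Gamma\in C^{2,1}(\mathbb R;\mathbb R^{n+1})$ be a curve with $|\Gamma'|=1$, let $T=\Gamma'$, and let $(T,N_1,\dots,N_n)$ be a relatively parallel adapted frame of $\Gamma$, i.e. an orthonormal frame of locally Lipschitz vector fields along $\Gamma$ such that each $N_j'$ is tangential almost everywhere. Put $k_j=T'\cdot N_j$ (so that $T'=\sum_j k_jN_j$, $N_j'=-k_jT$) and $k=(k_1,\dots,k_n)$. Let $\Theta\in C^{1,1}(\mathbb R;\mathbb R^n)$ with $\Theta_1^2+\dots+\Theta_n^2=1$. Here $C^{m,1}(\mathbb R)$ means that the $m$-th derivative is locally Lipschitz. Suppose $$k\cdot\Theta,\ (k\cdot\Theta)',\ |\Theta'|,\ |\Theta''|\in L^\infty(\mathbb R).$$ For $a>0$ with $a\,\|k\cdot\Theta\|_{L^\infty(\mathbb R)}<1$ let $\Omega_0=\mathbb R\times(-a,a)$, $\Pi=\mathbb R\times(-1,1)$, $E_1=(\pi/2a)^2$, and $$f(s,t)=\sqrt{[1-t\,(k\cdot\Theta)(s)]^2+t^2|\Theta'(s)|^2},\qquad V_{\rm eff}=-\tfrac14(k\cdot\Theta)^2+\tfrac12|\Theta'|^2,\qquad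 z_0=-\tfrac14\|k\cdot\Theta\|_{L^\infty(\mathbb R)}^2 .$$ All Hilbert spaces are complex. * $H$ is the operator in $\mathcal H=L^2(\Omega_0,f\,ds\,dt)$ associated with the form $h[\psi]=\int_{\Omega_0}\big(f^{-1}|\partial_1\psi|^2+f\,|\partial_2\psi|^2\big)\,ds\,dt$, whose domain is the closure of $C_0^\infty(\Omega_0)$ in the norm $(h[\psi]+\|\psi\|_{\mathcal H}^2)^{1/2}$. * $U:\mathcal H\to L^2(\Pi)$ is the unitary map $(U\psi)(s,u)=\sqrt{a f(s,au)}\,\psi(s,au)$, and $\hat H=UHU^{-1}$. * $\hat H_0$ is the operator in $L^2(\Pi)$ associated with the form $\hat h_0[\phi]=\int_\Pi\big(|\partial_1\phi|^2+a^{-2}|\partial_2\phi|^2+V_{\rm eff}(s)|\phi|^2\big)\,ds\,du$ on $W^{1,2}_0(\Pi)$. **Theorem.** For every real $z<z_0$ there exist positive numbers $a_0$ and $C$ such that for all $0<a\le a_0$ with $a\,\|k\cdot\Theta\|_{L^\infty(\mathbb R)}<1$: the number $z$ belongs to the resolvent sets of $\hat H$, of $\hat H-E_1$ and of $\hat H_0-E_1$,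 and $$\big\|(\hat H-E_1-z)^{-1}-(\hat H_0-E_1-z)^{-1}\big\|_{L^2(\Pi)\to L^2(\Pi)}\le C\,a .$$ -/

import Mathlib

open MeasureTheory Set
open scoped ENNReal ContDiff

noncomputable section

namespace QuantumStrip

/-! ### Unbounded operators: resolvents, forms, unitary conjugation -/

section Operators

variable {E F : Type*} [NormedAddCommGroup E] [InnerProductSpace ℂ E]
  [NormedAddCommGroup F] [InnerProductSpace ℂ F]

/-- `R` is a bounded everywhere defined two-sided inverse of `A - z : Dom A → E`. -/
def IsResolventAt (A : E →ₗ.[ℂ] E) (z : ℂ) (R : E →L[ℂ] E) : Prop :=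
  (∀ x : E, ∃ hx : R x ∈ A.domain, A ⟨R x, hx⟩ - z • R x = x) ∧
    ∀ y : A.domain, R (A y - z • (y : E)) = y

/-- The resolvent set `ρ(A)` of an unbounded operator. -/
def resolventSet (A : E →ₗ.[ℂ] E) : Set ℂ :=
  {z | ∃ R : E →L[ℂ] E, IsResolventAt A z R}

theorem IsResolventAt.unique {A : E →ₗ.[ℂ] E} {z : ℂ} {R R' : E →L[ℂ] E}
    (h : IsResolventAt A z R) (h' : IsResolventAt A z R') : R = R' := by
  ext x
  obtain ⟨hx, e⟩ := h'.1 x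
  have := h.2 ⟨R' x, hx⟩
  simp only [e] at this
  exact this

open Classical in
/-- The resolvent `(A - z)⁻¹`, for `z ∈ ρ(A)` (and zero, by convention, for all other `z`). -/
def resolvent (A : E →ₗ.[ℂ] E) (z : ℂ) : E →L[ℂ] E :=
  if h : ∃ R : E →L[ℂ] E, IsResolventAt A z R then h.choose else 0

theorem isResolventAt_resolvent {A : E →ₗ.[ℂ] E} {z : ℂ} (h : z ∈ resolventSet A) :
    IsResolventAt A z (resolvent A z) := by
  have h' : ∃ R : E →L[ℂ] E, IsResolventAt A z R := h
  rw [resolvent, dif_pos h']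
  exact h'.choose_spec

/-- The operator `A - c` on the domain of `A`. -/
def subScalar (A : E →ₗ.[ℂ] E) (c : ℂ) : E →ₗ.[ℂ] E where
  domain := A.domain
  toFun := A.toFun - c • A.domain.subtype

/-- The operator `U A U⁻¹` with domain `U (Dom A)`. -/
def unitaryConj (U : E ≃ₗᵢ[ℂ] F) (A : E →ₗ.[ℂ] E) : F →ₗ.[ℂ] F where
  domain := A.domain.comap (U.symm.toLinearEquiv : F →ₗ[ℂ] E)
  toFun :=
    { toFun := fun y => U (A ⟨U.symm (y : F), y.2⟩)
      map_add' := fun x y => by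
        rw [← map_add, ← LinearPMap.map_add]
        congr 2
        exact Subtype.ext (map_add U.symm (x : F) (y : F))
      map_smul' := fun c x => by
        rw [RingHom.id_apply, ← map_smul, ← LinearPMap.map_smul]
        congr 2
        exact Subtype.ext (map_smul U.symm c (x : F)) }

/-- The operator associated with a sesquilinear form (first representation theorem).
The form domain is presented by a subspace `D` of pairs `(ψ, ∇ψ)`, where `∇ψ` is determined by `ψ`,
and the form `b` is conjugate-linear in its first argument.
A vector `ψ` of the form domain lies in the operator domain and is sent to `η` exactly when
`b(φ, ψ) = ⟪φ, η⟫` for all `φ` in the form domain. -/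
def formOperator {G : Type*} [AddCommGroup G] [Module ℂ G] (D : Submodule ℂ (E × G))
    (b : E × G →ₗ⋆[ℂ] E × G →ₗ[ℂ] ℂ) : E →ₗ.[ℂ] E :=
  Submodule.toLinearPMap
    { carrier := {x : E × E | ∃ p : G, (x.1, p) ∈ D ∧ ∀ y ∈ D, b y (x.1, p) = inner ℂ y.1 x.2}
      zero_mem' := ⟨0, D.zero_mem, fun y _ => by
        change b y 0 = inner ℂ y.1 (0 : E)
        simp⟩
      add_mem' := by
        rintro x x' ⟨p, hp, h⟩ ⟨p', hp', h'⟩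
        refine ⟨p + p', D.add_mem hp hp', fun y hy => ?_⟩
        rw [Prod.snd_add, inner_add_right, ← h y hy, ← h' y hy, ← map_add]
        rfl
      smul_mem' := by
        rintro c x ⟨p, hp, h⟩
        refine ⟨c • p, D.smul_mem c hp, fun y hy => ?_⟩
        rw [Prod.smul_snd, inner_smul_right, ← h y hy, ← smul_eq_mul, ← map_smul]
        rfl }

end Operators

/-! ### First-order Sobolev spaces with Dirichlet conditions, with weights -/

/-- `φ ∈ C₀^∞(O)`. -/
def IsTestFunction (O : Set (ℝ × ℝ)) (φ : ℝ × ℝ → ℂ) : Prop :=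
  ContDiff ℝ ∞ φ ∧ HasCompactSupport φ ∧ tsupport φ ⊆ O

/-- Partial derivative in the first variable. -/
def d₁ (φ : ℝ × ℝ → ℂ) (p : ℝ × ℝ) : ℂ := fderiv ℝ φ p (1, 0)

/-- Partial derivative in the second variable. -/
def d₂ (φ : ℝ × ℝ → ℂ) (p : ℝ × ℝ) : ℂ := fderiv ℝ φ p (0, 1)

/-- The triples `(φ, ∂₁φ, ∂₂φ)` in `L²(μ) × L²(μ₁) × L²(μ₂)` with `φ ∈ C₀^∞(O)`. -/
def testGradients (O : Set (ℝ × ℝ)) (μ μ₁ μ₂ : Measure (ℝ × ℝ)) :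
    Submodule ℂ (Lp ℂ 2 μ × Lp ℂ 2 μ₁ × Lp ℂ 2 μ₂) where
  carrier := {x | ∃ φ : ℝ × ℝ → ℂ, IsTestFunction O φ ∧
    x.1 =ᵐ[μ] φ ∧ x.2.1 =ᵐ[μ₁] d₁ φ ∧ x.2.2 =ᵐ[μ₂] d₂ φ}
  zero_mem' := by
    refine ⟨0, ⟨contDiff_const, HasCompactSupport.zero, by simp⟩, Lp.coeFn_zero _ _ _, ?_, ?_⟩
    · filter_upwards [Lp.coeFn_zero ℂ 2 μ₁] with p hp
      simpa [d₁] using hp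
    · filter_upwards [Lp.coeFn_zero ℂ 2 μ₂] with p hp
      simpa [d₂] using hp
  add_mem' := by
    rintro x y ⟨φ, hφ, h0, h1, h2⟩ ⟨χ, hχ, k0, k1, k2⟩
    have dφ := hφ.1.differentiable (by simp)
    have dχ := hχ.1.differentiable (by simp)
    refine ⟨φ + χ, ⟨hφ.1.add hχ.1, hφ.2.1.add hχ.2.1,
      (tsupport_add φ χ).trans (union_subset hφ.2.2 hχ.2.2)⟩, ?_, ?_, ?_⟩
    · exact (Lp.coeFn_add _ _).trans (h0.add k0)
    · filter_upwards [Lp.coeFn_add x.2.1 y.2.1, h1, k1] with p hp hp1 hp2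
      simp only [Prod.snd_add, Prod.fst_add, hp, Pi.add_apply, hp1, hp2, d₁]
      rw [fderiv_add (dφ p) (dχ p)]
      rfl
    · filter_upwards [Lp.coeFn_add x.2.2 y.2.2, h2, k2] with p hp hp1 hp2
      simp only [Prod.snd_add, hp, Pi.add_apply, hp1, hp2, d₂]
      rw [fderiv_add (dφ p) (dχ p)]
      rfl
  smul_mem' := by
    rintro c x ⟨φ, hφ, h0, h1, h2⟩
    have dφ := hφ.1.differentiable (by simp)
    refine ⟨c • φ, ⟨contDiff_const.smul hφ.1, hφ.2.1.smul_left (f := fun _ => c),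
      (tsupport_smul_subset_right (fun _ => c) φ).trans hφ.2.2⟩, ?_, ?_, ?_⟩
    · exact (Lp.coeFn_smul _ _).trans (h0.const_smul c)
    · filter_upwards [Lp.coeFn_smul c x.2.1, h1] with p hp hp1
      simp only [Prod.smul_snd, Prod.smul_fst, hp, Pi.smul_apply, hp1, d₁]
      rw [fderiv_const_smul (dφ p)]
      rfl
    · filter_upwards [Lp.coeFn_smul c x.2.2, h2] with p hp hp1
      simp only [Prod.smul_snd, hp, Pi.smul_apply, hp1, d₂]
      rw [fderiv_const_smul (dφ p)]
      rfl

/-- The closure of `C₀^∞(O)` in the norm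
`(∫ |ψ|² dμ + ∫ |∂₁ψ|² dμ₁ + ∫ |∂₂ψ|² dμ₂)^{1/2}`,
each element `ψ` being recorded together with its weak gradient as `(ψ, ∂₁ψ, ∂₂ψ)`.
If the three measures are the Lebesgue measure on the open set `O`, this is `W₀^{1,2}(O)`. -/
def dirichletSpace (O : Set (ℝ × ℝ)) (μ μ₁ μ₂ : Measure (ℝ × ℝ)) :
    Submodule ℂ (Lp ℂ 2 μ × Lp ℂ 2 μ₁ × Lp ℂ 2 μ₂) :=
  (testGradients O μ μ₁ μ₂).topologicalClosure

/-- The form `α ∫ conj(∂₁φ) ∂₁ψ dμ₁ + β ∫ conj(∂₂φ) ∂₂ψ dμ₂ + ⟪φ, Vψ⟫`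
with `V` a bounded operator on `L²(μ)`. -/
def gradientForm (μ μ₁ μ₂ : Measure (ℝ × ℝ)) (α β : ℂ) (V : Lp ℂ 2 μ →L[ℂ] Lp ℂ 2 μ) :
    Lp ℂ 2 μ × Lp ℂ 2 μ₁ × Lp ℂ 2 μ₂ →ₗ⋆[ℂ] Lp ℂ 2 μ × Lp ℂ 2 μ₁ × Lp ℂ 2 μ₂ →ₗ[ℂ] ℂ :=
  LinearMap.mk₂'ₛₗ (starRingEnd ℂ) (RingHom.id ℂ)
    (fun y x => α * inner ℂ y.2.1 x.2.1 + β * inner ℂ y.2.2 x.2.2 + inner ℂ y.1 (V x.1))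
    (fun m₁ m₂ x => by simp only [Prod.snd_add, Prod.fst_add, inner_add_left]; ring)
    (fun c m x => by
      simp only [Prod.smul_snd, Prod.smul_fst, inner_smul_left, smul_eq_mul]; ring)
    (fun m x₁ x₂ => by simp only [Prod.snd_add, Prod.fst_add, inner_add_right, map_add]; ring)
    (fun c m x => by
      simp only [Prod.smul_snd, Prod.smul_fst, inner_smul_right, map_smul, smul_eq_mul,
        RingHom.id_apply]; ring)

/-- The measure `w(s,t) ds dt` on `O`. -/
def weightedMeasure (O : Set (ℝ × ℝ)) (w : ℝ × ℝ → ℝ) : Measure (ℝ × ℝ) :=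
  (volume.restrict O).withDensity (fun p => ENNReal.ofReal (w p))

/-! ### A unitary map given by a change of variables and the square root of a density -/

section Unitary

variable {X : Type*} [MeasurableSpace X] {π ν : Measure X} {σ : X ≃ᵐ X} {w : X → ℝ}

theorem quasi_of_density (hw : Measurable w) (hpos : ∀ᵐ x ∂π, 0 < w x)
    (hσ : MeasurePreserving σ (π.withDensity (fun x => ENNReal.ofReal (w x))) ν) :
    Measure.QuasiMeasurePreserving σ π ν := by
  refine ⟨σ.measurable, ?_⟩
  have h1 : π ≪ π.withDensity (fun x => ENNReal.ofReal (w x)) :=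
    withDensity_absolutelyContinuous' hw.ennreal_ofReal.aemeasurable
      (hpos.mono fun x hx => by simpa using hx)
  rw [← hσ.map_eq]
  exact h1.map σ.measurable

theorem eLpNorm_sqrt_density (hw : Measurable w) (hpos : ∀ᵐ x ∂π, 0 < w x)
    (hσ : MeasurePreserving σ (π.withDensity (fun x => ENNReal.ofReal (w x))) ν) (g : X → ℂ) :
    eLpNorm (fun x => ((√(w x) : ℝ) : ℂ) * g (σ x)) 2 π = eLpNorm g 2 ν := by
  rw [eLpNorm_eq_lintegral_rpow_enorm_toReal (by simp) (by simp),
    eLpNorm_eq_lintegral_rpow_enorm_toReal (by simp) (by simp)]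
  congr 1
  rw [← hσ.map_eq, lintegral_map_equiv,
    lintegral_withDensity_eq_lintegral_mul_non_measurable _ hw.ennreal_ofReal
      (by filter_upwards with x; simp)]
  refine lintegral_congr_ae ?_
  filter_upwards [hpos] with x hx
  simp only [Pi.mul_apply, ENNReal.toReal_ofNat, ENNReal.rpow_ofNat]
  rw [enorm_mul, mul_pow]
  congr 1
  rw [← ofReal_norm, ← ENNReal.ofReal_pow (norm_nonneg _)]
  congr 1
  simp [Real.sq_sqrt hx.le]

theorem memLp_sqrt_density (hw : Measurable w) (hpos : ∀ᵐ x ∂π, 0 < w x)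
    (hσ : MeasurePreserving σ (π.withDensity (fun x => ENNReal.ofReal (w x))) ν)
    (ψ : Lp ℂ 2 ν) : MemLp (fun x => ((√(w x) : ℝ) : ℂ) * ψ (σ x)) 2 π := by
  refine ⟨?_, ?_⟩
  · refine AEStronglyMeasurable.mul ?_ ?_
    · exact (Complex.measurable_ofReal.comp hw.sqrt).aestronglyMeasurable
    · exact (Lp.aestronglyMeasurable ψ).comp_quasiMeasurePreserving (quasi_of_density hw hpos hσ)
  · rw [eLpNorm_sqrt_density hw hpos hσ]
    exact Lp.eLpNorm_lt_top ψ

/-- The isometry `ψ ↦ √w · (ψ ∘ σ)`. -/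
def sqrtDensityIsometry (hw : Measurable w) (hpos : ∀ᵐ x ∂π, 0 < w x)
    (hσ : MeasurePreserving σ (π.withDensity (fun x => ENNReal.ofReal (w x))) ν) :
    Lp ℂ 2 ν →ₗᵢ[ℂ] Lp ℂ 2 π where
  toFun ψ := (memLp_sqrt_density hw hpos hσ ψ).toLp _
  map_add' ψ χ := by
    rw [← MemLp.toLp_add]
    apply MemLp.toLp_congr
    filter_upwards [(quasi_of_density hw hpos hσ).ae (Lp.coeFn_add ψ χ)] with x hx
    rw [hx, Pi.add_apply, mul_add]
    rfl
  map_smul' c ψ := by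
    rw [RingHom.id_apply, ← MemLp.toLp_const_smul]
    apply MemLp.toLp_congr
    filter_upwards [(quasi_of_density hw hpos hσ).ae (Lp.coeFn_smul c ψ)] with x hx
    simp only [hx, Pi.smul_apply, smul_eq_mul]
    ring
  norm_map' ψ := by
    change ‖(memLp_sqrt_density hw hpos hσ ψ).toLp _‖ = ‖ψ‖
    rw [Lp.norm_toLp, eLpNorm_sqrt_density hw hpos hσ, Lp.norm_def]

theorem sqrtDensityIsometry_surjective (hw : Measurable w) (hpos : ∀ᵐ x ∂π, 0 < w x)
    (hσ : MeasurePreserving σ (π.withDensity (fun x => ENNReal.ofReal (w x))) ν) :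
    Function.Surjective (sqrtDensityIsometry hw hpos hσ) := by
  intro χ
  let g : X → ℂ := fun y => ((√(w (σ.symm y)) : ℝ) : ℂ)⁻¹ * χ (σ.symm y)
  have hg : ∀ᵐ x ∂π, ((√(w x) : ℝ) : ℂ) * g (σ x) = χ x := by
    filter_upwards [hpos] with x hx
    have : ((√(w x) : ℝ) : ℂ) ≠ 0 := by
      exact_mod_cast (Real.sqrt_pos.2 hx).ne'
    simp [g, this]
  have hac : π.withDensity (fun x => ENNReal.ofReal (w x)) ≪ π :=
    withDensity_absolutelyContinuous _ _
  have hq : Measure.QuasiMeasurePreserving σ.symm ν π := by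
    refine ⟨σ.symm.measurable, ?_⟩
    rw [← hσ.map_eq, Measure.map_map σ.symm.measurable σ.measurable]
    simpa using hac
  have hmem : MemLp g 2 ν := by
    refine ⟨?_, ?_⟩
    · refine AEStronglyMeasurable.mul ?_ ?_
      · exact ((Complex.measurable_ofReal.comp
          (hw.comp σ.symm.measurable).sqrt).inv).aestronglyMeasurable
      · exact (Lp.aestronglyMeasurable χ).comp_quasiMeasurePreserving hq
    · rw [← eLpNorm_sqrt_density hw hpos hσ g, eLpNorm_congr_ae hg]
      exact Lp.eLpNorm_lt_top χ
  refine ⟨hmem.toLp g, ?_⟩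
  refine Lp.ext ?_
  refine (MemLp.coeFn_toLp (memLp_sqrt_density hw hpos hσ (hmem.toLp g))).trans ?_
  filter_upwards [hg, (quasi_of_density hw hpos hσ).ae hmem.coeFn_toLp] with x hx hx'
  rw [hx', hx]

/-- The unitary map `ψ ↦ √w · (ψ ∘ σ)`. -/
def sqrtDensityUnitary (hw : Measurable w) (hpos : ∀ᵐ x ∂π, 0 < w x)
    (hσ : MeasurePreserving σ (π.withDensity (fun x => ENNReal.ofReal (w x))) ν) :
    Lp ℂ 2 ν ≃ₗᵢ[ℂ] Lp ℂ 2 π :=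
  LinearIsometryEquiv.ofSurjective (sqrtDensityIsometry hw hpos hσ)
    (sqrtDensityIsometry_surjective hw hpos hσ)

end Unitary

/-! ### Geometry of the strip -/

/-- Euclidean space `ℝ^d`. -/
abbrev Euc (d : ℕ) : Type := EuclideanSpace ℝ (Fin d)

/-- The class `C^{m,1}(ℝ)`: `m` times continuously differentiable functions
whose `m`-th derivative is locally Lipschitz. -/
def IsCm1 {d : ℕ} (m : ℕ) (c : ℝ → Euc d) : Prop :=
  ContDiff ℝ m c ∧ LocallyLipschitz (iteratedDeriv m c)

/-- `(T, N₁, …, Nₙ)`, with `T = Γ'`, is a relatively parallel adapted frame of `Γ`: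
an orthonormal frame of locally Lipschitz fields whose normal fields have tangential derivatives
almost everywhere. -/
structure IsRelParallelFrame {n : ℕ} (Γ : ℝ → Euc (n + 1)) (N : Fin n → ℝ → Euc (n + 1)) :
    Prop where
  orthonormal : ∀ s, Orthonormal ℝ
    (Fin.cons (deriv Γ s) (fun j => N j s) : Fin (n + 1) → Euc (n + 1))
  locallyLipschitz : ∀ j, LocallyLipschitz (N j)
  tangential : ∀ j, ∀ᵐ s, ∃ c : ℝ, deriv (N j) s = c • deriv Γ s

/-- The components `kⱼ = T' · Nⱼ` of the curvature vector; for a relatively parallel adapted frame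
these are the coefficients in `T' = ∑ⱼ kⱼ Nⱼ` and `Nⱼ' = -kⱼ T`. -/
def curvatureVector {n : ℕ} (Γ : ℝ → Euc (n + 1)) (N : Fin n → ℝ → Euc (n + 1)) (s : ℝ)
    (j : Fin n) : ℝ :=
  inner ℝ (deriv (deriv Γ) s) (N j s)

/-- The function `k · Θ` (the geodesic curvature of `Γ` on the strip). -/
def kDotTheta {n : ℕ} (Γ : ℝ → Euc (n + 1)) (N : Fin n → ℝ → Euc (n + 1)) (Θ : ℝ → Euc n)
    (s : ℝ) : ℝ :=
  ∑ j, curvatureVector Γ N s j * Θ s j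

/-- A unit speed reference curve `Γ`, a relatively parallel adapted frame `N` of it, and a twisting
vector `Θ`, with the regularity and uniform boundedness used for thin strips.
The half-width is a separate parameter. -/
structure StripData (n : ℕ) where
  Γ : ℝ → Euc (n + 1)
  N : Fin n → ℝ → Euc (n + 1)
  Θ : ℝ → Euc n
  regular_Γ : IsCm1 2 Γ
  unit_speed : ∀ s, ‖deriv Γ s‖ = 1
  frame : IsRelParallelFrame Γ N
  regular_Θ : IsCm1 1 Θ
  unit_Θ : ∀ s, ∑ j, Θ s j ^ 2 = 1
  bdd_kΘ : MemLp (kDotTheta Γ N Θ) ∞ volume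
  bdd_kΘ' : MemLp (deriv (kDotTheta Γ N Θ)) ∞ volume
  bdd_Θ' : MemLp (fun s => ‖deriv Θ s‖) ∞ volume
  bdd_Θ'' : MemLp (fun s => ‖deriv (deriv Θ) s‖) ∞ volume

namespace StripData

variable {n : ℕ} (S : StripData n)

/-- The function `k · Θ`. -/
def kΘ : ℝ → ℝ := kDotTheta S.Γ S.N S.Θ

/-- The number `‖k · Θ‖_{L^∞(ℝ)}`. -/
def supNorm : ℝ := (eLpNorm S.kΘ ∞ volume).toReal

/-- The Jacobian `f(s,t) = ([1 - t (k·Θ)(s)]² + t² |Θ'(s)|²)^{1/2}`; the metric of the strip in the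
coordinates `(s,t)` is `diag(f², 1)`. -/
def jacobian (p : ℝ × ℝ) : ℝ :=
  √((1 - p.2 * S.kΘ p.1) ^ 2 + p.2 ^ 2 * ‖deriv S.Θ p.1‖ ^ 2)

/-- The effective potential `-¼ (k·Θ)² + ½ |Θ'|²`. -/
def Veff (s : ℝ) : ℝ := -(1 / 4) * S.kΘ s ^ 2 + 1 / 2 * ‖deriv S.Θ s‖ ^ 2

/-- The threshold `z₀ = -¼ ‖k·Θ‖_∞²`. -/
def z₀ : ℝ := -(1 / 4) * S.supNorm ^ 2

theorem continuous_kΘ : Continuous S.kΘ := by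
  have hT : Continuous (deriv (deriv S.Γ)) := by
    have := S.regular_Γ.1.continuous_iteratedDeriv 2 le_rfl
    simpa [iteratedDeriv_succ, iteratedDeriv_zero] using this
  have hΘ : Continuous S.Θ := S.regular_Θ.1.continuous
  unfold kΘ kDotTheta curvatureVector
  refine continuous_finsetSum _ fun j _ => ?_
  refine Continuous.mul (hT.inner (S.frame.locallyLipschitz j).continuous) ?_
  fun_prop

theorem measurable_jacobian : Measurable S.jacobian := by
  have h1 := S.continuous_kΘ.measurable
  have h2 : Measurable (deriv S.Θ) := measurable_deriv _
  unfold jacobian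
  fun_prop

theorem ae_abs_kΘ_le : ∀ᵐ s : ℝ, |S.kΘ s| ≤ S.supNorm := by
  have hfin : eLpNormEssSup S.kΘ volume ≠ ⊤ := by
    have := S.bdd_kΘ.2.ne
    rwa [eLpNorm_exponent_top] at this
  filter_upwards [ae_le_eLpNormEssSup (f := S.kΘ) (μ := (volume : Measure ℝ))] with s hs
  have := ENNReal.toReal_mono hfin hs
  simpa [supNorm, eLpNorm_exponent_top] using this

theorem jacobian_pos {s t a : ℝ} (hs : |S.kΘ s| ≤ S.supNorm) (ht : |t| < a)
    (hak : a * S.supNorm < 1) : 0 < S.jacobian (s, t) := by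
  have h : |t * S.kΘ s| ≤ a * S.supNorm := by
    rw [abs_mul]
    exact mul_le_mul ht.le hs (abs_nonneg _) ((abs_nonneg _).trans ht.le)
  have h1 : 0 < 1 - t * S.kΘ s := by
    have := le_abs_self (t * S.kΘ s)
    linarith
  unfold jacobian
  dsimp only
  positivity

end StripData

/-! ### The Hamiltonian and its rescaling -/

/-- The straight strip `Ω₀ = ℝ × (-a,a)`. -/
def Ω₀ (a : ℝ) : Set (ℝ × ℝ) := univ ×ˢ Ioo (-a) a

/-- The fixed strip `Π = ℝ × (-1,1)`. -/
def strip : Set (ℝ × ℝ) := univ ×ˢ Ioo (-1) 1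

/-- The Lebesgue measure on `Π`. -/
def stripMeasure : Measure (ℝ × ℝ) := volume.restrict strip

/-- The complex Hilbert space `L²(Π)`. -/
abbrev L2Strip : Type := Lp ℂ 2 stripMeasure

/-- The threshold energy `E₁ = (π / (2a))²`. -/
def E₁ (a : ℝ) : ℝ := (Real.pi / (2 * a)) ^ 2

/-- The change of variables `(s,u) ↦ (s, a u)`. -/
def scaling {a : ℝ} (ha : 0 < a) : ℝ × ℝ ≃ᵐ ℝ × ℝ :=
  (MeasurableEquiv.refl ℝ).prodCongr (MeasurableEquiv.mulLeft₀ a ha.ne')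

namespace StripData

variable {n : ℕ} (S : StripData n)

/-- The measure `f(s,t) ds dt` on `Ω₀`. -/
def measure (a : ℝ) : Measure (ℝ × ℝ) := weightedMeasure (Ω₀ a) S.jacobian

/-- The measure `f(s,t)⁻¹ ds dt` on `Ω₀`. -/
def measureInv (a : ℝ) : Measure (ℝ × ℝ) := weightedMeasure (Ω₀ a) (fun p => (S.jacobian p)⁻¹)

/-- The complex Hilbert space `ℋ = L²(Ω₀, f ds dt)`. -/
abbrev Hilb (a : ℝ) : Type := Lp ℂ 2 (S.measure a)

/-- The operator `H` in `ℋ` associated with the form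
`h[ψ] = ∫ |∂₁ψ|² f⁻¹ ds dt + ∫ |∂₂ψ|² f ds dt`,
whose domain is the closure of `C₀^∞(Ω₀)` in the norm `(h[ψ] + ‖ψ‖²)^{1/2}`. -/
def H (a : ℝ) : S.Hilb a →ₗ.[ℂ] S.Hilb a :=
  formOperator (dirichletSpace (Ω₀ a) (S.measure a) (S.measureInv a) (S.measure a))
    (gradientForm (S.measure a) (S.measureInv a) (S.measure a) 1 1 0)

/-- The density `a f(s, a u)` on `Π`. -/
def density (a : ℝ) (p : ℝ × ℝ) : ℝ := a * S.jacobian (p.1, a * p.2)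

theorem measurable_density (a : ℝ) : Measurable (S.density a) := by
  have := S.measurable_jacobian
  unfold density
  fun_prop

theorem density_pos {a : ℝ} (ha : 0 < a) (hak : a * S.supNorm < 1) :
    ∀ᵐ p ∂stripMeasure, 0 < S.density a p := by
  have h1 : ∀ᵐ p : ℝ × ℝ ∂stripMeasure, |S.kΘ p.1| ≤ S.supNorm := by
    refine ae_restrict_of_ae ?_
    rw [Measure.volume_eq_prod]
    exact Measure.quasiMeasurePreserving_fst.ae S.ae_abs_kΘ_le
  have h2 : ∀ᵐ p : ℝ × ℝ ∂stripMeasure, p ∈ strip :=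
    ae_restrict_mem (MeasurableSet.univ.prod measurableSet_Ioo)
  filter_upwards [h1, h2] with p hp hp'
  refine mul_pos ha (S.jacobian_pos hp ?_ hak)
  have h3 : |p.2| < 1 := abs_lt.2 hp'.2
  rw [abs_mul, abs_of_pos ha]
  nlinarith

theorem scaling_measurePreserving {a : ℝ} (ha : 0 < a) :
    MeasurePreserving (scaling ha)
      (stripMeasure.withDensity (fun p => ENNReal.ofReal (S.density a p))) (S.measure a) := by
  have hpre : strip = scaling ha ⁻¹' (Ω₀ a) := by
    ext ⟨s, u⟩
    simp only [strip, Ω₀, scaling, mem_prod, mem_univ, true_and, mem_Ioo, mem_preimage,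
      MeasurableEquiv.prodCongr, MeasurableEquiv.coe_mk]
    constructor
    · rintro ⟨h1, h2⟩
      exact ⟨by change -a < a * u; nlinarith, by change a * u < a; nlinarith⟩
    · rintro ⟨h1, h2⟩
      change -a < a * u at h1
      change a * u < a at h2
      exact ⟨by nlinarith, by nlinarith⟩
  have hmeas : MeasurableSet (Ω₀ a) := MeasurableSet.univ.prod measurableSet_Ioo
  have hvol : Measure.map (scaling ha) (volume : Measure (ℝ × ℝ)) =
      ENNReal.ofReal a⁻¹ • (volume : Measure (ℝ × ℝ)) := by
    have h := Measure.map_prod_map (volume : Measure ℝ) (volume : Measure ℝ)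
      measurable_id (measurable_const_mul a)
    rw [Real.map_volume_mul_left ha.ne', Measure.map_id, abs_of_pos (inv_pos.2 ha)] at h
    rw [Measure.volume_eq_prod, ← Measure.prod_smul_right, h]
    rfl
  refine ⟨(scaling ha).measurable, ?_⟩
  ext A hA
  rw [Measure.map_apply (scaling ha).measurable hA, withDensity_apply _ ((scaling ha).measurable hA),
    measure, weightedMeasure, withDensity_apply _ hA, stripMeasure,
    Measure.restrict_restrict ((scaling ha).measurable hA), Measure.restrict_restrict hA, hpre,
    ← preimage_inter]
  have hres : (volume.restrict (A ∩ Ω₀ a) : Measure (ℝ × ℝ)) =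
      ENNReal.ofReal a • Measure.map (scaling ha) (volume.restrict (scaling ha ⁻¹' (A ∩ Ω₀ a))) := by
    rw [← Measure.restrict_map (scaling ha).measurable (hA.inter hmeas), hvol,
      Measure.restrict_smul, smul_smul, ← ENNReal.ofReal_mul ha.le, mul_inv_cancel₀ ha.ne']
    simp
  rw [hres, lintegral_smul_measure, lintegral_map_equiv, smul_eq_mul,
    ← lintegral_const_mul _ (by
      exact (S.measurable_jacobian.comp (scaling ha).measurable).ennreal_ofReal)]
  refine lintegral_congr fun p => ?_
  rw [density, ENNReal.ofReal_mul ha.le]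
  rfl

/-- The unitary transform `U : ℋ → L²(Π)`, `(Uψ)(s,u) = √(a f(s, a u)) ψ(s, a u)`. -/
def U {a : ℝ} (ha : 0 < a) (hak : a * S.supNorm < 1) : S.Hilb a ≃ₗᵢ[ℂ] L2Strip :=
  sqrtDensityUnitary (S.measurable_density a) (S.density_pos ha hak)
    (S.scaling_measurePreserving ha)

theorem U_apply {a : ℝ} (ha : 0 < a) (hak : a * S.supNorm < 1) (ψ : S.Hilb a) :
    S.U ha hak ψ =ᵐ[stripMeasure]
      fun p => ((√(a * S.jacobian (p.1, a * p.2)) : ℝ) : ℂ) * ψ (p.1, a * p.2) :=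
  MemLp.coeFn_toLp (memLp_sqrt_density (S.measurable_density a) (S.density_pos ha hak)
    (S.scaling_measurePreserving ha) ψ)

/-- The rescaled operator `Ĥ = U H U⁻¹` in `L²(Π)`. -/
def Hhat {a : ℝ} (ha : 0 < a) (hak : a * S.supNorm < 1) : L2Strip →ₗ.[ℂ] L2Strip :=
  unitaryConj (S.U ha hak) (S.H a)

/-- The effective potential, as a function on `Π`, is bounded. -/
theorem memLp_Veff : MemLp (fun p : ℝ × ℝ => ((S.Veff p.1 : ℝ) : ℂ)) ∞ stripMeasure := by
  have hV : Measurable S.Veff := by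
    have h1 := S.continuous_kΘ.measurable
    have h2 : Measurable (deriv S.Θ) := measurable_deriv _
    unfold Veff
    fun_prop
  have hΘ : ∀ᵐ s : ℝ, ‖deriv S.Θ s‖ ≤ (eLpNorm (fun s => ‖deriv S.Θ s‖) ∞ volume).toReal := by
    have hfin := S.bdd_Θ'.2.ne
    rw [eLpNorm_exponent_top] at hfin ⊢
    filter_upwards [ae_le_eLpNormEssSup (f := fun s => ‖deriv S.Θ s‖)
      (μ := (volume : Measure ℝ))] with s hs
    simpa using ENNReal.toReal_mono hfin hs
  refine memLp_top_of_bound (C := S.supNorm ^ 2 +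
    (eLpNorm (fun s => ‖deriv S.Θ s‖) ∞ volume).toReal ^ 2) ?_ ?_
  · exact (Complex.measurable_ofReal.comp (hV.comp measurable_fst)).aestronglyMeasurable
  · refine ae_restrict_of_ae ?_
    rw [Measure.volume_eq_prod]
    filter_upwards [Measure.quasiMeasurePreserving_fst.ae S.ae_abs_kΘ_le,
      Measure.quasiMeasurePreserving_fst.ae hΘ] with p h1 h2
    have h3 : S.kΘ p.1 ^ 2 ≤ S.supNorm ^ 2 := by
      rw [← sq_abs]
      gcongr
    have h4 : ‖deriv S.Θ p.1‖ ^ 2 ≤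
      (eLpNorm (fun s => ‖deriv S.Θ s‖) ∞ volume).toReal ^ 2 := by gcongr
    rw [Complex.norm_real, Real.norm_eq_abs, abs_le, Veff]
    constructor <;> nlinarith [sq_nonneg (S.kΘ p.1), sq_nonneg ‖deriv S.Θ p.1‖]

/-- Multiplication by the effective potential, as a bounded operator in `L²(Π)`. -/
def mulVeff : L2Strip →L[ℂ] L2Strip :=
  (ContinuousLinearMap.mul ℂ ℂ).holderL stripMeasure ∞ 2 2 (S.memLp_Veff.toLp _)

/-- The comparison operator `Ĥ₀` in `L²(Π)`, associated with the form
`∫ |∂₁φ|² + a⁻² ∫ |∂₂φ|² + ∫ V_eff |φ|²` with domain `W₀^{1,2}(Π)`. -/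
def Hhat₀ (a : ℝ) : L2Strip →ₗ.[ℂ] L2Strip :=
  formOperator (dirichletSpace strip stripMeasure stripMeasure stripMeasure)
    (gradientForm stripMeasure stripMeasure stripMeasure 1 (((a ^ 2)⁻¹ : ℝ) : ℂ) S.mulVeff)

end StripData

end QuantumStrip

end

/-!
Every form domain is a closed space of triples `(ψ, ∂₁ψ, ∂₂ψ)`, so that the whole comparison can
be made in `L²(Π)³`.

For small `a` the metric coefficient `q = f²` is close to `1` on the strip, uniformly, and it is
Lipschitz. Multiplication by `√(a f)` or its inverse therefore maps test functions to compactly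
supported Lipschitz functions, and these belong to the Dirichlet spaces by mollification
(`mem_dirichletSpace_of_lipschitz`). Hence `U` identifies the form domain of `H` with `W₀^{1,2}(Π)`
(`ThinStrip.exists_mem_formDomain`, `ThinStrip.exists_mem_stripSobolev`). With `φ = Uψ` the product
rule turns `∂₁ψ` into `f⁻¹ ∂₁φ - σφ`, where the shift `σ` is `O(a)`, and `∂₂ψ` into
`a⁻¹ (∂₂φ + Wφ)` with `W = -∂_u f / (2f)`. Integrating by parts in the transverse direction
(`inner_add_mulOp`) removes the large cross term: `|∂₂φ + Wφ|²` becomes `|∂₂φ|² + (W² - ∂₂W) |φ|²`,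
and `a⁻² (W² - ∂₂W)` is `V_eff` up to `O(a)` (`potential_estimate`). So the transformed form and the
form of `Ĥ₀` have the same singular term `a⁻² |∂₂φ|²`, and their difference is at most
`O(a) (‖y‖ + ‖∂₁y‖) (‖x‖ + ‖∂₁x‖)` (`ThinStrip.norm_transformedForm_sub_le`).

The transverse Poincaré inequality, itself obtained by completing the square with a tangent, gives
`a⁻² ‖∂₂φ‖² ≥ E₁ ‖φ‖²`; since `V_eff ≥ z₀ > z`, the form of `Ĥ₀ - E₁ - z` controls the norm
`‖φ‖ + ‖∂₁φ‖` uniformly in `a`, and by the comparison so does the transformed form. Lax–Milgram then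
gives the resolvents (`exists_isResolventAt_gradientForm`), and subtracting the two variational
equations and testing with the difference of the solutions gives the bound `C a`
(`ThinStrip.norm_sub_le_of_solutions`).
-/

noncomputable section

namespace QuantumStrip

/-! ### Operators associated with coercive forms -/

section FormResolvent

variable {E F : Type*} [NormedAddCommGroup E] [InnerProductSpace ℂ E]
  [NormedAddCommGroup F] [InnerProductSpace ℂ F]

/-- The pair `(ψ, η)` belongs to the graph of the operator of the form `b` on `D`. -/
def FormSolves {G : Type*} [AddCommGroup G] [Module ℂ G] (D : Submodule ℂ (E × G))
    (b : E × G →ₗ⋆[ℂ] E × G →ₗ[ℂ] ℂ) (ψ η : E) : Prop :=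
  ∃ p : G, (ψ, p) ∈ D ∧ ∀ y ∈ D, b y (ψ, p) = inner ℂ y.1 η

theorem mem_graph_formOperator {G : Type*} [AddCommGroup G] [Module ℂ G]
    {D : Submodule ℂ (E × G)} {b : E × G →ₗ⋆[ℂ] E × G →ₗ[ℂ] ℂ}
    (h0 : ∀ η, FormSolves D b 0 η → η = 0) (x : E × E) :
    x ∈ (formOperator D b).graph ↔ FormSolves D b x.1 x.2 := by
  unfold formOperator
  rw [Submodule.toLinearPMap_graph_eq]
  · rfl
  · rintro ⟨x1, x2⟩ hx hx0
    obtain rfl : x1 = 0 := hx0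
    exact h0 x2 hx

/-- A bounded form-solution operator is the resolvent of the operator of the form. Single-valuedness
of the graph only needs density of the form domain and definiteness of the form on the vectors
`(0, p)`; closability is not needed separately. -/
theorem exists_isResolventAt_formOperator {G : Type*} [AddCommGroup G] [Module ℂ G]
    {D : Submodule ℂ (E × G)} {b : E × G →ₗ⋆[ℂ] E × G →ₗ[ℂ] ℂ} {z : ℂ} {c : ℝ} (hc : 0 < c)
    (hdense : ∀ η : E, (∀ y ∈ D, inner ℂ y.1 η = 0) → η = 0)
    (hdef : ∀ p, ((0 : E), p) ∈ D → b (0, p) (0, p) = 0 → p = 0)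
    (hcoer : ∀ x ∈ D, c * ‖x.1‖ ^ 2 ≤ (b x x - z * inner ℂ x.1 x.1).re)
    (hsolve : ∀ F : E, ∃ x ∈ D, ∀ y ∈ D, b y x - z * inner ℂ y.1 x.1 = inner ℂ y.1 F) :
    ∃ R : E →L[ℂ] E, IsResolventAt (formOperator D b) z R ∧
      ∀ F, ∃ p, (R F, p) ∈ D ∧
        ∀ y ∈ D, b y (R F, p) - z * inner ℂ y.1 (R F) = inner ℂ y.1 F := by
  have h0 : ∀ η, FormSolves D b 0 η → η = 0 := by
    rintro η ⟨p, hp, h⟩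
    have hp0 : p = 0 := hdef p hp (by rw [h _ hp]; simp)
    subst hp0
    refine hdense η fun y hy => ?_
    rw [← h y hy]
    exact map_zero (b y)
  have huniq : ∀ x ∈ D, ∀ F : E, (∀ y ∈ D, b y x - z * inner ℂ y.1 x.1 = inner ℂ y.1 F) →
      c * ‖x.1‖ ≤ ‖F‖ := by
    intro x hx F h
    have h1 := hcoer x hx
    rw [h x hx] at h1
    have h2 : (inner ℂ x.1 F).re ≤ ‖x.1‖ * ‖F‖ := re_inner_le_norm (𝕜 := ℂ) x.1 F
    rcases (norm_nonneg x.1).eq_or_lt with h3 | h3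
    · rw [← h3, mul_zero]
      exact norm_nonneg F
    · nlinarith
  choose X hXD hX using hsolve
  have key : ∀ x ∈ D, ∀ F : E, (∀ y ∈ D, b y x - z * inner ℂ y.1 x.1 = inner ℂ y.1 F) →
      x.1 = (X F).1 := by
    intro x hx F h
    have h1 := huniq (x - X F) (D.sub_mem hx (hXD F)) 0 (by
      intro y hy
      have e1 := h y hy
      have e2 := hX F y hy
      rw [map_sub, Prod.fst_sub, inner_sub_right, inner_zero_right]
      linear_combination e1 - e2)
    rw [norm_zero, Prod.fst_sub] at h1
    have h2 : ‖x.1 - (X F).1‖ = 0 := by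
      have := norm_nonneg (x.1 - (X F).1)
      nlinarith
    exact sub_eq_zero.1 (norm_eq_zero.1 h2)
  let R₀ : E →ₗ[ℂ] E :=
    { toFun := fun F => (X F).1
      map_add' := fun F F' => by
        refine (key (X F + X F') (D.add_mem (hXD F) (hXD F')) (F + F') fun y hy => ?_).symm
        rw [map_add, Prod.fst_add, inner_add_right, inner_add_right, ← hX F y hy, ← hX F' y hy]
        ring
      map_smul' := fun r F => by
        refine (key (r • X F) (D.smul_mem r (hXD F)) (r • F) fun y hy => ?_).symm
        rw [map_smul, Prod.smul_fst, inner_smul_right, inner_smul_right, ← hX F y hy, smul_eq_mul]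
        ring }
  let R : E →L[ℂ] E := R₀.mkContinuous c⁻¹ fun F => by
    have := huniq (X F) (hXD F) F (hX F)
    change ‖(X F).1‖ ≤ _
    rw [inv_mul_eq_div, le_div_iff₀ hc]
    linarith
  have hgraph := mem_graph_formOperator h0
  refine ⟨R, ⟨fun F => ?_, fun y => ?_⟩, fun F => ⟨(X F).2, hXD F, hX F⟩⟩
  · have h1 : FormSolves D b (R F) (F + z • R F) := by
      refine ⟨(X F).2, hXD F, fun y hy => ?_⟩
      rw [inner_add_right, inner_smul_right, ← hX F y hy]
      change b y (X F) = b y (X F) - z * inner ℂ y.1 (X F).1 + z * inner ℂ y.1 (X F).1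
      ring
    have h2 := (hgraph (R F, F + z • R F)).2 h1
    rw [LinearPMap.mem_graph_iff] at h2
    obtain ⟨w, hw1, hw2⟩ := h2
    dsimp only at hw1 hw2
    have hm : R F ∈ (formOperator D b).domain := hw1 ▸ w.2
    refine ⟨hm, ?_⟩
    have : (⟨R F, hm⟩ : (formOperator D b).domain) = w := Subtype.ext hw1.symm
    rw [this, hw2, add_sub_cancel_right]
  · obtain ⟨p, hp, h⟩ := (hgraph _).1 ((formOperator D b).mem_graph y)
    refine (key ((y : E), p) hp _ fun w hw => ?_).symm
    rw [inner_sub_right, inner_smul_right, ← h w hw]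

end FormResolvent

section Transport

variable {E F : Type*} [NormedAddCommGroup E] [InnerProductSpace ℂ E]
  [NormedAddCommGroup F] [InnerProductSpace ℂ F]

theorem IsResolventAt.resolvent_eq {A : E →ₗ.[ℂ] E} {z : ℂ} {R : E →L[ℂ] E}
    (h : IsResolventAt A z R) : resolvent A z = R :=
  (isResolventAt_resolvent ⟨R, h⟩).unique h

theorem IsResolventAt.subScalar {A : E →ₗ.[ℂ] E} {c z : ℂ} {R : E →L[ℂ] E}
    (h : IsResolventAt A (c + z) R) : IsResolventAt (subScalar A c) z R := by
  have happ : ∀ y : A.domain, (QuantumStrip.subScalar A c) y - z • (y : E)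
      = A y - (c + z) • (y : E) := by
    intro y
    change (A y - c • (y : E)) - z • (y : E) = _
    rw [add_smul]
    abel
  refine ⟨fun x => ?_, fun y => ?_⟩
  · obtain ⟨hx, e⟩ := h.1 x
    exact ⟨hx, (happ ⟨R x, hx⟩).trans e⟩
  · exact (congrArg R (happ y)).trans (h.2 y)

/-- The bounded operator `U R U⁻¹`. -/
def conjCLM (U : E ≃ₗᵢ[ℂ] F) (R : E →L[ℂ] E) : F →L[ℂ] F :=
  (U.toContinuousLinearEquiv : E →L[ℂ] F) ∘L R ∘L (U.symm.toContinuousLinearEquiv : F →L[ℂ] E)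

theorem conjCLM_apply (U : E ≃ₗᵢ[ℂ] F) (R : E →L[ℂ] E) (x : F) :
    conjCLM U R x = U (R (U.symm x)) := rfl

theorem IsResolventAt.unitaryConj {A : E →ₗ.[ℂ] E} {z : ℂ} {R : E →L[ℂ] E}
    (U : E ≃ₗᵢ[ℂ] F) (h : IsResolventAt A z R) :
    IsResolventAt (unitaryConj U A) z (conjCLM U R) := by
  refine ⟨fun x => ?_, fun y => ?_⟩
  · obtain ⟨hx, e⟩ := h.1 (U.symm x)
    have e0 : U.symm (conjCLM U R x) = R (U.symm x) := by simp [conjCLM_apply]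
    have hx' : U.symm (conjCLM U R x) ∈ A.domain := e0 ▸ hx
    refine ⟨hx', ?_⟩
    change U (A ⟨U.symm (conjCLM U R x), hx'⟩) - z • conjCLM U R x = x
    have e1 : (⟨U.symm (conjCLM U R x), hx'⟩ : A.domain) = ⟨R (U.symm x), hx⟩ := Subtype.ext e0
    rw [e1, conjCLM_apply, ← map_smul, ← map_sub, e, U.apply_symm_apply]
  · change conjCLM U R (U (A ⟨U.symm (y : F), y.2⟩) - z • (y : F)) = y
    have := h.2 ⟨U.symm (y : F), y.2⟩
    rw [conjCLM_apply, map_sub, map_smul, U.symm_apply_apply]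
    dsimp only at this
    rw [this, U.apply_symm_apply]

end Transport

theorem re_inner_self_eq {E : Type*} [NormedAddCommGroup E] [InnerProductSpace ℂ E] (x : E) :
    (inner ℂ x x).re = ‖x‖ ^ 2 :=
  inner_self_eq_norm_sq (𝕜 := ℂ) x

section LaxMilgram

variable {E E₁ E₂ : Type*} [NormedAddCommGroup E] [InnerProductSpace ℂ E] [CompleteSpace E]
  [NormedAddCommGroup E₁] [InnerProductSpace ℂ E₁] [CompleteSpace E₁]
  [NormedAddCommGroup E₂] [InnerProductSpace ℂ E₂] [CompleteSpace E₂]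

/-- Lax–Milgram for a bounded coercive operator `A` compressed to a closed subspace. -/
theorem exists_form_solution_of_coercive {X : Type*} [NormedAddCommGroup X] [InnerProductSpace ℂ X]
    [CompleteSpace X] (W : Submodule ℂ X) (hW : IsClosed (W : Set X)) (A : X →L[ℂ] X) {c : ℝ}
    (hc : 0 < c) (h : ∀ x ∈ W, c * ‖x‖ ^ 2 ≤ (inner ℂ x (A x)).re) (g : X) :
    ∃ x ∈ W, ∀ y ∈ W, inner ℂ y (A x) = inner ℂ y g := by
  have : CompleteSpace W := hW.completeSpace_coe
  let B : W →L[ℂ] W := W.orthogonalProjectionOnto ∘L A ∘L W.subtypeL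
  have hB : ∀ y x : W, inner ℂ y (B x) = inner ℂ (y : X) (A x) := by
    intro y x
    have := Submodule.inner_orthogonalProjectionOnto_eq_of_mem_left (K := W) y (A (x : X))
    exact this
  have hu : IsUnit B := by
    refine ContinuousLinearMap.isUnit_of_forall_le_norm_inner_map B (c := ⟨c, hc.le⟩) hc ?_
    intro x
    rw [norm_inner_symm, hB]
    refine le_trans ?_ (Complex.re_le_norm _)
    have := h x x.2
    change ‖(x : X)‖ ^ 2 * c ≤ _
    linarith
  obtain ⟨B', hB'⟩ := hu.exists_right_inv
  let x := B' (W.orthogonalProjectionOnto g)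
  refine ⟨x, x.2, fun y hy => ?_⟩
  have h1 : B x = W.orthogonalProjectionOnto g :=
    DFunLike.congr_fun hB' (W.orthogonalProjectionOnto g)
  rw [← hB ⟨y, hy⟩ x, h1]
  exact Submodule.inner_orthogonalProjectionOnto_eq_of_mem_left (K := W) ⟨y, hy⟩ g

/-- Solvability of the variational problem of a coercive form
`α ⟪y₁, x₁⟫ + β ⟪y₂, x₂⟫ + ⟪y₀, V x₀⟫ - z ⟪y₀, x₀⟫` on a closed space of triples. -/
theorem exists_gradient_form_solution (D : Submodule ℂ (E × E₁ × E₂))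
    (hD : IsClosed (D : Set (E × E₁ × E₂))) (α β z : ℝ) (V : E →L[ℂ] E) {c : ℝ} (hc : 0 < c)
    (h : ∀ x ∈ D, c * (‖x.1‖ ^ 2 + ‖x.2.1‖ ^ 2 + ‖x.2.2‖ ^ 2) ≤
      α * ‖x.2.1‖ ^ 2 + β * ‖x.2.2‖ ^ 2 + (inner ℂ x.1 (V x.1)).re - z * ‖x.1‖ ^ 2) (F : E) :
    ∃ x ∈ D, ∀ y ∈ D, (α : ℂ) * inner ℂ y.2.1 x.2.1 + (β : ℂ) * inner ℂ y.2.2 x.2.2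
      + inner ℂ y.1 (V x.1) - (z : ℂ) * inner ℂ y.1 x.1 = inner ℂ y.1 F := by
  let T : WithLp 2 (E × WithLp 2 (E₁ × E₂)) ≃L[ℂ] E × E₁ × E₂ :=
    (WithLp.prodContinuousLinearEquiv 2 ℂ E (WithLp 2 (E₁ × E₂))).trans
      ((ContinuousLinearEquiv.refl ℂ E).prodCongr (WithLp.prodContinuousLinearEquiv 2 ℂ E₁ E₂))
  have hT : ∀ x y, inner ℂ x y = inner ℂ (T x).1 (T y).1 + (inner ℂ (T x).2.1 (T y).2.1
      + inner ℂ (T x).2.2 (T y).2.2) := fun x y => by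
    rw [WithLp.prod_inner_apply, WithLp.prod_inner_apply]
    rfl
  let A₀ : E × E₁ × E₂ →L[ℂ] E × E₁ × E₂ :=
    (V - (z : ℂ) • ContinuousLinearMap.id ℂ E).prodMap
      (((α : ℂ) • ContinuousLinearMap.id ℂ E₁).prodMap ((β : ℂ) • ContinuousLinearMap.id ℂ E₂))
  let A : WithLp 2 (E × WithLp 2 (E₁ × E₂)) →L[ℂ] WithLp 2 (E × WithLp 2 (E₁ × E₂)) :=
    (T.symm : _ →L[ℂ] _) ∘L A₀ ∘L (T : _ →L[ℂ] _)
  have hTA : ∀ x, T (A x) = A₀ (T x) := fun x => T.apply_symm_apply _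
  have hin : ∀ y x, inner ℂ y (A x) = (α : ℂ) * inner ℂ (T y).2.1 (T x).2.1
      + (β : ℂ) * inner ℂ (T y).2.2 (T x).2.2
      + inner ℂ (T y).1 (V (T x).1) - (z : ℂ) * inner ℂ (T y).1 (T x).1 := by
    intro y x
    rw [hT, hTA]
    change inner ℂ (T y).1 (V (T x).1 - (z : ℂ) • (T x).1) +
      (inner ℂ (T y).2.1 ((α : ℂ) • (T x).2.1) + inner ℂ (T y).2.2 ((β : ℂ) • (T x).2.2)) = _
    rw [inner_sub_right, inner_smul_right, inner_smul_right, inner_smul_right]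
    ring
  let W : Submodule ℂ (WithLp 2 (E × WithLp 2 (E₁ × E₂))) :=
    D.comap (T.toLinearEquiv : WithLp 2 (E × WithLp 2 (E₁ × E₂)) →ₗ[ℂ] E × E₁ × E₂)
  have hcl : IsClosed (W : Set (WithLp 2 (E × WithLp 2 (E₁ × E₂)))) := hD.preimage T.continuous
  obtain ⟨x, hx, hxy⟩ := exists_form_solution_of_coercive W hcl A hc (fun x hx => by
    have h1 := h (T x) hx
    have h2 : ‖x‖ ^ 2 = ‖(T x).1‖ ^ 2 + ‖(T x).2.1‖ ^ 2 + ‖(T x).2.2‖ ^ 2 := by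
      have h3 := congrArg Complex.re (hT x x)
      simp only [re_inner_self_eq, Complex.add_re] at h3
      linarith
    rw [hin, h2]
    refine h1.trans (le_of_eq ?_)
    simp only [re_inner_self_eq, Complex.add_re, Complex.sub_re, Complex.re_ofReal_mul])
    (T.symm (F, 0, 0))
  refine ⟨T x, hx, fun y hy => ?_⟩
  have h1 := hxy (T.symm y) (by
    change T (T.symm y) ∈ D
    rwa [T.apply_symm_apply])
  rw [hin, hT, T.apply_symm_apply, T.apply_symm_apply] at h1
  rw [h1]
  simp

end LaxMilgram

/-! ### Lipschitz functions with compact support belong to the Dirichlet space -/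

section Mollification

open Filter Topology Convolution ContinuousLinearMap
open scoped NNReal

/-- Dominated convergence in `L²`. -/
theorem tendsto_toLp_of_dominated {α : Type*} [MeasurableSpace α] {μ : Measure α}
    {f : ℕ → α → ℂ} {f₀ : α → ℂ} {g : α → ℝ} (hg : MemLp g 2 μ)
    (hf : ∀ n, AEStronglyMeasurable (f n) μ) (hb : ∀ n, ∀ᵐ x ∂μ, ‖f n x‖ ≤ g x)
    (hlim : ∀ᵐ x ∂μ, Tendsto (fun n => f n x) atTop (𝓝 (f₀ x))) :
    ∃ (h : ∀ n, MemLp (f n) 2 μ) (h₀ : MemLp f₀ 2 μ),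
      Tendsto (fun n => (h n).toLp (f n)) atTop (𝓝 (h₀.toLp f₀)) := by
  have hm₀ : AEStronglyMeasurable f₀ μ := aestronglyMeasurable_of_tendsto_ae atTop hf hlim
  have hb₀ : ∀ᵐ x ∂μ, ‖f₀ x‖ ≤ g x := by
    filter_upwards [hlim, ae_all_iff.2 hb] with x h1 h2
    exact le_of_tendsto h1.norm (Eventually.of_forall h2)
  have h₀ : MemLp f₀ 2 μ := hg.mono' hm₀ hb₀
  refine ⟨fun n => hg.mono' (hf n) (hb n), h₀, ?_⟩
  rw [Lp.tendsto_Lp_iff_tendsto_eLpNorm'']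
  have key : Tendsto (fun n => ∫⁻ x, ‖f n x - f₀ x‖ₑ ^ (2 : ℝ) ∂μ) atTop (𝓝 0) := by
    have hzero : (∫⁻ _ : α, (0 : ℝ≥0∞) ∂μ) = 0 := lintegral_zero
    rw [← hzero]
    refine tendsto_lintegral_of_dominated_convergence'
      (fun x => ‖2 * g x‖ₑ ^ (2 : ℝ)) (fun n => ?_) (fun n => ?_) ?_ ?_
    · exact ((hf n).sub hm₀).enorm.pow_const _
    · filter_upwards [hb n, hb₀] with x h1 h2
      refine ENNReal.rpow_le_rpow ?_ (by norm_num)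
      rw [← ofReal_norm, ← ofReal_norm]
      refine ENNReal.ofReal_le_ofReal ((norm_sub_le _ _).trans ?_)
      rw [Real.norm_eq_abs]
      exact le_trans (by linarith) (le_abs_self _)
    · have h2 := (hg.const_mul 2).2
      rw [eLpNorm_lt_top_iff_lintegral_rpow_enorm_lt_top (by simp) (by simp)] at h2
      simpa using h2.ne
    · filter_upwards [hlim] with x hx
      have h1 : Tendsto (fun n => f n x - f₀ x) atTop (𝓝 0) := by
        simpa using hx.sub_const (f₀ x)
      have h2 := (ENNReal.continuous_rpow_const (y := (2 : ℝ))).tendsto 0 |>.comp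
        (by simpa using h1.enorm)
      simpa [Function.comp_def] using h2
  have h3 := (ENNReal.continuous_rpow_const (y := (1 / 2 : ℝ))).tendsto 0 |>.comp key
  simp only [one_div, inv_pos, Nat.ofNat_pos, ENNReal.zero_rpow_of_pos] at h3
  refine h3.congr fun n => ?_
  rw [eLpNorm_eq_lintegral_rpow_enorm_toReal (by simp) (by simp)]
  simp

variable {χ : ℝ × ℝ → ℂ} {L : ℝ≥0}

/-- Differentiation of a mollification falls on the Lipschitz factor. -/
theorem fderiv_mollification (hχ : LipschitzWith L χ) (hc : HasCompactSupport χ)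
    (φ : ContDiffBump (0 : ℝ × ℝ)) (x v : ℝ × ℝ) :
    fderiv ℝ (φ.normed volume ⋆[lsmul ℝ ℝ, volume] χ) x v =
      (φ.normed volume ⋆[lsmul ℝ ℝ, volume] (fun y => fderiv ℝ χ y v)) x := by
  have hφi : Integrable (φ.normed volume) volume := φ.integrable_normed
  have hcont := hχ.continuous
  have hφc : Continuous (φ.normed volume) := φ.continuous_normed
  obtain ⟨C, hC⟩ : ∃ C, ∀ y, ‖χ y‖ ≤ C := hc.exists_bound_of_continuous hcont
  obtain ⟨hi, hd⟩ := hasFDerivAt_integral_of_dominated_loc_of_lip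
    (F := fun x t => φ.normed volume t • χ (x - t))
    (F' := fun t => φ.normed volume t • fderiv ℝ χ (x - t))
    (bound := fun t => φ.normed volume t * L) (x₀ := x) (μ := volume) (s := univ)
    univ_mem
    (Eventually.of_forall fun y => by
      exact (hφc.smul (hcont.comp (continuous_const.sub continuous_id))).aestronglyMeasurable)
    (by
      refine (hφi.mul_const C).mono'
        (hφc.smul (hcont.comp (continuous_const.sub continuous_id))).aestronglyMeasurable ?_
      filter_upwards with t
      rw [norm_smul, Real.norm_of_nonneg (φ.nonneg_normed t)]
      exact mul_le_mul_of_nonneg_left (hC _) (φ.nonneg_normed t))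
    (by
      refine hφc.aestronglyMeasurable.smul ?_
      exact ((measurable_fderiv ℝ χ).comp
        (measurable_const.sub measurable_id)).aestronglyMeasurable)
    (Eventually.of_forall fun t => by
      refine LipschitzWith.lipschitzOnWith (LipschitzWith.of_dist_le_mul fun y y' => ?_)
      have h1 := hχ.dist_le_mul (y - t) (y' - t)
      rw [dist_sub_right] at h1
      rw [dist_eq_norm, ← smul_sub, norm_smul, Real.norm_of_nonneg (φ.nonneg_normed t),
        ← dist_eq_norm, Real.coe_nnabs,
        abs_of_nonneg (mul_nonneg (φ.nonneg_normed (μ := volume) t) L.coe_nonneg),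
        mul_assoc]
      exact mul_le_mul_of_nonneg_left h1 (φ.nonneg_normed t))
    (hφi.mul_const _)
    (by
      have h1 : ∀ᵐ y : ℝ × ℝ, DifferentiableAt ℝ χ y := hχ.ae_differentiableAt
      filter_upwards [(quasiMeasurePreserving_sub_left volume x).ae h1] with t ht
      have h2 : HasFDerivAt (fun y => χ (y - t)) (fderiv ℝ χ (x - t)) x := by
        have := ht.hasFDerivAt.comp x ((hasFDerivAt_id x).sub_const t)
        simpa [Function.comp_def] using this
      exact h2.const_smul (φ.normed volume t))
  have h2 : HasFDerivAt (φ.normed volume ⋆[lsmul ℝ ℝ, volume] χ)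
      (∫ t, φ.normed volume t • fderiv ℝ χ (x - t)) x := hd
  rw [h2.fderiv, ContinuousLinearMap.integral_apply hi]
  rfl

theorem norm_mollification_le {g : ℝ × ℝ → ℂ} (hg : Measurable g) {C : ℝ} (hC : ∀ y, ‖g y‖ ≤ C)
    (φ : ContDiffBump (0 : ℝ × ℝ)) (x : ℝ × ℝ) :
    ‖(φ.normed volume ⋆[lsmul ℝ ℝ, volume] g) x‖ ≤ C := by
  have h2 := dist_convolution_le (μ := volume) (g := g) (x₀ := x) (z₀ := (0 : ℂ)) (R := φ.rOut)
    ((norm_nonneg _).trans (hC 0)) φ.support_normed_eq.subset φ.nonneg_normed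
    φ.integral_normed hg.aestronglyMeasurable (fun y _ => by simpa using hC y)
  simpa using h2

/-- A Lipschitz function with compact support in `O` and its almost everywhere gradient form an
element of the Dirichlet space. -/
theorem mem_dirichletSpace_of_lipschitz {O : Set (ℝ × ℝ)} (hO : IsOpen O)
    {μ μ₁ μ₂ : Measure (ℝ × ℝ)} (hμ : μ ≪ volume) (hμ₁ : μ₁ ≪ volume) (hμ₂ : μ₂ ≪ volume)
    [IsFiniteMeasureOnCompacts μ] [IsFiniteMeasureOnCompacts μ₁] [IsFiniteMeasureOnCompacts μ₂]
    (hχ : LipschitzWith L χ) (hc : HasCompactSupport χ) (hs : tsupport χ ⊆ O)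
    (x : Lp ℂ 2 μ × Lp ℂ 2 μ₁ × Lp ℂ 2 μ₂) (h0 : x.1 =ᵐ[μ] χ)
    (h1 : ∀ᵐ p ∂μ₁, HasDerivAt (fun s => χ (s, p.2)) (x.2.1 p) p.1)
    (h2 : ∀ᵐ p ∂μ₂, HasDerivAt (fun t => χ (p.1, t)) (x.2.2 p) p.2) :
    x ∈ dirichletSpace O μ μ₁ μ₂ := by
  have hcont := hχ.continuous
  have hae : ∀ᵐ y : ℝ × ℝ, DifferentiableAt ℝ χ y := hχ.ae_differentiableAt
  have h1' : x.2.1 =ᵐ[μ₁] d₁ χ := by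
    filter_upwards [h1, hμ₁.ae_le hae] with p hp hd
    have hl : HasDerivAt (fun s : ℝ => (s, p.2)) ((1 : ℝ), (0 : ℝ)) p.1 :=
      (hasDerivAt_id p.1).prodMk (hasDerivAt_const p.1 p.2)
    exact hp.unique (hd.hasFDerivAt.comp_hasDerivAt p.1 hl)
  have h2' : x.2.2 =ᵐ[μ₂] d₂ χ := by
    filter_upwards [h2, hμ₂.ae_le hae] with p hp hd
    have hl : HasDerivAt (fun t : ℝ => (p.1, t)) ((0 : ℝ), (1 : ℝ)) p.2 :=
      (hasDerivAt_const p.2 p.1).prodMk (hasDerivAt_id p.2)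
    exact hp.unique (hd.hasFDerivAt.comp_hasDerivAt p.2 hl)
  -- mollify at scales `δ / (n + 1)`, where the `δ`-neighbourhood of the support lies in `O`
  obtain ⟨δ, hδ, hδO⟩ := hc.isCompact.exists_cthickening_subset_open hO hs
  let φ : ℕ → ContDiffBump (0 : ℝ × ℝ) := fun n =>
    ⟨δ / (n + 1) / 2, δ / (n + 1), by positivity, half_lt_self (by positivity)⟩
  have hφlim : Tendsto (fun n => (φ n).rOut) atTop (𝓝 0) :=
    tendsto_const_div_atTop_nhds_zero_nat δ |>.comp (tendsto_add_atTop_nat 1) |>.congr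
      fun n => by simp [φ]
  have hφ2 : ∀ᶠ n in atTop, (φ n).rOut ≤ 2 * (φ n).rIn :=
    Eventually.of_forall fun n => by simp only [φ]; linarith
  have hφδ : ∀ n, (φ n).rOut ≤ δ := fun n => by
    simp only [φ]
    exact div_le_self hδ.le (by linarith [n.cast_nonneg (α := ℝ)])
  let K := Metric.cthickening δ (tsupport χ)
  have hK : IsCompact K := hc.isCompact.cthickening
  let m : (ℝ × ℝ → ℂ) → ℕ → ℝ × ℝ → ℂ := fun g n =>
    (φ n).normed volume ⋆[lsmul ℝ ℝ, volume] g
  have hm0 : ∀ g : ℝ × ℝ → ℂ, (∀ y, y ∉ tsupport χ → g y = 0) → ∀ n y, y ∉ K → m g n y = 0 := by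
    intro g hg n y hy
    by_contra hne
    have h3 := support_convolution_subset_swap (lsmul ℝ ℝ) (Function.mem_support.2 hne)
    obtain ⟨u, hu, w, hw, rfl⟩ := h3
    refine hy (Metric.mem_cthickening_of_dist_le _ u δ _ (by_contra fun h => hu (hg u h)) ?_)
    rw [(φ n).support_normed_eq, mem_ball_zero_iff] at hw
    simpa using hw.le.trans (hφδ n)
  have hsm : ∀ n, ContDiff ℝ ∞ (m χ n) := fun n =>
    (φ n).hasCompactSupport_normed.contDiff_convolution_left _ (φ n).contDiff_normed
      hcont.locallyIntegrable
  have htest : ∀ n, IsTestFunction O (m χ n) := fun n => by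
    have hsub : tsupport (m χ n) ⊆ K := closure_minimal (fun y hy => by_contra fun h =>
      hy (hm0 χ (fun y hy => image_eq_zero_of_notMem_tsupport hy) n y h)) hK.isClosed
    exact ⟨hsm n, hK.of_isClosed_subset isClosed_closure hsub, hsub.trans hδO⟩
  -- every component converges by dominated convergence, with majorant a constant on `K`
  have hconv : ∀ (ν : Measure (ℝ × ℝ)) (_ : ν ≪ volume) (_ : IsFiniteMeasureOnCompacts ν)
      (g : ℝ × ℝ → ℂ) (_ : Measurable g) (_ : ∀ y, y ∉ tsupport χ → g y = 0) (C : ℝ)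
      (_ : ∀ y, ‖g y‖ ≤ C) (_ : ∀ n, Continuous (m g n)) (w : Lp ℂ 2 ν) (_ : w =ᵐ[ν] g),
      ∃ f : ℕ → Lp ℂ 2 ν, (∀ n, f n =ᵐ[ν] m g n) ∧ Tendsto f atTop (𝓝 w) := by
    intro ν hν _ g hg hg0 C hC hgc w hw
    have hloc : LocallyIntegrable g volume := by
      intro y
      exact ⟨_, Metric.closedBall_mem_nhds y one_pos, Measure.integrableOn_of_bounded (M := C)
        (isCompact_closedBall y 1).measure_lt_top.ne hg.aestronglyMeasurable
        (Eventually.of_forall hC)⟩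
    obtain ⟨h, h₀, hlim⟩ := tendsto_toLp_of_dominated (μ := ν) (f := m g) (f₀ := g)
      (g := K.indicator fun _ => C)
      (memLp_indicator_const 2 hK.measurableSet C (Or.inr hK.measure_lt_top.ne))
      (fun n => (hgc n).aestronglyMeasurable)
      (fun n => Eventually.of_forall fun y => by
        by_cases hy : y ∈ K
        · rw [indicator_of_mem hy]
          exact norm_mollification_le hg hC (φ n) y
        · rw [indicator_of_notMem hy, hm0 g hg0 n y hy, norm_zero])
      (hν.ae_le (ContDiffBump.ae_convolution_tendsto_right_of_locallyIntegrable hφlim hφ2 hloc))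
    refine ⟨fun n => (h n).toLp _, fun n => (h n).coeFn_toLp, ?_⟩
    have : w = h₀.toLp g := Lp.ext (hw.trans h₀.coeFn_toLp.symm)
    rwa [this]
  have hfd0 : ∀ v y, y ∉ tsupport χ → fderiv ℝ χ y v = 0 := fun v y hy => by
    have : fderiv ℝ χ y = 0 := by
      by_contra h
      exact hy (support_fderiv_subset ℝ h)
    rw [this]
    rfl
  have hfdb : ∀ v : ℝ × ℝ, ‖v‖ ≤ 1 → ∀ y, ‖fderiv ℝ χ y v‖ ≤ L := fun v hv y => by
    have := (fderiv ℝ χ y).le_of_opNorm_le (norm_fderiv_le_of_lipschitz ℝ hχ) v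
    exact this.trans (mul_le_of_le_one_right L.coe_nonneg hv)
  have hfdm : ∀ v : ℝ × ℝ, Measurable fun y => fderiv ℝ χ y v := measurable_fderiv_apply_const ℝ χ
  have hfde : ∀ v n, m (fun y => fderiv ℝ χ y v) n = fun y => fderiv ℝ (m χ n) y v := fun v n =>
    funext fun y => (fderiv_mollification hχ hc (φ n) y v).symm
  have hfdc : ∀ v n, Continuous (m (fun y => fderiv ℝ χ y v) n) := fun v n => by
    rw [hfde]
    exact ((hsm n).continuous_fderiv (by simp)).clm_apply continuous_const
  obtain ⟨C, hC⟩ : ∃ C, ∀ y, ‖χ y‖ ≤ C := hc.exists_bound_of_continuous hcont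
  obtain ⟨f0, e0, l0⟩ := hconv μ hμ inferInstance χ hcont.measurable
    (fun y hy => image_eq_zero_of_notMem_tsupport hy) C hC (fun n => (hsm n).continuous) x.1 h0
  obtain ⟨f1, e1, l1⟩ := hconv μ₁ hμ₁ inferInstance (d₁ χ) (hfdm _) (hfd0 _) L
    (hfdb _ (by simp [Prod.norm_def])) (hfdc _) x.2.1 h1'
  obtain ⟨f2, e2, l2⟩ := hconv μ₂ hμ₂ inferInstance (d₂ χ) (hfdm _) (hfd0 _) L
    (hfdb _ (by simp [Prod.norm_def])) (hfdc _) x.2.2 h2'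
  refine mem_closure_of_tendsto (l0.prodMk_nhds (l1.prodMk_nhds l2))
    (Eventually.of_forall fun n => ?_)
  refine ⟨m χ n, htest n, e0 n, (e1 n).trans ?_, (e2 n).trans ?_⟩
  · exact Eventually.of_forall fun y => congrFun (hfde (1, 0) n) y
  · exact Eventually.of_forall fun y => congrFun (hfde (0, 1) n) y

end Mollification

/-! ### Integration by parts and multiplication operators on the strip -/

section Strip

open Filter Topology

theorem isOpen_strip : IsOpen strip := isOpen_univ.prod isOpen_Ioo

theorem stripMeasure_ac : stripMeasure ≪ volume := Measure.absolutelyContinuous_restrict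

instance : IsFiniteMeasureOnCompacts stripMeasure := by
  unfold stripMeasure
  infer_instance

theorem ae_mem_strip : ∀ᵐ p ∂stripMeasure, p ∈ strip := ae_restrict_mem isOpen_strip.measurableSet

theorem ae_stripMeasure_of_ae_fst {P : ℝ → Prop} (h : ∀ᵐ s, P s) :
    ∀ᵐ p ∂stripMeasure, P p.1 := by
  refine ae_restrict_of_ae ?_
  rw [Measure.volume_eq_prod]
  exact Measure.quasiMeasurePreserving_fst.ae h

theorem hasDerivAt_slice_snd {g : ℝ × ℝ → ℂ} {p : ℝ × ℝ} (hd : DifferentiableAt ℝ g p) :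
    HasDerivAt (fun t => g (p.1, t)) (d₂ g p) p.2 :=
  hd.hasFDerivAt.comp_hasDerivAt p.2 ((hasDerivAt_const p.2 p.1).prodMk (hasDerivAt_id p.2))

theorem hasDerivAt_slice_fst {g : ℝ × ℝ → ℂ} {p : ℝ × ℝ} (hd : DifferentiableAt ℝ g p) :
    HasDerivAt (fun s => g (s, p.2)) (d₁ g p) p.1 :=
  hd.hasFDerivAt.comp_hasDerivAt p.1 ((hasDerivAt_id p.1).prodMk (hasDerivAt_const p.1 p.2))

theorem IsTestFunction.differentiable {O : Set (ℝ × ℝ)} {g : ℝ × ℝ → ℂ}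
    (hg : IsTestFunction O g) : Differentiable ℝ g :=
  hg.1.differentiable (by simp)

theorem IsTestFunction.continuous_d₁ {O : Set (ℝ × ℝ)} {g : ℝ × ℝ → ℂ}
    (hg : IsTestFunction O g) : Continuous (d₁ g) :=
  (hg.1.continuous_fderiv (by simp)).clm_apply continuous_const

theorem IsTestFunction.continuous_d₂ {O : Set (ℝ × ℝ)} {g : ℝ × ℝ → ℂ}
    (hg : IsTestFunction O g) : Continuous (d₂ g) :=
  (hg.1.continuous_fderiv (by simp)).clm_apply continuous_const

theorem tsupport_d₁_subset (g : ℝ × ℝ → ℂ) : tsupport (d₁ g) ⊆ tsupport g :=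
  tsupport_fderiv_apply_subset ℝ (1, 0)

theorem tsupport_d₂_subset (g : ℝ × ℝ → ℂ) : tsupport (d₂ g) ⊆ tsupport g :=
  tsupport_fderiv_apply_subset ℝ (0, 1)

/-- The partial derivative in the second variable of a compactly supported function has integral
zero; differentiability is required only in the second variable. -/
theorem integral_eq_zero_of_hasDerivAt_snd {G G' : ℝ × ℝ → ℂ} (hG : HasCompactSupport G)
    (hG' : Continuous G') (hc' : HasCompactSupport G')
    (hd : ∀ p : ℝ × ℝ, HasDerivAt (fun t => G (p.1, t)) (G' p) p.2) : ∫ p, G' p = 0 := by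
  have hint : Integrable G' (volume.prod volume) := by
    rw [← Measure.volume_eq_prod]
    exact hG'.integrable_of_hasCompactSupport hc'
  rw [Measure.volume_eq_prod, integral_prod _ hint]
  obtain ⟨R, hR⟩ := hG.isCompact.isBounded.subset_closedBall 0
  have hzero : ∀ s t : ℝ, R < |t| → G (s, t) = 0 := by
    intro s t ht
    refine image_eq_zero_of_notMem_tsupport fun h => ?_
    have h1 := hR h
    rw [mem_closedBall_zero_iff, Prod.norm_def] at h1
    exact absurd ((le_max_right _ _).trans h1) (not_le.2 ht)
  refine integral_eq_zero_of_ae ?_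
  filter_upwards [hint.prod_right_ae] with s hs
  have h1 : Tendsto (fun t => G (s, t)) atBot (𝓝 0) := by
    refine tendsto_const_nhds.congr' ?_
    filter_upwards [eventually_lt_atBot (-R), eventually_lt_atBot 0] with t ht ht0
    exact (hzero s t (by rw [abs_of_neg ht0]; linarith)).symm
  have h2 : Tendsto (fun t => G (s, t)) atTop (𝓝 0) := by
    refine tendsto_const_nhds.congr' ?_
    filter_upwards [eventually_gt_atTop R, eventually_gt_atTop 0] with t ht ht0
    exact (hzero s t (by rwa [abs_of_pos ht0])).symm
  have := integral_of_hasDerivAt_of_tendsto (fun t => hd (s, t)) hs h1 h2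
  simpa using this

/-- Integration by parts in the second variable against a weight that need only be differentiable
in that variable. -/
theorem integral_mul_d₂ {W W' : ℝ × ℝ → ℝ} (hW : ContinuousOn W strip)
    (hW' : ContinuousOn W' strip)
    (hd : ∀ p ∈ strip, HasDerivAt (fun t => W (p.1, t)) (W' p) p.2) {g : ℝ × ℝ → ℂ}
    (hg : IsTestFunction strip g) :
    ∫ p, ((W p : ℂ) * d₂ g p + (W' p : ℂ) * g p) ∂stripMeasure = 0 := by
  have hcont : ∀ (w : ℝ × ℝ → ℝ) (k : ℝ × ℝ → ℂ), ContinuousOn w strip → Continuous k →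
      tsupport k ⊆ tsupport g → Continuous (fun p => (w p : ℂ) * k p) ∧
        HasCompactSupport (fun p => (w p : ℂ) * k p) ∧
        ∀ p, p ∉ strip → (w p : ℂ) * k p = 0 := by
    intro w k hw hk hs
    have h1 : tsupport (fun p => (w p : ℂ) * k p) ⊆ tsupport g :=
      (tsupport_mul_subset_right (f := fun p => (w p : ℂ)) (g := k)).trans hs
    refine ⟨ContinuousOn.continuous_of_tsupport_subset (s := strip) ?_ isOpen_strip
      (h1.trans hg.2.2), hg.2.1.isCompact.of_isClosed_subset isClosed_closure h1, fun p hp => ?_⟩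
    · exact (Complex.continuous_ofReal.comp_continuousOn hw).mul hk.continuousOn
    · exact image_eq_zero_of_notMem_tsupport (f := fun p => (w p : ℂ) * k p)
        fun h => hp (hg.2.2 (h1 h))
  obtain ⟨c1, s1, z1⟩ := hcont W (d₂ g) hW hg.continuous_d₂ (tsupport_d₂_subset g)
  obtain ⟨c2, s2, z2⟩ := hcont W' g hW' hg.1.continuous Subset.rfl
  obtain ⟨-, s3, -⟩ := hcont W g hW hg.1.continuous Subset.rfl
  have h0 := integral_eq_zero_of_hasDerivAt_snd (G := fun p => (W p : ℂ) * g p)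
    (G' := fun p => (W p : ℂ) * d₂ g p + (W' p : ℂ) * g p) s3 (c1.add c2) (s1.add s2) (by
      intro p
      by_cases hp : p ∈ strip
      · have e1 := (hd p hp).ofReal_comp
        have e2 := e1.mul (hasDerivAt_slice_snd (hg.differentiable p))
        rw [add_comm]
        exact e2
      · have hev : ∀ᶠ t in 𝓝 p.2, (W (p.1, t) : ℂ) * g (p.1, t) = 0 := by
          have ho : IsOpen (tsupport g)ᶜ := (isClosed_tsupport g).isOpen_compl
          have hmem : (p.1, p.2) ∈ (tsupport g)ᶜ := fun h => hp (hg.2.2 h)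
          have hc : ContinuousAt (fun t : ℝ => (p.1, t)) p.2 := by fun_prop
          filter_upwards [hc.eventually (ho.mem_nhds hmem)] with t ht
          rw [image_eq_zero_of_notMem_tsupport ht, mul_zero]
        rw [z1 p hp, z2 p hp, add_zero]
        exact (hasDerivAt_const p.2 (0 : ℂ)).congr_of_eventuallyEq hev)
  unfold stripMeasure
  rw [setIntegral_eq_integral_of_forall_compl_eq_zero fun p hp => by
    rw [z1 p hp, z2 p hp, add_zero]]
  exact h0

/-- Multiplication by an essentially bounded real function, as a bounded operator in `L²(Π)`. -/
def mulOp (g : ℝ × ℝ → ℝ) (hg : MemLp (fun p => ((g p : ℝ) : ℂ)) ∞ stripMeasure) :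
    L2Strip →L[ℂ] L2Strip :=
  (ContinuousLinearMap.mul ℂ ℂ).holderL stripMeasure ∞ 2 2 (hg.toLp _)

theorem coeFn_mulOp {g : ℝ × ℝ → ℝ} (hg : MemLp (fun p => ((g p : ℝ) : ℂ)) ∞ stripMeasure)
    (x : L2Strip) : mulOp g hg x =ᵐ[stripMeasure] fun p => (g p : ℂ) * x p := by
  have h1 : mulOp g hg x =ᵐ[stripMeasure] fun p => (hg.toLp _ : Lp ℂ ∞ stripMeasure) p * x p :=
    (ContinuousLinearMap.mul ℂ ℂ).coeFn_holder (hg.toLp _) x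
  filter_upwards [h1, hg.coeFn_toLp] with p hp hp'
  rw [hp, hp']

theorem norm_mulOp_le {g : ℝ × ℝ → ℝ} (hg : MemLp (fun p => ((g p : ℝ) : ℂ)) ∞ stripMeasure)
    {C : ℝ} (hC : ∀ᵐ p ∂stripMeasure, |g p| ≤ C) (x : L2Strip) : ‖mulOp g hg x‖ ≤ C * ‖x‖ := by
  refine Lp.norm_le_mul_norm_of_ae_le_mul ?_
  filter_upwards [coeFn_mulOp hg x, hC] with p h1 h2
  rw [h1, norm_mul, Complex.norm_real, Real.norm_eq_abs]
  gcongr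

theorem norm_mulOp_sub_self_le {g : ℝ × ℝ → ℝ}
    (hg : MemLp (fun p => ((g p : ℝ) : ℂ)) ∞ stripMeasure)
    {C : ℝ} (hC : ∀ᵐ p ∂stripMeasure, |g p - 1| ≤ C) (x : L2Strip) :
    ‖mulOp g hg x - x‖ ≤ C * ‖x‖ := by
  refine Lp.norm_le_mul_norm_of_ae_le_mul ?_
  filter_upwards [Lp.coeFn_sub (mulOp g hg x) x, coeFn_mulOp hg x, hC] with p h0 h1 h2
  have : (g p : ℂ) * x p - x p = ((g p - 1 : ℝ) : ℂ) * x p := by push_cast; ring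
  rw [h0, Pi.sub_apply, h1, this, norm_mul, Complex.norm_real, Real.norm_eq_abs]
  gcongr

theorem norm_mulOp_sub_le {g h : ℝ × ℝ → ℝ}
    (hg : MemLp (fun p => ((g p : ℝ) : ℂ)) ∞ stripMeasure)
    (hh : MemLp (fun p => ((h p : ℝ) : ℂ)) ∞ stripMeasure)
    {C : ℝ} (hC : ∀ᵐ p ∂stripMeasure, |g p - h p| ≤ C) (x : L2Strip) :
    ‖mulOp g hg x - mulOp h hh x‖ ≤ C * ‖x‖ := by
  refine Lp.norm_le_mul_norm_of_ae_le_mul ?_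
  filter_upwards [Lp.coeFn_sub (mulOp g hg x) (mulOp h hh x), coeFn_mulOp hg x, coeFn_mulOp hh x,
    hC] with p h0 h1 h1' h2
  have : (g p : ℂ) * x p - (h p : ℂ) * x p = ((g p - h p : ℝ) : ℂ) * x p := by push_cast; ring
  rw [h0, Pi.sub_apply, h1, h1', this, norm_mul, Complex.norm_real, Real.norm_eq_abs]
  gcongr

theorem re_inner_mulOp_ge {g : ℝ × ℝ → ℝ}
    (hg : MemLp (fun p => ((g p : ℝ) : ℂ)) ∞ stripMeasure)
    {c : ℝ} (hc : ∀ᵐ p ∂stripMeasure, c ≤ g p) (x : L2Strip) :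
    c * ‖x‖ ^ 2 ≤ (inner ℂ x (mulOp g hg x)).re := by
  have h1 : c * ‖x‖ ^ 2 = (inner ℂ x ((c : ℂ) • x)).re := by
    rw [inner_smul_right, Complex.re_ofReal_mul, re_inner_self_eq]
  rw [h1, L2.inner_def, L2.inner_def]
  have i1 := L2.integrable_inner (𝕜 := ℂ) x ((c : ℂ) • x)
  have i2 := L2.integrable_inner (𝕜 := ℂ) x (mulOp g hg x)
  have r1 := integral_re i1
  have r2 := integral_re i2
  simp only [RCLike.re_to_complex] at r1 r2
  rw [← r1, ← r2]
  refine integral_mono_ae i1.re i2.re ?_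
  filter_upwards [Lp.coeFn_smul (c : ℂ) x, coeFn_mulOp hg x, hc] with p h1 h2 h3
  rw [h1, h2, Pi.smul_apply, smul_eq_mul, ← smul_eq_mul, ← smul_eq_mul, inner_smul_right,
    inner_smul_right, Complex.re_ofReal_mul, Complex.re_ofReal_mul, re_inner_self_eq]
  gcongr

end Strip

/-! ### The Dirichlet space of the strip -/

section DirichletStrip

open Filter Topology

theorem exists_mem_testGradients {O : Set (ℝ × ℝ)} {μ μ₁ μ₂ : Measure (ℝ × ℝ)}
    [IsFiniteMeasureOnCompacts μ] [IsFiniteMeasureOnCompacts μ₁] [IsFiniteMeasureOnCompacts μ₂]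
    {φ : ℝ × ℝ → ℂ} (hφ : IsTestFunction O φ) :
    ∃ x ∈ testGradients O μ μ₁ μ₂, x.1 =ᵐ[μ] φ := by
  have m0 : MemLp φ 2 μ := hφ.1.continuous.memLp_of_hasCompactSupport hφ.2.1
  have m1 : MemLp (d₁ φ) 2 μ₁ := hφ.continuous_d₁.memLp_of_hasCompactSupport
    (hφ.2.1.isCompact.of_isClosed_subset isClosed_closure (tsupport_d₁_subset φ))
  have m2 : MemLp (d₂ φ) 2 μ₂ := hφ.continuous_d₂.memLp_of_hasCompactSupport
    (hφ.2.1.isCompact.of_isClosed_subset isClosed_closure (tsupport_d₂_subset φ))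
  exact ⟨(m0.toLp _, m1.toLp _, m2.toLp _), ⟨φ, hφ, m0.coeFn_toLp, m1.coeFn_toLp, m2.coeFn_toLp⟩,
    m0.coeFn_toLp⟩

/-- The Sobolev space `W₀^{1,2}(Π)`, as a space of triples `(φ, ∂₁φ, ∂₂φ)`. -/
abbrev stripSobolev : Submodule ℂ (L2Strip × L2Strip × L2Strip) :=
  dirichletSpace strip stripMeasure stripMeasure stripMeasure

/-- `W₀^{1,2}(Π)` is dense in `L²(Π)`. -/
theorem eq_zero_of_forall_inner_stripSobolev (η : L2Strip)
    (h : ∀ y ∈ stripSobolev, inner ℂ y.1 η = 0) : η = 0 := by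
  have hloc : LocallyIntegrableOn η strip stripMeasure :=
    ((Lp.memLp η).locallyIntegrable (by norm_num)).locallyIntegrableOn _
  have key := isOpen_strip.ae_eq_zero_of_integral_contDiff_smul_eq_zero hloc (by
    intro g hg hc hs
    have hsub : tsupport (fun p => (g p : ℂ)) ⊆ tsupport g :=
      closure_mono fun p hp => by
        rw [Function.mem_support] at hp ⊢
        exact_mod_cast hp
    have ht : IsTestFunction strip (fun p => (g p : ℂ)) :=
      ⟨Complex.ofRealCLM.contDiff.comp hg, hc.isCompact.of_isClosed_subset isClosed_closure hsub,
        hsub.trans hs⟩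
    obtain ⟨x, hx, hxg⟩ := exists_mem_testGradients (μ := stripMeasure) (μ₁ := stripMeasure)
      (μ₂ := stripMeasure) ht
    have h1 := h x (subset_closure hx)
    rw [L2.inner_def] at h1
    rw [← h1]
    refine integral_congr_ae ?_
    filter_upwards [hxg] with p hp
    rw [hp, RCLike.inner_apply', Complex.real_smul]
    simp)
  refine Lp.ext ?_
  filter_upwards [key, ae_mem_strip, Lp.coeFn_zero ℂ 2 stripMeasure] with p h1 h2 h3
  rw [h1 h2, h3]
  rfl

theorem IsTestFunction.conj_mul {O : Set (ℝ × ℝ)} {χ φ : ℝ × ℝ → ℂ} (hχ : IsTestFunction O χ)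
    (hφ : IsTestFunction O φ) :
    IsTestFunction O (fun p => starRingEnd ℂ (χ p) * φ p) ∧
      ∀ p, d₂ (fun p => starRingEnd ℂ (χ p) * φ p) p =
        starRingEnd ℂ (d₂ χ p) * φ p + starRingEnd ℂ (χ p) * d₂ φ p := by
  have h1 : tsupport (fun p => starRingEnd ℂ (χ p) * φ p) ⊆ tsupport φ :=
    tsupport_mul_subset_right
  have hs : ContDiff ℝ ∞ (fun p => starRingEnd ℂ (χ p) * φ p) :=
    (Complex.conjCLE.contDiff.comp hχ.1).mul hφ.1
  refine ⟨⟨hs, hφ.2.1.isCompact.of_isClosed_subset isClosed_closure h1, h1.trans hφ.2.2⟩,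
    fun p => ?_⟩
  have e1 := hasDerivAt_slice_snd (hs.differentiable (by simp) p)
  have e2 := (hasDerivAt_slice_snd (hχ.differentiable p)).star.mul
    (hasDerivAt_slice_snd (hφ.differentiable p))
  exact e1.unique e2

/-- An equality of continuous functions of two elements of a Dirichlet space has to be checked on
test functions only. -/
theorem dirichletSpace_induction₂ {O : Set (ℝ × ℝ)} {μ μ₁ μ₂ : Measure (ℝ × ℝ)}
    {f g : Lp ℂ 2 μ × Lp ℂ 2 μ₁ × Lp ℂ 2 μ₂ → Lp ℂ 2 μ × Lp ℂ 2 μ₁ × Lp ℂ 2 μ₂ → ℂ}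
    (hf : Continuous fun w : (Lp ℂ 2 μ × Lp ℂ 2 μ₁ × Lp ℂ 2 μ₂) ×
      (Lp ℂ 2 μ × Lp ℂ 2 μ₁ × Lp ℂ 2 μ₂) => f w.1 w.2)
    (hg : Continuous fun w : (Lp ℂ 2 μ × Lp ℂ 2 μ₁ × Lp ℂ 2 μ₂) ×
      (Lp ℂ 2 μ × Lp ℂ 2 μ₁ × Lp ℂ 2 μ₂) => g w.1 w.2)
    (h : ∀ y ∈ testGradients O μ μ₁ μ₂, ∀ x ∈ testGradients O μ μ₁ μ₂, f y x = g y x) :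
    ∀ y ∈ dirichletSpace O μ μ₁ μ₂, ∀ x ∈ dirichletSpace O μ μ₁ μ₂, f y x = g y x := by
  intro y hy x hx
  have hmem : (y, x) ∈ closure ((testGradients O μ μ₁ μ₂ : Set _) ×ˢ
      (testGradients O μ μ₁ μ₂ : Set _)) := by
    rw [closure_prod_eq]
    exact ⟨hy, hx⟩
  have hsub : (testGradients O μ μ₁ μ₂ : Set _) ×ˢ (testGradients O μ μ₁ μ₂ : Set _) ⊆
      {w | f w.1 w.2 = g w.1 w.2} := fun w hw => h w.1 hw.1 w.2 hw.2
  exact closure_minimal hsub (isClosed_eq hf hg) hmem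

/-- Completing the square: for `V = W² - ∂₂W`,
`⟪∂₂χ + Wχ, ∂₂φ + Wφ⟫ = ⟪∂₂χ, ∂₂φ⟫ + ⟪χ, Vφ⟫`. -/
theorem inner_add_mulOp {W W' V : ℝ × ℝ → ℝ} (hW : ContinuousOn W strip)
    (hW' : ContinuousOn W' strip)
    (hd : ∀ p ∈ strip, HasDerivAt (fun t => W (p.1, t)) (W' p) p.2)
    (hV : ∀ p ∈ strip, V p = W p ^ 2 - W' p)
    (hWb : MemLp (fun p => ((W p : ℝ) : ℂ)) ∞ stripMeasure)
    (hVb : MemLp (fun p => ((V p : ℝ) : ℂ)) ∞ stripMeasure) :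
    ∀ y ∈ stripSobolev, ∀ x ∈ stripSobolev,
      inner ℂ (y.2.2 + mulOp W hWb y.1) (x.2.2 + mulOp W hWb x.1) =
        inner ℂ y.2.2 x.2.2 + inner ℂ y.1 (mulOp V hVb x.1) := by
  refine dirichletSpace_induction₂ ?_ ?_ ?_
  · have := (mulOp W hWb).continuous
    exact Continuous.inner (by fun_prop) (by fun_prop)
  · have := (mulOp V hVb).continuous
    exact (Continuous.inner (by fun_prop) (by fun_prop)).add
      (Continuous.inner (by fun_prop) (by fun_prop))
  · rintro y ⟨χ, hχ, y0, -, y2⟩ x ⟨φ, hφ, x0, -, x2⟩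
    obtain ⟨hg, hdg⟩ := hχ.conj_mul hφ
    have h0 := integral_mul_d₂ hW hW' hd hg
    rw [← sub_eq_zero, L2.inner_def, L2.inner_def, L2.inner_def,
      ← integral_add (L2.integrable_inner _ _) (L2.integrable_inner _ _),
      ← integral_sub (L2.integrable_inner _ _)
        ((L2.integrable_inner _ _).add (L2.integrable_inner _ _)), ← h0]
    refine integral_congr_ae ?_
    filter_upwards [y0, y2, x0, x2, Lp.coeFn_add y.2.2 (mulOp W hWb y.1),
      Lp.coeFn_add x.2.2 (mulOp W hWb x.1), coeFn_mulOp hWb y.1, coeFn_mulOp hWb x.1,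
      coeFn_mulOp hVb x.1, ae_mem_strip] with p a1 a2 a3 a4 a5 a6 a7 a8 a9 a10
    simp only [RCLike.inner_apply']
    rw [a5, a6, Pi.add_apply, Pi.add_apply, a7, a8, a9, a1, a2, a3, a4, hdg, hV p a10]
    simp only [map_add, map_mul, Complex.conj_ofReal]
    push_cast
    ring

theorem memLp_top_of_forall_strip {g : ℝ × ℝ → ℝ} (hg : ContinuousOn g strip) {C : ℝ}
    (hC : ∀ p ∈ strip, |g p| ≤ C) : MemLp (fun p => ((g p : ℝ) : ℂ)) ∞ stripMeasure := by
  refine memLp_top_of_bound (C := C) ?_ ?_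
  · exact ContinuousOn.aestronglyMeasurable
      (Complex.continuous_ofReal.comp_continuousOn hg) isOpen_strip.measurableSet
  · filter_upwards [ae_mem_strip] with p hp
    rw [Complex.norm_real, Real.norm_eq_abs]
    exact hC p hp

/-- The Poincaré inequality in the cross-section `(-1, 1)` with the optimal constant. It follows by
completing the square with `W = c tan (c u)`, `c < π / 2`, for which `W² - ∂₂W = -c²`. -/
theorem stripSobolev_poincare {x : L2Strip × L2Strip × L2Strip} (hx : x ∈ stripSobolev) :
    (Real.pi / 2) ^ 2 * ‖x.1‖ ^ 2 ≤ ‖x.2.2‖ ^ 2 := by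
  have key : ∀ c ∈ Ioo 0 (Real.pi / 2), c ^ 2 * ‖x.1‖ ^ 2 ≤ ‖x.2.2‖ ^ 2 := by
    rintro c ⟨hc0, hc1⟩
    have hcos0 : 0 < Real.cos c := Real.cos_pos_of_mem_Ioo ⟨by linarith, hc1⟩
    have hcos : ∀ p ∈ strip, Real.cos c ≤ Real.cos (c * p.2) := by
      rintro p ⟨-, h1, h2⟩
      rw [← Real.cos_abs (c * p.2)]
      have h3 : |c * p.2| ≤ c := by
        rw [abs_le]
        constructor <;> nlinarith
      exact Real.cos_le_cos_of_nonneg_of_le_pi (abs_nonneg _) (by linarith [Real.pi_pos]) h3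
    have hne : ∀ p ∈ strip, Real.cos (c * p.2) ≠ 0 := fun p hp => (hcos0.trans_le (hcos p hp)).ne'
    have hW : ContinuousOn (fun p : ℝ × ℝ => c * (Real.sin (c * p.2) / Real.cos (c * p.2)))
        strip := by
      refine continuousOn_const.mul (ContinuousOn.div (by fun_prop) (by fun_prop) hne)
    have hV : MemLp (fun p : ℝ × ℝ => (((fun _ => -c ^ 2 : ℝ × ℝ → ℝ) p : ℝ) : ℂ)) ∞
        stripMeasure := memLp_top_of_forall_strip continuousOn_const (C := c ^ 2) fun p _ => by
      rw [abs_neg, abs_of_nonneg (sq_nonneg c)]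
    have hWb := memLp_top_of_forall_strip hW (C := c / Real.cos c) (by
      intro p hp
      rw [abs_mul, abs_of_pos hc0, div_eq_mul_one_div c, abs_div,
        abs_of_pos (hcos0.trans_le (hcos p hp))]
      gcongr
      · exact Real.abs_sin_le_one _
      · exact hcos p hp)
    have h := inner_add_mulOp hW
      (W' := fun p => c ^ 2 + (c * (Real.sin (c * p.2) / Real.cos (c * p.2))) ^ 2)
      (continuousOn_const.add (hW.pow 2)) (by
        intro p hp
        have hl : HasDerivAt (fun t : ℝ => c * t) c p.2 := by
          simpa using (hasDerivAt_id p.2).const_mul c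
        have h1 := ((hl.sin.div hl.cos (hne p hp)).const_mul c)
        refine h1.congr_deriv ?_
        have := hne p hp
        field_simp
        ring) (V := fun _ => -c ^ 2) (fun p _ => by ring) hWb hV x hx x hx
    have h1 := congrArg Complex.re h
    rw [re_inner_self_eq, Complex.add_re, re_inner_self_eq] at h1
    have h2 : mulOp (fun _ => -c ^ 2) hV x.1 = ((-c ^ 2 : ℝ) : ℂ) • x.1 := by
      refine Lp.ext ?_
      filter_upwards [coeFn_mulOp hV x.1, Lp.coeFn_smul ((-c ^ 2 : ℝ) : ℂ) x.1] with p e1 e2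
      rw [e1, e2]
      rfl
    rw [h2, inner_smul_right, Complex.re_ofReal_mul, re_inner_self_eq] at h1
    nlinarith [sq_nonneg ‖x.2.2 + mulOp _ hWb x.1‖]
  have hlim : Tendsto (fun c : ℝ => c ^ 2 * ‖x.1‖ ^ 2) (𝓝[<] (Real.pi / 2))
      (𝓝 ((Real.pi / 2) ^ 2 * ‖x.1‖ ^ 2)) :=
    (Continuous.tendsto (by fun_prop) _).mono_left nhdsWithin_le_nhds
  refine le_of_tendsto hlim ?_
  filter_upwards [Ioo_mem_nhdsLT (by positivity : (0 : ℝ) < Real.pi / 2)] with c hc using key c hc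

end DirichletStrip

/-! ### Bounded Lipschitz functions -/

section BoundedLipschitz

open scoped NNReal

/-- `g` is bounded and Lipschitz on `O`, with a common constant. -/
def BddLipOn {X Y : Type*} [PseudoMetricSpace X] [NormedAddCommGroup Y] (O : Set X) (g : X → Y) :
    Prop :=
  ∃ C, 0 ≤ C ∧ (∀ x ∈ O, ‖g x‖ ≤ C) ∧ ∀ x ∈ O, ∀ y ∈ O, ‖g x - g y‖ ≤ C * dist x y

variable {X X' Y Y₁ Y₂ : Type*} [PseudoMetricSpace X] [PseudoMetricSpace X']
  [NormedAddCommGroup Y] [NormedAddCommGroup Y₁] [NormedAddCommGroup Y₂]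
  {O : Set X} {O' : Set X'}

theorem BddLipOn.of_locallyLipschitz {g : X → Y} (hO : IsCompact O) (hg : LocallyLipschitz g) :
    BddLipOn O g := by
  obtain ⟨K, hK⟩ := (hg.locallyLipschitzOn (s := O)).exists_lipschitzOnWith_of_compact hO
  obtain ⟨C, hC⟩ := hO.exists_bound_of_continuousOn hg.continuous.continuousOn
  refine ⟨max (max C 0) K, le_max_of_le_left (le_max_right _ _), fun x hx =>
    (hC x hx).trans (le_max_of_le_left (le_max_left _ _)), fun x hx y hy => ?_⟩
  rw [← dist_eq_norm]
  exact (hK.dist_le_mul x hx y hy).trans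
    (mul_le_mul_of_nonneg_right (le_max_right _ _) dist_nonneg)

theorem BddLipOn.bilin [NormedSpace ℝ Y] [NormedSpace ℝ Y₁] [NormedSpace ℝ Y₂]
    {g₁ : X → Y₁} {g₂ : X → Y₂} (B : Y₁ →L[ℝ] Y₂ →L[ℝ] Y) (h₁ : BddLipOn O g₁)
    (h₂ : BddLipOn O g₂) : BddLipOn O fun x => B (g₁ x) (g₂ x) := by
  obtain ⟨C₁, c₁, b₁, l₁⟩ := h₁
  obtain ⟨C₂, c₂, b₂, l₂⟩ := h₂
  have hB := norm_nonneg B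
  refine ⟨2 * (‖B‖ * C₁ * C₂), by positivity, fun x hx => ?_, fun x hx y hy => ?_⟩
  · have h0 : 0 ≤ ‖B‖ * C₁ * C₂ := by positivity
    have h1 : ‖B (g₁ x) (g₂ x)‖ ≤ ‖B‖ * C₁ * C₂ := (B.le_opNorm₂ _ _).trans
      (mul_le_mul (mul_le_mul_of_nonneg_left (b₁ x hx) hB) (b₂ x hx) (norm_nonneg _)
        (mul_nonneg hB c₁))
    linarith
  · have e : B (g₁ x) (g₂ x) - B (g₁ y) (g₂ y) =
        B (g₁ x - g₁ y) (g₂ x) + B (g₁ y) (g₂ x - g₂ y) := by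
      simp only [map_sub, sub_apply]
      abel
    have hd := dist_nonneg (x := x) (y := y)
    have h1 : ‖B (g₁ x - g₁ y) (g₂ x)‖ ≤ ‖B‖ * (C₁ * dist x y) * C₂ := (B.le_opNorm₂ _ _).trans
      (mul_le_mul (mul_le_mul_of_nonneg_left (l₁ x hx y hy) hB) (b₂ x hx) (norm_nonneg _)
        (mul_nonneg hB (mul_nonneg c₁ hd)))
    have h2 : ‖B (g₁ y) (g₂ x - g₂ y)‖ ≤ ‖B‖ * C₁ * (C₂ * dist x y) := (B.le_opNorm₂ _ _).trans
      (mul_le_mul (mul_le_mul_of_nonneg_left (b₁ y hy) hB) (l₂ x hx y hy) (norm_nonneg _)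
        (mul_nonneg hB c₁))
    rw [e]
    refine (norm_add_le _ _).trans ((add_le_add h1 h2).trans (le_of_eq ?_))
    ring

theorem BddLipOn.add {g₁ g₂ : X → Y} (h₁ : BddLipOn O g₁) (h₂ : BddLipOn O g₂) :
    BddLipOn O fun x => g₁ x + g₂ x := by
  obtain ⟨C₁, c₁, b₁, l₁⟩ := h₁
  obtain ⟨C₂, c₂, b₂, l₂⟩ := h₂
  refine ⟨C₁ + C₂, by positivity, fun x hx =>
    (norm_add_le _ _).trans (add_le_add (b₁ x hx) (b₂ x hx)), fun x hx y hy => ?_⟩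
  rw [add_sub_add_comm, add_mul]
  exact (norm_add_le _ _).trans (add_le_add (l₁ x hx y hy) (l₂ x hx y hy))

theorem BddLipOn.const (O : Set X) (c : Y) : BddLipOn O fun _ => c :=
  ⟨‖c‖, norm_nonneg c, fun _ _ => le_rfl, fun x _ y _ => by
    rw [sub_self, norm_zero]
    exact mul_nonneg (norm_nonneg c) dist_nonneg⟩

theorem BddLipOn.mul {g₁ g₂ : X → ℝ} (h₁ : BddLipOn O g₁) (h₂ : BddLipOn O g₂) :
    BddLipOn O fun x => g₁ x * g₂ x :=
  h₁.bilin (ContinuousLinearMap.mul ℝ ℝ) h₂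

theorem BddLipOn.comp {g : X → Y} (hg : BddLipOn O g) {σ : X' → X} {K : ℝ≥0}
    (hσ : LipschitzWith K σ) (hm : ∀ x ∈ O', σ x ∈ O) : BddLipOn O' fun x => g (σ x) := by
  obtain ⟨C, c, b, l⟩ := hg
  refine ⟨max C (C * K), le_max_of_le_left c, fun x hx => (b _ (hm x hx)).trans (le_max_left _ _),
    fun x hx y hy => (l _ (hm x hx) _ (hm y hy)).trans ?_⟩
  calc C * dist (σ x) (σ y) ≤ C * (K * dist x y) :=
        mul_le_mul_of_nonneg_left (hσ.dist_le_mul x y) c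
    _ = C * K * dist x y := by ring
    _ ≤ _ := mul_le_mul_of_nonneg_right (le_max_right _ _) dist_nonneg

theorem BddLipOn.contDiffOn_comp {g : X → ℝ} (hg : BddLipOn O g) {c d : ℝ}
    (hm : ∀ x ∈ O, g x ∈ Icc c d) {G : ℝ → ℝ} (hG : ContDiffOn ℝ 1 G (Icc c d)) :
    BddLipOn O fun x => G (g x) := by
  obtain ⟨K, hK⟩ := hG.exists_lipschitzOnWith (by simp) (convex_Icc c d) isCompact_Icc
  obtain ⟨D, hD⟩ := isCompact_Icc.exists_bound_of_continuousOn hG.continuousOn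
  obtain ⟨C, hC, -, l⟩ := hg
  refine ⟨max (max D 0) (K * C), le_max_of_le_left (le_max_right _ _), fun x hx =>
    (hD _ (hm x hx)).trans (le_max_of_le_left (le_max_left _ _)), fun x hx y hy => ?_⟩
  rw [← dist_eq_norm]
  calc dist (G (g x)) (G (g y)) ≤ K * dist (g x) (g y) :=
        hK.dist_le_mul _ (hm x hx) _ (hm y hy)
    _ ≤ K * (C * dist x y) := by
        rw [dist_eq_norm]
        exact mul_le_mul_of_nonneg_left (l x hx y hy) K.coe_nonneg
    _ = K * C * dist x y := by ring
    _ ≤ _ := mul_le_mul_of_nonneg_right (le_max_right _ _) dist_nonneg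

/-- The product of a test function and a function that is bounded and Lipschitz on the open set
only is Lipschitz on the whole plane. -/
theorem BddLipOn.exists_lipschitzWith_mul {O : Set (ℝ × ℝ)} {w : ℝ × ℝ → ℝ} (hw : BddLipOn O w)
    {φ : ℝ × ℝ → ℂ} (hφ : IsTestFunction O φ) :
    (∃ L : ℝ≥0, LipschitzWith L fun p => (w p : ℂ) * φ p) ∧
      HasCompactSupport (fun p => (w p : ℂ) * φ p) ∧
      tsupport (fun p => (w p : ℂ) * φ p) ⊆ O := by
  have hs : tsupport (fun p => (w p : ℂ) * φ p) ⊆ tsupport φ := tsupport_mul_subset_right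
  refine ⟨?_, hφ.2.1.isCompact.of_isClosed_subset isClosed_closure hs, hs.trans hφ.2.2⟩
  obtain ⟨K, hK⟩ := ContDiff.lipschitzWith_of_hasCompactSupport hφ.2.1 hφ.1 (by simp)
  obtain ⟨D, hD⟩ := hφ.2.1.exists_bound_of_continuous hφ.1.continuous
  have hD0 : 0 ≤ D := (norm_nonneg _).trans (hD 0)
  obtain ⟨C, hC, b, l⟩ := hw
  have h0 : ∀ p, p ∉ O → φ p = 0 := fun p hp =>
    image_eq_zero_of_notMem_tsupport fun h => hp (hφ.2.2 h)
  have hin : ∀ x ∈ O, ∀ y, ‖(w x : ℂ) * φ x - (w x : ℂ) * φ y‖ ≤ C * K * dist x y := by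
    intro x hx y
    rw [← mul_sub, norm_mul, Complex.norm_real, ← dist_eq_norm, mul_assoc]
    exact mul_le_mul (b x hx) (hK.dist_le_mul x y) dist_nonneg hC
  refine ⟨⟨C * K + C * D, by positivity⟩, LipschitzWith.of_dist_le_mul fun x y => ?_⟩
  change _ ≤ (C * K + C * D) * dist x y
  have hCD : 0 ≤ C * D * dist x y := mul_nonneg (mul_nonneg hC hD0) dist_nonneg
  rw [add_mul, dist_eq_norm]
  by_cases hx : x ∈ O
  · by_cases hy : y ∈ O
    · have e : (w x : ℂ) * φ x - (w y : ℂ) * φ y =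
          ((w x : ℂ) * φ x - (w x : ℂ) * φ y) + ((w x - w y : ℝ) : ℂ) * φ y := by
        push_cast
        ring
      rw [e]
      refine (norm_add_le _ _).trans (add_le_add (hin x hx y) ?_)
      rw [norm_mul, Complex.norm_real]
      calc ‖w x - w y‖ * ‖φ y‖ ≤ C * dist x y * D :=
            mul_le_mul (l x hx y hy) (hD y) (norm_nonneg _) (mul_nonneg hC dist_nonneg)
        _ = C * D * dist x y := by ring
    · have := hin x hx y
      rw [h0 y hy, mul_zero] at this ⊢
      linarith
  · by_cases hy : y ∈ O
    · have := hin y hy x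
      rw [norm_sub_rev, dist_comm, h0 x hx, mul_zero] at this
      rw [h0 x hx, mul_zero]
      linarith
    · rw [h0 x hx, h0 y hy, mul_zero, mul_zero, sub_self, norm_zero]
      have := mul_nonneg (mul_nonneg hC K.coe_nonneg) (dist_nonneg (x := x) (y := y))
      linarith

/-- A locally Lipschitz function with essentially bounded derivative is globally Lipschitz. -/
theorem abs_sub_le_of_ae_abs_deriv_le {h : ℝ → ℝ} {C : ℝ}
    (hl : ∀ a b : ℝ, BddLipOn (uIcc a b) h) (hC : ∀ᵐ s, |deriv h s| ≤ C) (a b : ℝ) :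
    |h b - h a| ≤ C * |b - a| := by
  obtain ⟨K, hK, -, l⟩ := hl a b
  have hlip : LipschitzOnWith ⟨K, hK⟩ h (uIcc a b) :=
    LipschitzOnWith.of_dist_le_mul fun x hx y hy => by
      rw [dist_eq_norm]
      exact l x hx y hy
  rw [← hlip.absolutelyContinuousOnInterval.integral_deriv_eq_sub]
  rw [← Real.norm_eq_abs]
  refine intervalIntegral.norm_integral_le_of_norm_le_const_ae (hC.mono fun s hs _ => ?_)
  rwa [Real.norm_eq_abs]

end BoundedLipschitz

/-! ### The metric of the strip -/

/-- Elementary estimates for `q = (1 - tκ)² + t²τ` and its derivatives on a thin strip, where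
`|t| ≤ a` and `ε = a M` is small. -/
theorem metric_estimates {κ τ κ' τ' t M a ε q q₁ q₂ : ℝ} (hM : 1 ≤ M) (ha : 0 < a)
    (hε : ε = a * M) (ham : 8 * ε ≤ 1) (ht : |t| ≤ a) (hκ : |κ| ≤ M) (hτ0 : 0 ≤ τ) (hτ : τ ≤ M)
    (hκ' : |κ'| ≤ M) (hτ' : |τ'| ≤ M) (hq : q = (1 - t * κ) ^ 2 + t ^ 2 * τ)
    (hq₁ : q₁ = -2 * (t * κ') * (1 - t * κ) + t ^ 2 * τ')
    (hq₂ : q₂ = -2 * κ * (1 - t * κ) + 2 * (t * τ)) :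
    |q - 1| ≤ 3 * ε ∧ |q₁| ≤ 3 * ε ∧ |q₂| ≤ 3 * M ∧ |t * κ| ≤ ε ∧ |t * τ| ≤ ε := by
  have hε0 : 0 ≤ ε := by rw [hε]; positivity
  have haε : a ≤ ε := by rw [hε]; exact le_mul_of_one_le_right ha.le hM
  have hmul : ∀ x, |x| ≤ M → |t * x| ≤ ε := fun x hx => by
    rw [abs_mul, hε]
    exact mul_le_mul ht hx (abs_nonneg _) ha.le
  have hmul2 : ∀ x, |x| ≤ M → |t ^ 2 * x| ≤ ε / 8 := fun x hx => by
    rw [pow_two, mul_assoc, abs_mul]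
    calc |t| * |t * x| ≤ a * ε := mul_le_mul ht (hmul x hx) (abs_nonneg _) ha.le
      _ ≤ ε / 8 := by nlinarith
  have hτa : |τ| ≤ M := by rwa [abs_of_nonneg hτ0]
  have e1 := abs_le.1 (hmul κ hκ)
  have e2 := abs_le.1 (hmul2 τ hτa)
  have e4 := abs_le.1 (hmul2 τ' hτ')
  have e5 := abs_le.1 (hmul τ hτa)
  have h9 : |1 - t * κ| ≤ 9 / 8 := by
    rw [abs_le]
    constructor <;> linarith
  refine ⟨?_, ?_, ?_, hmul κ hκ, hmul τ hτa⟩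
  · have h1 : (t * κ) ^ 2 ≤ ε / 8 := by nlinarith
    have h2 := sq_nonneg (t * κ)
    have h3 : q = 1 - 2 * (t * κ) + (t * κ) ^ 2 + t ^ 2 * τ := by rw [hq]; ring
    rw [abs_le]
    constructor <;> linarith
  · have h1 : |2 * (t * κ') * (1 - t * κ)| ≤ 2 * ε * (9 / 8) := by
      rw [abs_mul, abs_mul, abs_two]
      exact mul_le_mul (mul_le_mul_of_nonneg_left (hmul κ' hκ') two_pos.le) h9 (abs_nonneg _)
        (by positivity)
    have h2 := abs_le.1 h1
    rw [hq₁, abs_le]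
    constructor <;> linarith
  · have h1 : |2 * κ * (1 - t * κ)| ≤ 2 * M * (9 / 8) := by
      rw [abs_mul, abs_mul, abs_two]
      exact mul_le_mul (mul_le_mul_of_nonneg_left hκ two_pos.le) h9 (abs_nonneg _)
        (by positivity)
    have h2 := abs_le.1 h1
    rw [hq₂, abs_le]
    constructor <;> linarith

/-- The potential `q_tt / (4q) - 3 q_t² / (16 q²)` created by the unitary transform is close to
its value `-κ²/4 + τ/2` at `t = 0`. -/
theorem potential_estimate {κ τ t M ε q q₂ : ℝ} (hM : 1 ≤ M)
    (ham : 8 * ε ≤ 1) (hκ : |κ| ≤ M) (hτ0 : 0 ≤ τ) (hτ : τ ≤ M) (htκ : |t * κ| ≤ ε)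
    (htτ : |t * τ| ≤ ε) (hq : |q - 1| ≤ 3 * ε) (hq₂b : |q₂| ≤ 3 * M)
    (hq₂ : q₂ = -2 * κ * (1 - t * κ) + 2 * (t * τ)) :
    |(2 * κ ^ 2 + 2 * τ) / (4 * q) - 3 * q₂ ^ 2 / (16 * q ^ 2) -
      (-(1 / 4) * κ ^ 2 + 1 / 2 * τ)| ≤ 40 * M ^ 2 * ε := by
  have hε0 : 0 ≤ ε := (abs_nonneg _).trans htκ
  have hM0 : 0 ≤ M := by linarith
  have hk1 := abs_le.1 hq
  have hq0 : 0 < q := by linarith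
  have hinv : 1 / q ≤ 2 := by
    rw [div_le_iff₀ hq0]
    linarith
  have hinv0 : 0 ≤ 1 / q := by positivity
  have hinva : |1 / q| ≤ 2 := by rwa [abs_of_nonneg hinv0]
  have hκsq : κ ^ 2 ≤ M ^ 2 := by
    rw [← sq_abs]
    exact pow_le_pow_left₀ (abs_nonneg _) hκ 2
  have hMM : M ≤ M ^ 2 := le_self_pow₀ hM two_ne_zero
  have h2κ : |2 * κ| ≤ 2 * M := by
    rw [abs_mul, abs_two]
    linarith
  have a1 : |(κ ^ 2 + τ) / 2 * (1 - q) * (1 / q)| ≤ M ^ 2 * (3 * ε) * 2 := by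
    rw [abs_mul, abs_mul, abs_sub_comm 1 q]
    refine mul_le_mul (mul_le_mul ?_ hq (abs_nonneg _) (by positivity)) hinva (abs_nonneg _)
      (by positivity)
    rw [abs_of_nonneg (by positivity)]
    linarith
  have a2 : |(2 * κ * (t * κ) + 2 * (t * τ) + 2 * κ * (q - 1)) * (1 / q)| ≤ 10 * M * ε * 2 := by
    have h2 : |2 * κ * (t * κ)| ≤ 2 * M * ε := by
      rw [abs_mul]
      exact mul_le_mul h2κ htκ (abs_nonneg _) (by positivity)
    have h3 : |2 * (t * τ)| ≤ 2 * M * ε := by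
      rw [abs_mul, abs_two]
      nlinarith
    have h4 : |2 * κ * (q - 1)| ≤ 2 * M * (3 * ε) := by
      rw [abs_mul]
      exact mul_le_mul h2κ hq (abs_nonneg _) (by positivity)
    rw [abs_mul]
    refine mul_le_mul ((abs_add_three _ _ _).trans ?_) hinva (abs_nonneg _) (by positivity)
    linarith
  have a3 : |q₂ * (1 / q) - 2 * κ| ≤ 8 * M := by
    have h1 : |q₂ * (1 / q)| ≤ 3 * M * 2 := by
      rw [abs_mul]
      exact mul_le_mul hq₂b hinva (abs_nonneg _) (by positivity)
    refine (abs_sub _ _).trans ?_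
    linarith
  have a4 : |(2 * κ * (t * κ) + 2 * (t * τ) + 2 * κ * (q - 1)) * (1 / q) *
      (q₂ * (1 / q) - 2 * κ)| ≤ 10 * M * ε * 2 * (8 * M) := by
    rw [abs_mul]
    exact mul_le_mul a2 a3 (abs_nonneg _) (by positivity)
  have e : (2 * κ ^ 2 + 2 * τ) / (4 * q) - 3 * q₂ ^ 2 / (16 * q ^ 2) -
      (-(1 / 4) * κ ^ 2 + 1 / 2 * τ) = (κ ^ 2 + τ) / 2 * (1 - q) * (1 / q) -
      3 / 16 * ((2 * κ * (t * κ) + 2 * (t * τ) + 2 * κ * (q - 1)) * (1 / q) *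
      (q₂ * (1 / q) - 2 * κ)) := by
    have h1 : 2 * κ * (t * κ) + 2 * (t * τ) + 2 * κ * (q - 1) = q₂ + 2 * κ * q := by
      rw [hq₂]
      ring
    rw [h1]
    field_simp
    ring
  have b1 := abs_le.1 a1
  have b4 := abs_le.1 a4
  have hnn : 0 ≤ M ^ 2 * ε := by positivity
  rw [e, abs_le]
  constructor <;> linarith

/-- Rademacher's theorem on the line, for locally Lipschitz functions. -/
theorem _root_.LocallyLipschitz.ae_differentiableAt_real {V : Type*} [NormedAddCommGroup V]
    [NormedSpace ℝ V] [FiniteDimensional ℝ V] {g : ℝ → V} (hg : LocallyLipschitz g) :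
    ∀ᵐ s, DifferentiableAt ℝ g s := by
  refine LocallyBoundedVariationOn.ae_differentiableAt fun a b _ _ => ?_
  obtain ⟨K, hK⟩ := (hg.locallyLipschitzOn (s := Icc a b)).exists_lipschitzOnWith_of_compact
    isCompact_Icc
  rw [univ_inter]
  rcases le_or_gt a b with h | h
  · have := hK.locallyBoundedVariationOn a b (left_mem_Icc.2 h) (right_mem_Icc.2 h)
    rwa [inter_self] at this
  · rw [Icc_eq_empty (not_le.2 h)]
    simp [BoundedVariationOn]

namespace StripData

variable {n : ℕ} (S : StripData n)

/-- The coefficient `q = [1 - t k·Θ]² + t² |Θ'|² = f²` of the metric. -/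
def metricSq (p : ℝ × ℝ) : ℝ :=
  (1 - p.2 * S.kΘ p.1) ^ 2 + p.2 ^ 2 * ‖deriv S.Θ p.1‖ ^ 2

/-- The derivative of `q` in the longitudinal variable `s`. -/
def metricSq₁ (p : ℝ × ℝ) : ℝ :=
  -2 * (p.2 * deriv S.kΘ p.1) * (1 - p.2 * S.kΘ p.1) +
    p.2 ^ 2 * deriv (fun s => ‖deriv S.Θ s‖ ^ 2) p.1

/-- The derivative of `q` in the transverse variable `t`. -/
def metricSq₂ (p : ℝ × ℝ) : ℝ :=
  -2 * S.kΘ p.1 * (1 - p.2 * S.kΘ p.1) + 2 * (p.2 * ‖deriv S.Θ p.1‖ ^ 2)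

/-- The second derivative of `q` in the transverse variable `t`. -/
def metricSq₂₂ (p : ℝ × ℝ) : ℝ := 2 * S.kΘ p.1 ^ 2 + 2 * ‖deriv S.Θ p.1‖ ^ 2

theorem jacobian_eq (p : ℝ × ℝ) : S.jacobian p = √(S.metricSq p) := rfl

theorem hasDerivAt_metricSq_fst {s : ℝ} (hκ : DifferentiableAt ℝ S.kΘ s)
    (hτ : DifferentiableAt ℝ (fun s => ‖deriv S.Θ s‖ ^ 2) s) (t : ℝ) :
    HasDerivAt (fun s => S.metricSq (s, t)) (S.metricSq₁ (s, t)) s := by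
  have h := (((hκ.hasDerivAt.const_mul t).const_sub 1).pow 2).add (hτ.hasDerivAt.const_mul (t ^ 2))
  refine h.congr_deriv ?_
  simp only [metricSq₁]
  ring

theorem hasDerivAt_metricSq_snd (s t : ℝ) :
    HasDerivAt (fun t => S.metricSq (s, t)) (S.metricSq₂ (s, t)) t := by
  have h := ((((hasDerivAt_id t).mul_const (S.kΘ s)).const_sub 1).pow 2).add
    (((hasDerivAt_id t).pow 2).mul_const (‖deriv S.Θ s‖ ^ 2))
  refine h.congr_deriv ?_
  simp only [metricSq₂, id]
  ring

theorem hasDerivAt_metricSq₂_snd (s t : ℝ) :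
    HasDerivAt (fun t => S.metricSq₂ (s, t)) (S.metricSq₂₂ (s, t)) t := by
  have h := ((((hasDerivAt_id t).mul_const (S.kΘ s)).const_sub 1).const_mul (-2 * S.kΘ s)).add
    (((hasDerivAt_id t).mul_const (‖deriv S.Θ s‖ ^ 2)).const_mul 2)
  refine h.congr_deriv ?_
  simp only [metricSq₂₂]
  ring

theorem continuous_norm_derivΘ_sq : Continuous fun s => ‖deriv S.Θ s‖ ^ 2 := by
  have h1 : Continuous (deriv S.Θ) := S.regular_Θ.1.continuous_deriv (by simp)
  fun_prop

theorem continuous_metricSq : Continuous S.metricSq := by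
  have h1 := S.continuous_kΘ
  have h2 := S.continuous_norm_derivΘ_sq.comp continuous_fst (X := ℝ × ℝ)
  simp only [Function.comp_def] at h2
  unfold metricSq
  fun_prop

theorem continuous_metricSq₂ : Continuous S.metricSq₂ := by
  have h1 := S.continuous_kΘ
  have h2 := S.continuous_norm_derivΘ_sq.comp continuous_fst (X := ℝ × ℝ)
  simp only [Function.comp_def] at h2
  unfold metricSq₂
  fun_prop

theorem continuous_metricSq₂₂ : Continuous S.metricSq₂₂ := by
  have h1 := S.continuous_kΘ
  have h2 := S.continuous_norm_derivΘ_sq.comp continuous_fst (X := ℝ × ℝ)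
  simp only [Function.comp_def] at h2
  unfold metricSq₂₂
  fun_prop

theorem measurable_metricSq₁ : Measurable S.metricSq₁ := by
  have h1 := S.continuous_kΘ.measurable
  have h2 : Measurable (deriv S.kΘ) := measurable_deriv _
  have h3 : Measurable (deriv fun s => ‖deriv S.Θ s‖ ^ 2) := measurable_deriv _
  unfold metricSq₁
  fun_prop

/-- `k·Θ` and `|Θ'|²` are bounded and globally Lipschitz, with the common constant `M ≥ 1`. -/
structure UniformBounds (M : ℝ) : Prop where
  one_le : 1 ≤ M
  kΘ_le : ∀ s, |S.kΘ s| ≤ M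
  kΘ_lip : ∀ s s', |S.kΘ s - S.kΘ s'| ≤ M * |s - s'|
  τ_le : ∀ s, ‖deriv S.Θ s‖ ^ 2 ≤ M
  τ_lip : ∀ s s', |‖deriv S.Θ s‖ ^ 2 - ‖deriv S.Θ s'‖ ^ 2| ≤ M * |s - s'|

theorem _root_.QuantumStrip.ae_norm_le_of_memLp_top {Y : Type*} [NormedAddCommGroup Y] {g : ℝ → Y}
    (hg : MemLp g ∞ volume) : ∃ C, 0 ≤ C ∧ ∀ᵐ s, ‖g s‖ ≤ C := by
  refine ⟨(eLpNorm g ∞ volume).toReal, ENNReal.toReal_nonneg, ?_⟩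
  have hfin := hg.2.ne
  rw [eLpNorm_exponent_top] at hfin ⊢
  filter_upwards [ae_le_eLpNormEssSup (f := g) (μ := (volume : Measure ℝ))] with s hs
  simpa using ENNReal.toReal_mono hfin hs

theorem _root_.QuantumStrip.le_of_ae_le_of_continuous {g : ℝ → ℝ} (hg : Continuous g) {C : ℝ}
    (h : ∀ᵐ s, g s ≤ C) (s : ℝ) : g s ≤ C := by
  have h1 : (fun s => max (g s) C) = fun _ => C :=
    Measure.eq_of_ae_eq (μ := (volume : Measure ℝ)) (h.mono fun s hs => max_eq_right hs)
      (hg.max continuous_const) continuous_const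
  exact max_eq_right_iff.1 (congrFun h1 s)

theorem abs_kΘ_le (s : ℝ) : |S.kΘ s| ≤ S.supNorm :=
  le_of_ae_le_of_continuous S.continuous_kΘ.abs S.ae_abs_kΘ_le s

theorem bddLipOn_kΘ (a b : ℝ) : BddLipOn (uIcc a b) S.kΘ := by
  have hT : LocallyLipschitz (deriv (deriv S.Γ)) := by
    have := S.regular_Γ.2
    simpa [iteratedDeriv_succ, iteratedDeriv_zero] using this
  have hΘ : LocallyLipschitz S.Θ := (S.regular_Θ.1.of_le (by simp)).locallyLipschitz
  have hsum : ∀ A : Finset (Fin n), BddLipOn (uIcc a b) fun s =>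
      ∑ j ∈ A, curvatureVector S.Γ S.N s j * S.Θ s j := by
    intro A
    classical
    induction A using Finset.induction_on with
    | empty => simpa using BddLipOn.const (uIcc a b) (0 : ℝ)
    | insert j A hj ih =>
      simp only [Finset.sum_insert hj]
      refine BddLipOn.add (BddLipOn.mul ?_ ?_) ih
      · exact (BddLipOn.of_locallyLipschitz isCompact_uIcc hT).bilin (innerSL ℝ)
          (BddLipOn.of_locallyLipschitz isCompact_uIcc (S.frame.locallyLipschitz j))
      · have := (BddLipOn.const (uIcc a b) (EuclideanSpace.proj j : Euc n →L[ℝ] ℝ)).bilin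
          (ContinuousLinearMap.id ℝ (Euc n →L[ℝ] ℝ))
          (BddLipOn.of_locallyLipschitz isCompact_uIcc hΘ)
        exact this
  exact hsum Finset.univ

theorem locallyLipschitz_derivΘ : LocallyLipschitz (deriv S.Θ) := by
  have := S.regular_Θ.2
  simpa [iteratedDeriv_succ, iteratedDeriv_zero] using this

theorem bddLipOn_derivΘ_sq (a b : ℝ) : BddLipOn (uIcc a b) fun s => ‖deriv S.Θ s‖ ^ 2 := by
  have h := BddLipOn.of_locallyLipschitz (isCompact_uIcc (a := a) (b := b))
    S.locallyLipschitz_derivΘ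
  have h2 : BddLipOn (uIcc a b) fun s => inner ℝ (deriv S.Θ s) (deriv S.Θ s) :=
    h.bilin (innerSL ℝ) h
  simpa only [real_inner_self_eq_norm_sq] using h2

theorem exists_uniformBounds : ∃ M, S.UniformBounds M := by
  obtain ⟨C₁, hC₁, h₁⟩ := ae_norm_le_of_memLp_top S.bdd_kΘ'
  obtain ⟨C₂, hC₂, h₂⟩ := ae_norm_le_of_memLp_top S.bdd_Θ'
  obtain ⟨C₃, hC₃, h₃⟩ := ae_norm_le_of_memLp_top S.bdd_Θ''
  simp only [norm_norm] at h₂ h₃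
  have hK : 0 ≤ S.supNorm := (abs_nonneg _).trans (S.abs_kΘ_le 0)
  have hΘc : Continuous (deriv S.Θ) := S.locallyLipschitz_derivΘ.continuous
  have hΘ : ∀ s, ‖deriv S.Θ s‖ ≤ C₂ := le_of_ae_le_of_continuous hΘc.norm h₂
  have hκ := abs_sub_le_of_ae_abs_deriv_le (C := C₁) S.bddLipOn_kΘ h₁
  have hτd : ∀ᵐ s, |deriv (fun s => ‖deriv S.Θ s‖ ^ 2) s| ≤ 2 * (C₂ * C₃) := by
    filter_upwards [h₃, S.locallyLipschitz_derivΘ.ae_differentiableAt_real] with s hs hd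
    rw [hd.hasDerivAt.norm_sq.deriv, abs_mul, abs_two]
    refine mul_le_mul_of_nonneg_left ((abs_real_inner_le_norm _ _).trans ?_) two_pos.le
    exact mul_le_mul (hΘ s) hs (norm_nonneg _) hC₂
  have hτ := abs_sub_le_of_ae_abs_deriv_le S.bddLipOn_derivΘ_sq hτd
  refine ⟨1 + S.supNorm + C₁ + C₂ ^ 2 + 2 * (C₂ * C₃), ?_, ?_, ?_, ?_, ?_⟩
  · nlinarith [mul_nonneg hC₂ hC₃]
  · intro s
    nlinarith [mul_nonneg hC₂ hC₃, S.abs_kΘ_le s]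
  · intro s s'
    refine (hκ s' s).trans (mul_le_mul_of_nonneg_right ?_ (abs_nonneg _))
    nlinarith [mul_nonneg hC₂ hC₃]
  · intro s
    have : ‖deriv S.Θ s‖ ^ 2 ≤ C₂ ^ 2 := pow_le_pow_left₀ (norm_nonneg _) (hΘ s) 2
    nlinarith [mul_nonneg hC₂ hC₃]
  · intro s s'
    refine (hτ s' s).trans (mul_le_mul_of_nonneg_right ?_ (abs_nonneg _))
    nlinarith [sq_nonneg C₂]

end StripData

/-! ### Coefficients of the transformed form -/

namespace StripData

variable {n : ℕ} {S : StripData n} {M a : ℝ}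

/-- The strip is so thin, in comparison with the uniform bounds on its geometry, that its metric is
close to the Euclidean one. -/
structure ThinStrip (S : StripData n) (M a : ℝ) : Prop extends S.UniformBounds M where
  pos : 0 < a
  small : 8 * (a * M) ≤ 1

/-- The effective potential before the limit `a → 0`, in the coordinates `(s, t)`. -/
def transformedPotential (S : StripData n) (p : ℝ × ℝ) : ℝ :=
  S.metricSq₂₂ p / (4 * S.metricSq p) - 3 * S.metricSq₂ p ^ 2 / (16 * S.metricSq p ^ 2)

theorem UniformBounds.lipschitzWith_kΘ (T : S.UniformBounds M) :
    LipschitzWith ⟨M, zero_le_one.trans T.one_le⟩ S.kΘ :=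
  LipschitzWith.of_dist_le_mul fun s s' => by
    rw [Real.dist_eq, Real.dist_eq]
    exact T.kΘ_lip s s'

theorem UniformBounds.lipschitzWith_τ (T : S.UniformBounds M) :
    LipschitzWith ⟨M, zero_le_one.trans T.one_le⟩ fun s => ‖deriv S.Θ s‖ ^ 2 :=
  LipschitzWith.of_dist_le_mul fun s s' => by
    rw [Real.dist_eq, Real.dist_eq]
    exact T.τ_lip s s'

theorem ThinStrip.estimates (T : S.ThinStrip M a) {p : ℝ × ℝ} (hp : p ∈ Ω₀ a) :
    |S.metricSq p - 1| ≤ 3 * (a * M) ∧ |S.metricSq₁ p| ≤ 3 * (a * M) ∧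
      |S.metricSq₂ p| ≤ 3 * M ∧ |S.transformedPotential p - S.Veff p.1| ≤ 40 * M ^ 2 * (a * M) := by
  have ht : |p.2| ≤ a := (abs_lt.2 hp.2).le
  have hκ' : |deriv S.kΘ p.1| ≤ M := norm_deriv_le_of_lipschitz T.lipschitzWith_kΘ
  have hτ' : |deriv (fun s => ‖deriv S.Θ s‖ ^ 2) p.1| ≤ M :=
    norm_deriv_le_of_lipschitz T.lipschitzWith_τ
  obtain ⟨h1, h2, h3, h4, h5⟩ := metric_estimates (q := S.metricSq p) (q₁ := S.metricSq₁ p)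
    (q₂ := S.metricSq₂ p) T.one_le T.pos rfl T.small ht (T.kΘ_le p.1) (sq_nonneg _) (T.τ_le p.1)
    hκ' hτ' rfl rfl rfl
  exact ⟨h1, h2, h3, potential_estimate T.one_le T.small (T.kΘ_le p.1) (sq_nonneg _) (T.τ_le p.1)
    h4 h5 h1 h3 rfl⟩

theorem ThinStrip.metricSq_mem (T : S.ThinStrip M a) {p : ℝ × ℝ} (hp : p ∈ Ω₀ a) :
    S.metricSq p ∈ Icc (1 / 2) 2 := by
  have h := abs_le.1 (T.estimates hp).1
  have := T.small
  constructor <;> linarith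

theorem ThinStrip.metricSq_pos (T : S.ThinStrip M a) {p : ℝ × ℝ} (hp : p ∈ Ω₀ a) :
    0 < S.metricSq p := by
  have := (T.metricSq_mem hp).1
  linarith

theorem ThinStrip.jacobian_mem (T : S.ThinStrip M a) {p : ℝ × ℝ} (hp : p ∈ Ω₀ a) :
    S.jacobian p ∈ Icc (1 / 2) 2 := by
  obtain ⟨h1, h2⟩ := T.metricSq_mem hp
  rw [jacobian_eq]
  constructor
  · exact Real.le_sqrt_of_sq_le (by linarith)
  · exact Real.sqrt_le_iff.2 ⟨by norm_num, by linarith⟩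

theorem ThinStrip.inv_jacobian_le (T : S.ThinStrip M a) {p : ℝ × ℝ} (hp : p ∈ Ω₀ a) :
    0 < (S.jacobian p)⁻¹ ∧ (S.jacobian p)⁻¹ ≤ 2 := by
  have h1 := (T.jacobian_mem hp).1
  refine ⟨inv_pos.2 (by linarith), ?_⟩
  rw [inv_le_comm₀ (by linarith) two_pos]
  linarith

theorem ThinStrip.abs_inv_jacobian_sub_one_le (T : S.ThinStrip M a) {p : ℝ × ℝ} (hp : p ∈ Ω₀ a) :
    |(S.jacobian p)⁻¹ - 1| ≤ 6 * (a * M) := by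
  have h1 := (T.jacobian_mem hp).1
  have hpos : 0 < S.jacobian p := by linarith
  obtain ⟨h2, h3⟩ := T.inv_jacobian_le hp
  have hsq : S.jacobian p ^ 2 = S.metricSq p := Real.sq_sqrt (T.metricSq_pos hp).le
  have h4 : |S.jacobian p - 1| ≤ 3 * (a * M) := by
    refine le_trans ?_ (T.estimates hp).1
    have e : S.metricSq p - 1 = (S.jacobian p - 1) * (S.jacobian p + 1) := by
      rw [← hsq]
      ring
    rw [e, abs_mul]
    refine le_mul_of_one_le_right (abs_nonneg _) ?_
    rw [abs_of_pos (by linarith)]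
    linarith
  have e : (S.jacobian p)⁻¹ - 1 = -((S.jacobian p - 1) * (S.jacobian p)⁻¹) := by
    field_simp
    ring
  rw [e, abs_neg, abs_mul, abs_of_pos h2]
  nlinarith [abs_nonneg (S.jacobian p - 1)]

theorem ThinStrip.abs_metricSq₁_div_le (T : S.ThinStrip M a) {p : ℝ × ℝ} (hp : p ∈ Ω₀ a) :
    |S.metricSq₁ p / (4 * S.metricSq p)| ≤ 3 / 2 * (a * M) := by
  have h1 := (T.metricSq_mem hp).1
  rw [abs_div, abs_of_pos (by linarith : 0 < 4 * S.metricSq p), div_le_iff₀ (by linarith)]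
  have h2 := (T.estimates hp).2.1
  have h3 : 0 ≤ a * M := by
    have := abs_nonneg (S.metricSq₁ p)
    linarith
  nlinarith

theorem ThinStrip.abs_metricSq₂_div_le (T : S.ThinStrip M a) {p : ℝ × ℝ} (hp : p ∈ Ω₀ a) :
    |S.metricSq₂ p / (4 * S.metricSq p)| ≤ 3 / 2 * M := by
  have h1 := (T.metricSq_mem hp).1
  rw [abs_div, abs_of_pos (by linarith : 0 < 4 * S.metricSq p), div_le_iff₀ (by linarith)]
  have h2 := (T.estimates hp).2.2.1
  have := T.one_le
  nlinarith

theorem abs_Veff_le (T : S.UniformBounds M) (s : ℝ) : |S.Veff s| ≤ M ^ 2 := by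
  have h1 : S.kΘ s ^ 2 ≤ M ^ 2 := by
    rw [← sq_abs]
    exact pow_le_pow_left₀ (abs_nonneg _) (T.kΘ_le s) 2
  have h2 := T.τ_le s
  have h3 : M ≤ M ^ 2 := le_self_pow₀ T.one_le two_ne_zero
  have h4 := sq_nonneg (S.kΘ s)
  have h5 := sq_nonneg ‖deriv S.Θ s‖
  rw [Veff, abs_le]
  constructor <;> linarith

theorem z₀_le_Veff (s : ℝ) : S.z₀ ≤ S.Veff s := by
  have h1 : S.kΘ s ^ 2 ≤ S.supNorm ^ 2 := by
    rw [← sq_abs]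
    exact pow_le_pow_left₀ (abs_nonneg _) (S.abs_kΘ_le s) 2
  have h5 := sq_nonneg ‖deriv S.Θ s‖
  rw [Veff, z₀]
  linarith

/-! ### Differentiability and regularity of the density -/

/-- The logarithmic derivative of `√(a f)`, `f = √q`, is `f' / (2f) = q' / (4q)`. -/
theorem _root_.QuantumStrip.hasDerivAt_sqrt_mul_sqrt {q : ℝ → ℝ} {q' x a : ℝ}
    (h : HasDerivAt q q' x) (hq : 0 < q x) (ha : 0 < a) :
    HasDerivAt (fun y => √(a * √(q y))) (q' / (4 * q x) * √(a * √(q x))) x := by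
  have hf : 0 < √(q x) := Real.sqrt_pos.2 hq
  have haf : 0 < a * √(q x) := mul_pos ha hf
  have hA : 0 < √(a * √(q x)) := Real.sqrt_pos.2 haf
  refine (((h.sqrt hq.ne').const_mul a).sqrt haf.ne').congr_deriv ?_
  have e1 : √(q x) ^ 2 = q x := Real.sq_sqrt hq.le
  have e2 : √(a * √(q x)) ^ 2 = a * √(q x) := Real.sq_sqrt haf.le
  generalize √(a * √(q x)) = A at hA e2 ⊢
  generalize √(q x) = f at hf e1 e2 ⊢
  rw [← e1]
  field_simp
  rw [e2]
  ring

theorem _root_.QuantumStrip.hasDerivAt_inv_sqrt_mul_sqrt {q : ℝ → ℝ} {q' x a : ℝ}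
    (h : HasDerivAt q q' x) (hq : 0 < q x) (ha : 0 < a) :
    HasDerivAt (fun y => (√(a * √(q y)))⁻¹) (-(q' / (4 * q x)) * (√(a * √(q x)))⁻¹) x := by
  have hA : 0 < √(a * √(q x)) := Real.sqrt_pos.2 (mul_pos ha (Real.sqrt_pos.2 hq))
  refine ((hasDerivAt_sqrt_mul_sqrt h hq ha).inv hA.ne').congr_deriv ?_
  field_simp

theorem ThinStrip.bddLipOn_metricSq (T : S.ThinStrip M a) : BddLipOn (Ω₀ a) S.metricSq := by
  have hM : 0 ≤ M := zero_le_one.trans T.one_le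
  have h1 : BddLipOn (Ω₀ a) fun p : ℝ × ℝ => S.kΘ p.1 :=
    BddLipOn.comp (O := univ) ⟨M, hM, fun s _ => T.kΘ_le s, fun s _ s' _ => T.kΘ_lip s s'⟩
      LipschitzWith.prod_fst fun _ _ => mem_univ _
  have h2 : BddLipOn (Ω₀ a) fun p : ℝ × ℝ => ‖deriv S.Θ p.1‖ ^ 2 :=
    BddLipOn.comp (O := univ) ⟨M, hM, fun s _ => by
        rw [Real.norm_eq_abs, abs_of_nonneg (sq_nonneg _)]
        exact T.τ_le s, fun s _ s' _ => T.τ_lip s s'⟩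
      LipschitzWith.prod_fst fun _ _ => mem_univ _
  have h3 : BddLipOn (Ω₀ a) fun p : ℝ × ℝ => p.2 := by
    refine ⟨max a 1, le_max_of_le_left T.pos.le, fun p hp => le_max_of_le_left ?_,
      fun p _ p' _ => ?_⟩
    · exact (abs_lt.2 hp.2).le
    · rw [← dist_eq_norm]
      calc dist p.2 p'.2 ≤ 1 * dist p p' := by
            rw [one_mul]
            exact le_max_right _ _
        _ ≤ _ := mul_le_mul_of_nonneg_right (le_max_right _ _) dist_nonneg
  have h4 : BddLipOn (Ω₀ a) fun p : ℝ × ℝ => 1 + (-1) * (p.2 * S.kΘ p.1) :=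
    (BddLipOn.const _ 1).add ((BddLipOn.const _ (-1)).mul (h3.mul h1))
  have h5 := (h4.mul h4).add ((h3.mul h3).mul h2)
  have e : S.metricSq = fun p => (1 + (-1) * (p.2 * S.kΘ p.1)) * (1 + (-1) * (p.2 * S.kΘ p.1)) +
      p.2 * p.2 * ‖deriv S.Θ p.1‖ ^ 2 := by
    funext p
    simp only [metricSq]
    ring
  rw [e]
  exact h5

theorem ThinStrip.bddLipOn_sqrt_density (T : S.ThinStrip M a) :
    BddLipOn (Ω₀ a) fun p => √(a * √(S.metricSq p)) := by
  refine T.bddLipOn_metricSq.contDiffOn_comp (G := fun x => √(a * √x))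
    (fun p hp => T.metricSq_mem hp) fun x hx => ContDiffAt.contDiffWithinAt ?_
  have hx0 : 0 < x := by linarith [hx.1]
  exact (contDiffAt_const.mul (contDiffAt_id.sqrt hx0.ne')).sqrt
    (mul_pos T.pos (Real.sqrt_pos.2 hx0)).ne'

theorem ThinStrip.bddLipOn_inv_sqrt_density (T : S.ThinStrip M a) :
    BddLipOn (Ω₀ a) fun p => (√(a * √(S.metricSq p)))⁻¹ := by
  refine T.bddLipOn_metricSq.contDiffOn_comp (G := fun x => (√(a * √x))⁻¹)
    (fun p hp => T.metricSq_mem hp) fun x hx => ContDiffAt.contDiffWithinAt ?_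
  have hx0 : 0 < x := by linarith [hx.1]
  have h1 : 0 < a * √x := mul_pos T.pos (Real.sqrt_pos.2 hx0)
  exact ((contDiffAt_const.mul (contDiffAt_id.sqrt hx0.ne')).sqrt h1.ne').inv
    (Real.sqrt_pos.2 h1).ne'

/-! ### The weighted spaces -/

theorem _root_.QuantumStrip.weightedMeasure_ac (O : Set (ℝ × ℝ)) (w : ℝ × ℝ → ℝ) :
    weightedMeasure O w ≪ volume :=
  (withDensity_absolutelyContinuous _ _).trans Measure.absolutelyContinuous_restrict

theorem _root_.QuantumStrip.isFiniteMeasureOnCompacts_weightedMeasure {O : Set (ℝ × ℝ)}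
    (hO : MeasurableSet O) {w : ℝ × ℝ → ℝ} {C : ℝ} (hw : ∀ p ∈ O, w p ≤ C) :
    IsFiniteMeasureOnCompacts (weightedMeasure O w) := by
  have hle : weightedMeasure O w ≤ ENNReal.ofReal C • volume := by
    have h1 : weightedMeasure O w ≤ (volume.restrict O).withDensity fun _ => ENNReal.ofReal C := by
      refine withDensity_mono ?_
      filter_upwards [ae_restrict_mem hO] with p hp
      exact ENNReal.ofReal_le_ofReal (hw p hp)
    rw [withDensity_const] at h1
    refine h1.trans ?_
    gcongr
    exact Measure.restrict_le_self
  refine ⟨fun K hK => (hle K).trans_lt ?_⟩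
  rw [Measure.smul_apply, smul_eq_mul]
  exact ENNReal.mul_lt_top ENNReal.ofReal_lt_top hK.measure_lt_top

theorem _root_.QuantumStrip.measurableSet_Ω₀ (a : ℝ) : MeasurableSet (Ω₀ a) :=
  MeasurableSet.univ.prod measurableSet_Ioo

theorem _root_.QuantumStrip.isOpen_Ω₀ (a : ℝ) : IsOpen (Ω₀ a) := isOpen_univ.prod isOpen_Ioo

theorem _root_.QuantumStrip.scaling_apply (ha : 0 < a) (p : ℝ × ℝ) :
    scaling ha p = (p.1, a * p.2) := rfl

theorem _root_.QuantumStrip.mem_strip_iff (ha : 0 < a) (p : ℝ × ℝ) :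
    (p.1, a * p.2) ∈ Ω₀ a ↔ p ∈ strip := by
  simp only [strip, Ω₀, mem_prod, mem_univ, true_and, mem_Ioo]
  constructor
  · rintro ⟨h1, h2⟩
    constructor <;> nlinarith
  · rintro ⟨h1, h2⟩
    constructor <;> nlinarith

/-- The rescaling maps the measure with density `a w(s, a u)` on `Π` to the one with density
`w(s, t)` on `Ω₀`. -/
theorem _root_.QuantumStrip.scaling_measurePreserving_weighted {w : ℝ × ℝ → ℝ} (hw : Measurable w)
    (ha : 0 < a) :
    MeasurePreserving (scaling ha)
      (stripMeasure.withDensity (fun p => ENNReal.ofReal (a * w (p.1, a * p.2))))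
      (weightedMeasure (Ω₀ a) w) := by
  have hpre : strip = scaling ha ⁻¹' (Ω₀ a) := by
    ext p
    rw [mem_preimage, scaling_apply, mem_strip_iff ha]
  have hvol : Measure.map (scaling ha) (volume : Measure (ℝ × ℝ)) =
      ENNReal.ofReal a⁻¹ • (volume : Measure (ℝ × ℝ)) := by
    have h := Measure.map_prod_map (volume : Measure ℝ) (volume : Measure ℝ)
      measurable_id (measurable_const_mul a)
    rw [Real.map_volume_mul_left ha.ne', Measure.map_id, abs_of_pos (inv_pos.2 ha)] at h
    rw [Measure.volume_eq_prod, ← Measure.prod_smul_right, h]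
    rfl
  refine ⟨(scaling ha).measurable, ?_⟩
  ext A hA
  rw [Measure.map_apply (scaling ha).measurable hA,
    withDensity_apply _ ((scaling ha).measurable hA), weightedMeasure,
    withDensity_apply _ hA, stripMeasure,
    Measure.restrict_restrict ((scaling ha).measurable hA), Measure.restrict_restrict hA, hpre,
    ← preimage_inter]
  have hres : (volume.restrict (A ∩ Ω₀ a) : Measure (ℝ × ℝ)) =
      ENNReal.ofReal a • Measure.map (scaling ha)
        (volume.restrict (scaling ha ⁻¹' (A ∩ Ω₀ a))) := by
    rw [← Measure.restrict_map (scaling ha).measurable (hA.inter (measurableSet_Ω₀ a)), hvol,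
      Measure.restrict_smul, smul_smul, ← ENNReal.ofReal_mul ha.le, mul_inv_cancel₀ ha.ne']
    simp
  rw [hres, lintegral_smul_measure, lintegral_map_equiv, smul_eq_mul,
    ← lintegral_const_mul _ (by exact (hw.comp (scaling ha).measurable).ennreal_ofReal)]
  refine lintegral_congr fun p => ?_
  rw [ENNReal.ofReal_mul ha.le]
  rfl

theorem measurable_densityInv (S : StripData n) (a : ℝ) :
    Measurable fun p : ℝ × ℝ => a * (S.jacobian (p.1, a * p.2))⁻¹ := by
  have := S.measurable_jacobian
  fun_prop

theorem densityInv_pos (S : StripData n) (ha : 0 < a) (hak : a * S.supNorm < 1) :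
    ∀ᵐ p ∂stripMeasure, 0 < a * (S.jacobian (p.1, a * p.2))⁻¹ := by
  filter_upwards [S.density_pos ha hak] with p hp
  exact mul_pos ha (inv_pos.2 (pos_of_mul_pos_right hp ha.le))

/-- The analogue of `U` for the component `∂₁ψ`, which lives in the space with weight `f⁻¹`. -/
def U₁ (S : StripData n) (ha : 0 < a) (hak : a * S.supNorm < 1) :
    Lp ℂ 2 (S.measureInv a) ≃ₗᵢ[ℂ] L2Strip :=
  sqrtDensityUnitary (S.measurable_densityInv a) (S.densityInv_pos ha hak)
    (scaling_measurePreserving_weighted S.measurable_jacobian.inv ha)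

theorem U₁_apply (S : StripData n) (ha : 0 < a) (hak : a * S.supNorm < 1)
    (ψ : Lp ℂ 2 (S.measureInv a)) :
    S.U₁ ha hak ψ =ᵐ[stripMeasure] fun p =>
      ((√(a * (S.jacobian (p.1, a * p.2))⁻¹) : ℝ) : ℂ) * ψ (p.1, a * p.2) :=
  MemLp.coeFn_toLp (memLp_sqrt_density (S.measurable_densityInv a) (S.densityInv_pos ha hak)
    (scaling_measurePreserving_weighted S.measurable_jacobian.inv ha) ψ)

/-- A property that holds almost everywhere on `Π` after rescaling holds almost everywhere for every
weighted measure on `Ω₀`. -/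
theorem _root_.QuantumStrip.ae_weightedMeasure_of_ae_strip {w : ℝ × ℝ → ℝ} (hw : Measurable w)
    (ha : 0 < a) {P : ℝ × ℝ → Prop} (h : ∀ᵐ p ∂stripMeasure, P (p.1, a * p.2)) :
    ∀ᵐ p ∂weightedMeasure (Ω₀ a) w, P p := by
  have hmp := scaling_measurePreserving_weighted hw ha
  have h1 : ∀ᵐ p ∂stripMeasure.withDensity (fun p => ENNReal.ofReal (a * w (p.1, a * p.2))),
      P (scaling ha p) := (withDensity_absolutelyContinuous _ _).ae_le h
  rw [← hmp.map_eq]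
  exact (scaling ha).measurableEmbedding.ae_map_iff.2 h1

theorem _root_.QuantumStrip.ae_strip_of_ae_weightedMeasure {w : ℝ × ℝ → ℝ} (hw : Measurable w)
    (ha : 0 < a) (hpos : ∀ p ∈ Ω₀ a, 0 < w p) {P : ℝ × ℝ → Prop}
    (h : ∀ᵐ p ∂weightedMeasure (Ω₀ a) w, P p) :
    ∀ᵐ p ∂stripMeasure, P (p.1, a * p.2) := by
  have hm : Measurable fun p : ℝ × ℝ => a * w (p.1, a * p.2) := by fun_prop
  have hae : ∀ᵐ p ∂stripMeasure, 0 < a * w (p.1, a * p.2) := by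
    filter_upwards [ae_mem_strip] with p hp
    exact mul_pos ha (hpos _ ((mem_strip_iff ha p).2 hp))
  have hq := quasi_of_density hm hae (scaling_measurePreserving_weighted hw ha)
  exact hq.ae h

end StripData

/-! ### Identification of the form domain -/

theorem IsTestFunction.comp_scaling {O O' : Set (ℝ × ℝ)} {φ : ℝ × ℝ → ℂ}
    (hφ : IsTestFunction O φ) {c : ℝ} (hc : c ≠ 0) (hO : ∀ p : ℝ × ℝ, (p.1, c * p.2) ∈ O → p ∈ O') :
    IsTestFunction O' fun p => φ (p.1, c * p.2) := by
  let e : ℝ × ℝ ≃ₜ ℝ × ℝ := (Homeomorph.refl ℝ).prodCongr (Homeomorph.mulLeft₀ c hc)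
  have hs : tsupport (fun p : ℝ × ℝ => φ (p.1, c * p.2)) = e ⁻¹' tsupport φ :=
    tsupport_comp_eq_preimage φ e
  have he : ContDiff ℝ ∞ fun p : ℝ × ℝ => (p.1, c * p.2) := by fun_prop
  refine ⟨hφ.1.comp he, hφ.2.1.comp_homeomorph e, ?_⟩
  rw [hs]
  exact fun p hp => hO p (hφ.2.2 hp)

theorem sqrt_mul_inv_eq {a f : ℝ} (hf : 0 < f) : √(a * f⁻¹) = √(a * f) * f⁻¹ := by
  have : a * f⁻¹ = a * f * (f⁻¹) ^ 2 := by field_simp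
  rw [this, Real.sqrt_mul' _ (sq_nonneg _), Real.sqrt_sq (inv_pos.2 hf).le]

namespace StripData

variable {n : ℕ} {S : StripData n} {M a : ℝ}

/-- The form domain of `H`, as a space of triples `(ψ, ∂₁ψ, ∂₂ψ)`. -/
abbrev formDomain (S : StripData n) (a : ℝ) :
    Submodule ℂ (S.Hilb a × Lp ℂ 2 (S.measureInv a) × S.Hilb a) :=
  dirichletSpace (Ω₀ a) (S.measure a) (S.measureInv a) (S.measure a)

theorem ThinStrip.memLp_inv_jacobian (T : S.ThinStrip M a) :
    MemLp (fun p : ℝ × ℝ => (((S.jacobian (p.1, a * p.2))⁻¹ : ℝ) : ℂ)) ∞ stripMeasure := by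
  refine memLp_top_of_bound (C := 2) ?_ ?_
  · have := S.measurable_jacobian
    exact Measurable.aestronglyMeasurable (by fun_prop)
  · filter_upwards [ae_mem_strip] with p hp
    obtain ⟨h1, h2⟩ := T.inv_jacobian_le ((mem_strip_iff T.pos p).2 hp)
    rwa [Complex.norm_real, Real.norm_eq_abs, abs_of_pos h1]

theorem ThinStrip.memLp_jacobian (T : S.ThinStrip M a) :
    MemLp (fun p : ℝ × ℝ => ((S.jacobian (p.1, a * p.2) : ℝ) : ℂ)) ∞ stripMeasure := by
  refine memLp_top_of_bound (C := 2) ?_ ?_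
  · have := S.measurable_jacobian
    exact Measurable.aestronglyMeasurable (by fun_prop)
  · filter_upwards [ae_mem_strip] with p hp
    obtain ⟨h1, h2⟩ := T.jacobian_mem ((mem_strip_iff T.pos p).2 hp)
    rwa [Complex.norm_real, Real.norm_eq_abs, abs_of_pos (by linarith)]

/-- The coefficient `f⁻¹ ∂₁f / (2f)`, as a function on `Π`. -/
def shift (S : StripData n) (a : ℝ) (p : ℝ × ℝ) : ℝ :=
  S.metricSq₁ (p.1, a * p.2) / (4 * S.metricSq (p.1, a * p.2)) * (S.jacobian (p.1, a * p.2))⁻¹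

theorem ThinStrip.abs_shift_le (T : S.ThinStrip M a) {p : ℝ × ℝ} (hp : p ∈ strip) :
    |S.shift a p| ≤ 3 * (a * M) := by
  have hp' := (mem_strip_iff T.pos p).2 hp
  obtain ⟨h1, h2⟩ := T.inv_jacobian_le hp'
  rw [shift, abs_mul, abs_of_pos h1]
  have h3 := T.abs_metricSq₁_div_le hp'
  calc _ ≤ 3 / 2 * (a * M) * 2 := mul_le_mul h3 h2 h1.le ((abs_nonneg _).trans h3)
    _ = _ := by ring

theorem ThinStrip.memLp_shift (T : S.ThinStrip M a) :
    MemLp (fun p : ℝ × ℝ => ((S.shift a p : ℝ) : ℂ)) ∞ stripMeasure := by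
  refine memLp_top_of_bound (C := 3 * (a * M)) ?_ ?_
  · have h1 := S.measurable_jacobian
    have h2 := S.measurable_metricSq₁
    have h3 := S.continuous_metricSq.measurable
    unfold shift
    exact Measurable.aestronglyMeasurable (by fun_prop)
  · filter_upwards [ae_mem_strip] with p hp
    rw [Complex.norm_real, Real.norm_eq_abs]
    exact T.abs_shift_le hp

/-- The coefficient `-∂_u f / (2f)` on `Π`, where `f` is evaluated at `(s, a u)`. -/
def transverseShift (S : StripData n) (a : ℝ) (p : ℝ × ℝ) : ℝ :=
  -(a * (S.metricSq₂ (p.1, a * p.2) / (4 * S.metricSq (p.1, a * p.2))))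

/-- The derivative of `transverseShift` in the transverse variable. -/
def transverseShift' (S : StripData n) (a : ℝ) (p : ℝ × ℝ) : ℝ :=
  -(a ^ 2 * (S.metricSq₂₂ (p.1, a * p.2) / (4 * S.metricSq (p.1, a * p.2)) -
    S.metricSq₂ (p.1, a * p.2) ^ 2 / (4 * S.metricSq (p.1, a * p.2) ^ 2)))

theorem ThinStrip.metricSq_ne (T : S.ThinStrip M a) {p : ℝ × ℝ} (hp : p ∈ strip) :
    S.metricSq (p.1, a * p.2) ≠ 0 :=
  (T.metricSq_pos ((mem_strip_iff T.pos p).2 hp)).ne'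

theorem ThinStrip.continuousOn_transverseShift (T : S.ThinStrip M a) :
    ContinuousOn (S.transverseShift a) strip := by
  have h1 := S.continuous_metricSq
  have h2 := S.continuous_metricSq₂
  unfold transverseShift
  exact (continuousOn_const.mul (ContinuousOn.div (by fun_prop) (by fun_prop) fun p hp =>
    mul_ne_zero four_ne_zero (T.metricSq_ne hp))).neg

theorem ThinStrip.continuousOn_transverseShift' (T : S.ThinStrip M a) :
    ContinuousOn (S.transverseShift' a) strip := by
  have h1 := S.continuous_metricSq
  have h2 := S.continuous_metricSq₂
  have h3 := S.continuous_metricSq₂₂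
  unfold transverseShift'
  refine (continuousOn_const.mul (ContinuousOn.sub ?_ ?_)).neg
  · exact ContinuousOn.div (by fun_prop) (by fun_prop) fun p hp =>
      mul_ne_zero four_ne_zero (T.metricSq_ne hp)
  · exact ContinuousOn.div (by fun_prop) (by fun_prop) fun p hp =>
      mul_ne_zero four_ne_zero (pow_ne_zero 2 (T.metricSq_ne hp))

theorem ThinStrip.continuousOn_transformedPotential (T : S.ThinStrip M a) :
    ContinuousOn (fun p : ℝ × ℝ => S.transformedPotential (p.1, a * p.2)) strip := by
  have h1 := S.continuous_metricSq
  have h2 := S.continuous_metricSq₂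
  have h3 := S.continuous_metricSq₂₂
  unfold transformedPotential
  refine ContinuousOn.sub ?_ ?_
  · exact ContinuousOn.div (by fun_prop) (by fun_prop) fun p hp =>
      mul_ne_zero four_ne_zero (T.metricSq_ne hp)
  · exact ContinuousOn.div (by fun_prop) (by fun_prop) fun p hp =>
      mul_ne_zero (by norm_num) (pow_ne_zero 2 (T.metricSq_ne hp))

theorem ThinStrip.hasDerivAt_transverseShift (T : S.ThinStrip M a) {p : ℝ × ℝ} (hp : p ∈ strip) :
    HasDerivAt (fun u => S.transverseShift a (p.1, u)) (S.transverseShift' a p) p.2 := by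
  have hl : HasDerivAt (fun u : ℝ => a * u) a p.2 := by
    simpa using (hasDerivAt_id p.2).const_mul a
  have h1 := (S.hasDerivAt_metricSq_snd p.1 (a * p.2)).comp p.2 hl
  have h2 := (S.hasDerivAt_metricSq₂_snd p.1 (a * p.2)).comp p.2 hl
  have hne := T.metricSq_ne hp
  have h3 := ((h2.div (h1.const_mul 4) (mul_ne_zero four_ne_zero hne)).const_mul a).neg
  refine h3.congr_deriv ?_
  simp only [transverseShift', Function.comp_apply]
  field_simp

theorem ThinStrip.memLp_transverseShift (T : S.ThinStrip M a) :
    MemLp (fun p : ℝ × ℝ => ((S.transverseShift a p : ℝ) : ℂ)) ∞ stripMeasure := by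
  refine memLp_top_of_forall_strip T.continuousOn_transverseShift (C := a * (3 / 2 * M))
    fun p hp => ?_
  rw [transverseShift, abs_neg, abs_mul, abs_of_pos T.pos]
  exact mul_le_mul_of_nonneg_left (T.abs_metricSq₂_div_le ((mem_strip_iff T.pos p).2 hp)) T.pos.le

theorem ThinStrip.memLp_transformedPotential (T : S.ThinStrip M a) :
    MemLp (fun p : ℝ × ℝ => ((S.transformedPotential (p.1, a * p.2) : ℝ) : ℂ)) ∞
      stripMeasure := by
  refine memLp_top_of_forall_strip T.continuousOn_transformedPotential
    (C := 40 * M ^ 2 * (a * M) + M ^ 2) fun p hp => ?_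
  have h1 := abs_le.1 (T.estimates ((mem_strip_iff T.pos p).2 hp)).2.2.2
  have h2 := abs_le.1 (abs_Veff_le T.toUniformBounds p.1)
  rw [abs_le]
  constructor <;> linarith

/-- Multiplication by `f⁻¹`. -/
def ThinStrip.opInvJ (T : S.ThinStrip M a) : L2Strip →L[ℂ] L2Strip := mulOp _ T.memLp_inv_jacobian

/-- Multiplication by `f`. -/
def ThinStrip.opJ (T : S.ThinStrip M a) : L2Strip →L[ℂ] L2Strip := mulOp _ T.memLp_jacobian

/-- Multiplication by `f⁻¹ ∂₁f / (2f)`. -/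
def ThinStrip.opShift (T : S.ThinStrip M a) : L2Strip →L[ℂ] L2Strip := mulOp _ T.memLp_shift

/-- Multiplication by `-∂_u f / (2f)`. -/
def ThinStrip.opW (T : S.ThinStrip M a) : L2Strip →L[ℂ] L2Strip := mulOp _ T.memLp_transverseShift

/-- Multiplication by the transformed potential. -/
def ThinStrip.opV (T : S.ThinStrip M a) : L2Strip →L[ℂ] L2Strip :=
  mulOp _ T.memLp_transformedPotential

/-- The triple `x = (ψ, ∂₁ψ, ∂₂ψ)` is, in the coordinates of `Π` and after the unitary transform,
given by the triple `y = (φ, ∂₁φ, ∂₂φ)` with `φ = Uψ`. The component `∂₁ψ` is transported by `U₁`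
because its weight is `f⁻¹`, which produces the factor `f⁻¹` in front of `∂₁φ`. -/
def ThinStrip.Corresponds (T : S.ThinStrip M a) (hak : a * S.supNorm < 1)
    (x : S.Hilb a × Lp ℂ 2 (S.measureInv a) × S.Hilb a) (y : L2Strip × L2Strip × L2Strip) : Prop :=
  S.U T.pos hak x.1 = y.1 ∧ S.U₁ T.pos hak x.2.1 = T.opInvJ y.2.1 - T.opShift y.1 ∧
    S.U T.pos hak x.2.2 = ((a⁻¹ : ℝ) : ℂ) • (y.2.2 + T.opW y.1)

theorem ThinStrip.opInvJ_opJ (T : S.ThinStrip M a) (x : L2Strip) :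
    T.opInvJ (T.opJ x) = x := by
  refine Lp.ext ?_
  filter_upwards [coeFn_mulOp T.memLp_inv_jacobian (T.opJ x), coeFn_mulOp T.memLp_jacobian x,
    ae_mem_strip] with p h1 h2 hp
  have hf := (T.jacobian_mem ((mem_strip_iff T.pos p).2 hp)).1
  have hne : (S.jacobian (p.1, a * p.2) : ℂ) ≠ 0 := by
    have : S.jacobian (p.1, a * p.2) ≠ 0 := by linarith
    exact_mod_cast this
  have h3 : T.opJ x p = (S.jacobian (p.1, a * p.2) : ℂ) * x p := h2
  refine h1.trans ?_
  rw [h3]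
  push_cast
  field_simp

theorem ThinStrip.isFiniteMeasureOnCompacts_measure (T : S.ThinStrip M a) :
    IsFiniteMeasureOnCompacts (S.measure a) :=
  isFiniteMeasureOnCompacts_weightedMeasure (measurableSet_Ω₀ a)
    fun _ hp => (T.jacobian_mem hp).2

theorem ThinStrip.isFiniteMeasureOnCompacts_measureInv (T : S.ThinStrip M a) :
    IsFiniteMeasureOnCompacts (S.measureInv a) :=
  isFiniteMeasureOnCompacts_weightedMeasure (measurableSet_Ω₀ a)
    fun _ hp => (T.inv_jacobian_le hp).2

theorem ThinStrip.ae_differentiableAt (T : S.ThinStrip M a) :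
    ∀ᵐ p ∂stripMeasure, DifferentiableAt ℝ S.kΘ p.1 ∧
    DifferentiableAt ℝ (fun s => ‖deriv S.Θ s‖ ^ 2) p.1 := by
  refine ae_stripMeasure_of_ae_fst (P := fun s => DifferentiableAt ℝ S.kΘ s ∧
    DifferentiableAt ℝ (fun s => ‖deriv S.Θ s‖ ^ 2) s) ?_
  filter_upwards [T.lipschitzWith_kΘ.ae_differentiableAt_real,
    T.lipschitzWith_τ.ae_differentiableAt_real] with s h1 h2 using ⟨h1, h2⟩

/-- A test function on `Π` is mapped into the form domain by `φ ↦ (a f)^{-1/2} φ(s, t / a)`. The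
image is Lipschitz only, since `f` is; its almost everywhere gradient, computed by the product rule,
is the one prescribed by `Corresponds`. -/
theorem ThinStrip.mem_formDomain_of_test (T : S.ThinStrip M a) (hak : a * S.supNorm < 1)
    {x : S.Hilb a × Lp ℂ 2 (S.measureInv a) × S.Hilb a} {y : L2Strip × L2Strip × L2Strip}
    (hxy : T.Corresponds hak x y) (hy : y ∈ testGradients strip stripMeasure stripMeasure
      stripMeasure) : x ∈ S.formDomain a := by
  obtain ⟨φ, hφ, y0, y1, y2⟩ := hy
  obtain ⟨e0, e1, e2⟩ := hxy
  have ha := T.pos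
  have hane : (a : ℂ) ≠ 0 := by exact_mod_cast ha.ne'
  have := T.isFiniteMeasureOnCompacts_measure
  have := T.isFiniteMeasureOnCompacts_measureInv
  have hg : IsTestFunction (Ω₀ a) fun p : ℝ × ℝ => φ (p.1, a⁻¹ * p.2) := by
    refine hφ.comp_scaling (inv_ne_zero ha.ne') fun p hp => ?_
    have := (mem_strip_iff ha _).2 hp
    simpa [ha.ne'] using this
  obtain ⟨⟨L, hL⟩, hc, hs⟩ := T.bddLipOn_inv_sqrt_density.exists_lipschitzWith_mul hg
  have hpos : ∀ p ∈ strip, 0 < √(a * √(S.metricSq (p.1, a * p.2))) := fun p hp =>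
    Real.sqrt_pos.2 (mul_pos ha (Real.sqrt_pos.2
      (T.metricSq_pos ((mem_strip_iff ha p).2 hp))))
  have hne : ∀ p ∈ strip, ((√(a * √(S.metricSq (p.1, a * p.2))) : ℝ) : ℂ) ≠ 0 := fun p hp => by
    exact_mod_cast (hpos p hp).ne'
  have hinv : ∀ p : ℝ × ℝ, a⁻¹ * (a * p.2) = p.2 := fun p => inv_mul_cancel_left₀ ha.ne' _
  refine mem_dirichletSpace_of_lipschitz (μ := S.measure a) (μ₁ := S.measureInv a)
    (μ₂ := S.measure a) (isOpen_Ω₀ a) (weightedMeasure_ac _ _)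
    (weightedMeasure_ac _ _) (weightedMeasure_ac _ _) hL hc hs x ?_ ?_ ?_
  · refine ae_weightedMeasure_of_ae_strip S.measurable_jacobian ha ?_
    filter_upwards [S.U_apply ha hak x.1, y0, ae_mem_strip] with p h1 h2 hp
    rw [e0, h2, jacobian_eq] at h1
    rw [hinv, h1]
    push_cast
    rw [inv_mul_cancel_left₀ (hne p hp)]
  · refine ae_weightedMeasure_of_ae_strip S.measurable_jacobian.inv ha ?_
    filter_upwards [S.U₁_apply ha hak x.2.1, y0, y1, Lp.coeFn_sub (T.opInvJ y.2.1) (T.opShift y.1),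
      coeFn_mulOp T.memLp_inv_jacobian y.2.1, coeFn_mulOp T.memLp_shift y.1, ae_mem_strip,
      T.ae_differentiableAt] with p h1 h2 h3 h4 h5 h6 hp hd
    have hp' := (mem_strip_iff ha p).2 hp
    have hf : 0 < S.jacobian (p.1, a * p.2) := by linarith [(T.jacobian_mem hp').1]
    rw [e1, h4, Pi.sub_apply] at h1
    replace h1 := (congrArg₂ (fun u v => u - v) h5 h6).symm.trans h1
    rw [h2, h3, sqrt_mul_inv_eq hf, shift, jacobian_eq] at h1
    have d1 := (hasDerivAt_inv_sqrt_mul_sqrt (S.hasDerivAt_metricSq_fst hd.1 hd.2 (a * p.2))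
      (T.metricSq_pos hp') ha).ofReal_comp
    have d2 := d1.mul (hasDerivAt_slice_fst (hφ.differentiable p))
    rw [hinv]
    refine d2.congr_deriv ?_
    have hf' : ((√(S.metricSq (p.1, a * p.2)) : ℝ) : ℂ) ≠ 0 := by
      rw [jacobian_eq] at hf
      exact_mod_cast hf.ne'
    have hA := hne p hp
    push_cast at h1 ⊢
    generalize ((√(a * √(S.metricSq (p.1, a * p.2))) : ℝ) : ℂ) = A at h1 hA ⊢
    generalize ((√(S.metricSq (p.1, a * p.2)) : ℝ) : ℂ) = f at h1 hf' ⊢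
    generalize (S.metricSq₁ (p.1, a * p.2) : ℂ) / (4 * (S.metricSq (p.1, a * p.2) : ℂ)) = r
      at h1 ⊢
    have h8 : f⁻¹ * (A * x.2.1 (p.1, a * p.2)) = f⁻¹ * (d₁ φ p - r * φ p) := by
      linear_combination -h1
    have h9 := mul_left_cancel₀ (inv_ne_zero hf') h8
    apply mul_left_cancel₀ hA
    rw [h9]
    field_simp
    ring
  · refine ae_weightedMeasure_of_ae_strip S.measurable_jacobian ha ?_
    filter_upwards [S.U_apply ha hak x.2.2, y0, y2,
      Lp.coeFn_smul ((a⁻¹ : ℝ) : ℂ) (y.2.2 + T.opW y.1), Lp.coeFn_add y.2.2 (T.opW y.1),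
      coeFn_mulOp T.memLp_transverseShift y.1, ae_mem_strip] with p h1 h2 h3 h4 h5 h6 hp
    have hp' := (mem_strip_iff ha p).2 hp
    have h6' : T.opW y.1 p = (S.transverseShift a p : ℂ) * y.1 p := h6
    rw [e2, h4, Pi.smul_apply, h5, Pi.add_apply, h6', h2, h3, transverseShift, jacobian_eq] at h1
    have d1 := (hasDerivAt_inv_sqrt_mul_sqrt (S.hasDerivAt_metricSq_snd p.1 (a * p.2))
      (T.metricSq_pos hp') ha).ofReal_comp
    have hl : HasDerivAt (fun t : ℝ => a⁻¹ * t) a⁻¹ (a * p.2) := by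
      simpa using (hasDerivAt_id (a * p.2)).const_mul a⁻¹
    have d3 := (hasDerivAt_slice_snd (hφ.differentiable p))
    rw [← hinv p] at d3
    have d2 := d1.mul (d3.scomp (a * p.2) hl)
    refine d2.congr_deriv ?_
    have hA := hne p hp
    simp only [Function.comp_apply, hinv, Complex.real_smul]
    push_cast at h1 ⊢
    rw [smul_eq_mul] at h1
    generalize ((√(a * √(S.metricSq (p.1, a * p.2))) : ℝ) : ℂ) = A at h1 hA ⊢
    generalize (S.metricSq₂ (p.1, a * p.2) : ℂ) / (4 * (S.metricSq (p.1, a * p.2) : ℂ)) = r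
      at h1 ⊢
    apply mul_left_cancel₀ hA
    rw [← h1]
    field_simp
    ring

/-- A test function on `Ω₀` is mapped into `W₀^{1,2}(Π)` by `U`. -/
theorem ThinStrip.mem_stripSobolev_of_test (T : S.ThinStrip M a) (hak : a * S.supNorm < 1)
    {x : S.Hilb a × Lp ℂ 2 (S.measureInv a) × S.Hilb a} {y : L2Strip × L2Strip × L2Strip}
    (hxy : T.Corresponds hak x y) (hx : x ∈ testGradients (Ω₀ a) (S.measure a) (S.measureInv a)
      (S.measure a)) : y ∈ stripSobolev := by
  obtain ⟨ψ, hψ, x0, x1, x2⟩ := hx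
  obtain ⟨e0, e1, e2⟩ := hxy
  have ha := T.pos
  have hane : (a : ℂ) ≠ 0 := by exact_mod_cast ha.ne'
  have hg : IsTestFunction strip fun p : ℝ × ℝ => ψ (p.1, a * p.2) :=
    hψ.comp_scaling ha.ne' fun p hp => (mem_strip_iff ha p).1 hp
  have hlip : LipschitzWith (max 1 (Real.nnabs a)) fun p : ℝ × ℝ => (p.1, a * p.2) := by
    have h2 : LipschitzWith (Real.nnabs a) fun p : ℝ × ℝ => a * p.2 :=
      LipschitzWith.of_dist_le_mul fun p p' => by
        rw [Real.dist_eq, ← mul_sub, abs_mul, Real.coe_nnabs]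
        exact mul_le_mul_of_nonneg_left (le_max_right _ _) (abs_nonneg a)
    exact LipschitzWith.prod_fst.prodMk h2
  obtain ⟨⟨L, hL⟩, hc, hs⟩ := (T.bddLipOn_sqrt_density.comp (O' := strip) hlip
    fun p hp => (mem_strip_iff ha p).2 hp).exists_lipschitzWith_mul hg
  have z0 := ae_strip_of_ae_weightedMeasure S.measurable_jacobian ha
    (fun p hp => by linarith [(T.jacobian_mem hp).1]) x0
  have z1 := ae_strip_of_ae_weightedMeasure S.measurable_jacobian.inv ha
    (fun p hp => (T.inv_jacobian_le hp).1) x1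
  have z2 := ae_strip_of_ae_weightedMeasure S.measurable_jacobian ha
    (fun p hp => by linarith [(T.jacobian_mem hp).1]) x2
  refine mem_dirichletSpace_of_lipschitz isOpen_strip stripMeasure_ac stripMeasure_ac
    stripMeasure_ac hL hc hs y ?_ ?_ ?_
  · rw [← e0]
    filter_upwards [S.U_apply ha hak x.1, z0] with p h1 h2
    rw [h1, h2, jacobian_eq]
  · filter_upwards [S.U_apply ha hak x.1, S.U₁_apply ha hak x.2.1, z0, z1,
      Lp.coeFn_sub (T.opInvJ y.2.1) (T.opShift y.1), coeFn_mulOp T.memLp_inv_jacobian y.2.1,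
      coeFn_mulOp T.memLp_shift y.1, ae_mem_strip, T.ae_differentiableAt]
      with p h0 h1 h2 h3 h4 h5 h6 hp hd
    have hp' := (mem_strip_iff ha p).2 hp
    have hf : 0 < S.jacobian (p.1, a * p.2) := by linarith [(T.jacobian_mem hp').1]
    rw [e0, h2] at h0
    rw [e1, h4, Pi.sub_apply] at h1
    replace h1 := (congrArg₂ (fun u v => u - v) h5 h6).symm.trans h1
    rw [h0, h3, sqrt_mul_inv_eq hf, shift, jacobian_eq] at h1
    have d1 := (hasDerivAt_sqrt_mul_sqrt (S.hasDerivAt_metricSq_fst hd.1 hd.2 (a * p.2))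
      (T.metricSq_pos hp') ha).ofReal_comp
    have d3 : HasDerivAt (fun s => ψ (s, a * p.2)) (d₁ ψ (p.1, a * p.2)) p.1 :=
      hasDerivAt_slice_fst (hψ.differentiable (p.1, a * p.2))
    have d2 := d1.mul d3
    refine d2.congr_deriv ?_
    have hf' : ((√(S.metricSq (p.1, a * p.2)) : ℝ) : ℂ) ≠ 0 := by
      rw [jacobian_eq] at hf
      exact_mod_cast hf.ne'
    push_cast at h1 ⊢
    generalize ((√(a * √(S.metricSq (p.1, a * p.2))) : ℝ) : ℂ) = A at h1 ⊢
    generalize ((√(S.metricSq (p.1, a * p.2)) : ℝ) : ℂ) = f at h1 hf' ⊢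
    generalize (S.metricSq₁ (p.1, a * p.2) : ℂ) / (4 * (S.metricSq (p.1, a * p.2) : ℂ)) = r
      at h1 ⊢
    apply mul_left_cancel₀ (inv_ne_zero hf')
    linear_combination -h1
  · filter_upwards [S.U_apply ha hak x.1, S.U_apply ha hak x.2.2, z0, z2,
      Lp.coeFn_smul ((a⁻¹ : ℝ) : ℂ) (y.2.2 + T.opW y.1), Lp.coeFn_add y.2.2 (T.opW y.1),
      coeFn_mulOp T.memLp_transverseShift y.1, ae_mem_strip] with p h0 h1 h2 h3 h4 h5 h6 hp
    have hp' := (mem_strip_iff ha p).2 hp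
    have h6' : T.opW y.1 p = (S.transverseShift a p : ℂ) * y.1 p := h6
    rw [e0, h2, jacobian_eq] at h0
    rw [e2, h4, Pi.smul_apply, h5, Pi.add_apply, h6', h0, h3, transverseShift, jacobian_eq] at h1
    have d1 := (hasDerivAt_sqrt_mul_sqrt (S.hasDerivAt_metricSq_snd p.1 (a * p.2))
      (T.metricSq_pos hp') ha)
    have hl : HasDerivAt (fun t : ℝ => a * t) a p.2 := by
      simpa using (hasDerivAt_id p.2).const_mul a
    have d2 := (d1.scomp p.2 hl).ofReal_comp.mul
      ((hasDerivAt_slice_snd (hψ.differentiable (p.1, a * p.2))).scomp p.2 hl)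
    refine d2.congr_deriv ?_
    simp only [Function.comp_apply, Complex.real_smul, smul_eq_mul]
    push_cast at h1 ⊢
    rw [smul_eq_mul] at h1
    generalize ((√(a * √(S.metricSq (p.1, a * p.2))) : ℝ) : ℂ) = A at h1 ⊢
    generalize (S.metricSq₂ (p.1, a * p.2) : ℂ) / (4 * (S.metricSq (p.1, a * p.2) : ℂ)) = r
      at h1 ⊢
    apply mul_left_cancel₀ (inv_ne_zero hane)
    linear_combination -h1 + A * d₂ ψ (p.1, a * p.2) * mul_inv_cancel₀ hane

end StripData

/-! ### Resolvents of gradient forms -/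

/-- A real `z` strictly below the form belongs to the resolvent set, and the resolvent solves the
variational problem. The bound need only hold in the norm of `L²(μ)`. -/
theorem exists_isResolventAt_gradientForm {O : Set (ℝ × ℝ)} {μ μ₁ μ₂ : Measure (ℝ × ℝ)}
    {α β z c : ℝ} (hα : 0 < α) (hβ : 0 < β) (hc : 0 < c) (V : Lp ℂ 2 μ →L[ℂ] Lp ℂ 2 μ)
    (hdense : ∀ η : Lp ℂ 2 μ, (∀ y ∈ dirichletSpace O μ μ₁ μ₂, inner ℂ y.1 η = 0) → η = 0)
    (h : ∀ x ∈ dirichletSpace O μ μ₁ μ₂, c * ‖x.1‖ ^ 2 ≤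
      α * ‖x.2.1‖ ^ 2 + β * ‖x.2.2‖ ^ 2 + (inner ℂ x.1 (V x.1)).re - z * ‖x.1‖ ^ 2) :
    ∃ R : Lp ℂ 2 μ →L[ℂ] Lp ℂ 2 μ,
      IsResolventAt (formOperator (dirichletSpace O μ μ₁ μ₂) (gradientForm μ μ₁ μ₂ α β V)) z R ∧
      ∀ F, ∃ p, (R F, p) ∈ dirichletSpace O μ μ₁ μ₂ ∧ ∀ y ∈ dirichletSpace O μ μ₁ μ₂,
        gradientForm μ μ₁ μ₂ α β V y (R F, p) - z * inner ℂ y.1 (R F) = inner ℂ y.1 F := by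
  have happ : ∀ y x, gradientForm μ μ₁ μ₂ α β V y x =
      α * inner ℂ y.2.1 x.2.1 + β * inner ℂ y.2.2 x.2.2 + inner ℂ y.1 (V x.1) := fun _ _ => rfl
  have hself : ∀ x, (gradientForm μ μ₁ μ₂ α β V x x - z * inner ℂ x.1 x.1).re =
      α * ‖x.2.1‖ ^ 2 + β * ‖x.2.2‖ ^ 2 + (inner ℂ x.1 (V x.1)).re - z * ‖x.1‖ ^ 2 := fun x => by
    simp only [happ, Complex.sub_re, Complex.add_re, Complex.re_ofReal_mul, re_inner_self_eq]
  refine exists_isResolventAt_formOperator hc hdense ?_ (fun x hx => ?_) ?_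
  · rintro ⟨p₁, p₂⟩ - h0
    have h1 := congrArg Complex.re h0
    simp only [happ, Complex.add_re, Complex.re_ofReal_mul, re_inner_self_eq, map_zero,
      inner_zero_left, Complex.zero_re, add_zero] at h1
    have h2 : 0 ≤ α * ‖p₁‖ ^ 2 := by positivity
    have h3 : 0 ≤ β * ‖p₂‖ ^ 2 := by positivity
    have h4 : α * ‖p₁‖ ^ 2 = 0 := by linarith
    have h5 : β * ‖p₂‖ ^ 2 = 0 := by linarith
    have h6 : p₁ = 0 := by simpa [hα.ne'] using h4
    have h7 : p₂ = 0 := by simpa [hβ.ne'] using h5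
    rw [h6, h7]
    rfl
  · rw [hself]
    exact h x hx
  · -- coercivity in the whole form norm follows from the bound `Q ≥ c ‖x.1‖²`, because the
    -- gradient part of `Q` is `Q` up to a multiple of `‖x.1‖²`
    set B := ‖V‖ + |z| with hB
    have hB0 : 0 ≤ B := by positivity
    set Λ := 1 + B / c with hΛ
    have hΛ0 : 0 < Λ := by positivity
    set D := 1 / c + Λ / α + Λ / β with hD
    have hD0 : 0 < D := by positivity
    refine exists_gradient_form_solution _ isClosed_closure α β z V (c := 1 / D) (by positivity)
      fun x hx => ?_
    have hQ := h x hx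
    set Q := α * ‖x.2.1‖ ^ 2 + β * ‖x.2.2‖ ^ 2 + (inner ℂ x.1 (V x.1)).re - z * ‖x.1‖ ^ 2 with hQd
    have hv : |(inner ℂ x.1 (V x.1)).re| ≤ ‖V‖ * ‖x.1‖ ^ 2 := by
      refine (Complex.abs_re_le_norm _).trans ((norm_inner_le_norm _ _).trans ?_)
      have := V.le_opNorm x.1
      nlinarith [norm_nonneg x.1]
    have hz : z * ‖x.1‖ ^ 2 ≤ |z| * ‖x.1‖ ^ 2 :=
      mul_le_mul_of_nonneg_right (le_abs_self z) (sq_nonneg _)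
    have h1 : ‖x.1‖ ^ 2 ≤ Q / c := by
      rw [le_div_iff₀ hc]
      linarith
    have h2 : α * ‖x.2.1‖ ^ 2 + β * ‖x.2.2‖ ^ 2 ≤ Λ * Q := by
      have h3 := (abs_le.1 hv).1
      have h4 : B * ‖x.1‖ ^ 2 ≤ B * (Q / c) := mul_le_mul_of_nonneg_left h1 hB0
      have h5 : Λ * Q = Q + B * (Q / c) := by rw [hΛ]; ring
      have h6 : B * ‖x.1‖ ^ 2 = ‖V‖ * ‖x.1‖ ^ 2 + |z| * ‖x.1‖ ^ 2 := by rw [hB]; ring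
      linarith
    have n1 : 0 ≤ α * ‖x.2.1‖ ^ 2 := by positivity
    have n2 : 0 ≤ β * ‖x.2.2‖ ^ 2 := by positivity
    have h3 : ‖x.2.1‖ ^ 2 ≤ Λ * Q / α := by
      rw [le_div_iff₀ hα]
      linarith
    have h4 : ‖x.2.2‖ ^ 2 ≤ Λ * Q / β := by
      rw [le_div_iff₀ hβ]
      linarith
    rw [one_div, inv_mul_le_iff₀ hD0]
    have h5 : D * Q = Q / c + Λ * Q / α + Λ * Q / β := by rw [hD]; ring
    linarith

namespace StripData

variable {n : ℕ} {S : StripData n} {M a : ℝ}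

/-! ### The transformed form and its comparison with the effective one -/

/-- The transform maps the form domain of `H` onto `W₀^{1,2}(Π)`. -/
theorem ThinStrip.exists_mem_formDomain (T : S.ThinStrip M a) (hak : a * S.supNorm < 1)
    {y : L2Strip × L2Strip × L2Strip} (hy : y ∈ stripSobolev) :
    ∃ x ∈ S.formDomain a, T.Corresponds hak x y := by
  let Φ : L2Strip × L2Strip × L2Strip → S.Hilb a × Lp ℂ 2 (S.measureInv a) × S.Hilb a := fun y =>
    ((S.U T.pos hak).symm y.1, (S.U₁ T.pos hak).symm (T.opInvJ y.2.1 - T.opShift y.1),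
      (S.U T.pos hak).symm (((a⁻¹ : ℝ) : ℂ) • (y.2.2 + T.opW y.1)))
  have hΦ : ∀ y, T.Corresponds hak (Φ y) y := fun y =>
    ⟨LinearIsometryEquiv.apply_symm_apply _ _, LinearIsometryEquiv.apply_symm_apply _ _,
      LinearIsometryEquiv.apply_symm_apply _ _⟩
  have hc : Continuous Φ := by
    have h1 := (S.U T.pos hak).symm.continuous
    have h2 := (S.U₁ T.pos hak).symm.continuous
    have h3 := T.opInvJ.continuous
    have h4 := T.opShift.continuous
    have h5 := T.opW.continuous
    fun_prop
  refine ⟨Φ y, ?_, hΦ y⟩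
  have h := map_mem_closure (t := (S.formDomain a : Set _)) hc hy
    fun w hw => T.mem_formDomain_of_test hak (hΦ w) hw
  have hcl : IsClosed (S.formDomain a : Set (S.Hilb a × Lp ℂ 2 (S.measureInv a) × S.Hilb a)) :=
    isClosed_closure
  rwa [hcl.closure_eq] at h

/-- The transform maps the form domain of `H` into `W₀^{1,2}(Π)`. -/
theorem ThinStrip.exists_mem_stripSobolev (T : S.ThinStrip M a) (hak : a * S.supNorm < 1)
    {x : S.Hilb a × Lp ℂ 2 (S.measureInv a) × S.Hilb a} (hx : x ∈ S.formDomain a) :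
    ∃ y ∈ stripSobolev, T.Corresponds hak x y := by
  let Ψ : S.Hilb a × Lp ℂ 2 (S.measureInv a) × S.Hilb a → L2Strip × L2Strip × L2Strip := fun x =>
    (S.U T.pos hak x.1, T.opJ (S.U₁ T.pos hak x.2.1 + T.opShift (S.U T.pos hak x.1)),
      (a : ℂ) • S.U T.pos hak x.2.2 - T.opW (S.U T.pos hak x.1))
  have hane : (a : ℂ) ≠ 0 := by exact_mod_cast T.pos.ne'
  have hΨ : ∀ x, T.Corresponds hak x (Ψ x) := fun x => by
    refine ⟨rfl, ?_, ?_⟩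
    · change _ = T.opInvJ (T.opJ _) - _
      rw [T.opInvJ_opJ, add_sub_cancel_right]
    · change _ = _ • (_ - _ + _)
      rw [sub_add_cancel, smul_smul]
      push_cast
      rw [inv_mul_cancel₀ hane, one_smul]
  have hc : Continuous Ψ := by
    have h1 := (S.U T.pos hak).continuous
    have h2 := (S.U₁ T.pos hak).continuous
    have h3 := T.opJ.continuous
    have h4 := T.opShift.continuous
    have h5 := T.opW.continuous
    fun_prop
  refine ⟨Ψ x, ?_, hΨ x⟩
  have h := map_mem_closure (t := (stripSobolev : Set _)) hc hx
    fun w hw => T.mem_stripSobolev_of_test hak (hΨ w) hw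
  have hcl : IsClosed (stripSobolev : Set (L2Strip × L2Strip × L2Strip)) := isClosed_closure
  rwa [hcl.closure_eq] at h

/-- The form of `H` in the space `L²(Π)`, after integration by parts. -/
def ThinStrip.transformedForm (T : S.ThinStrip M a) (y x : L2Strip × L2Strip × L2Strip) : ℂ :=
  inner ℂ (T.opInvJ y.2.1 - T.opShift y.1) (T.opInvJ x.2.1 - T.opShift x.1) +
    (((a ^ 2)⁻¹ : ℝ) : ℂ) * inner ℂ y.2.2 x.2.2 + inner ℂ y.1 (T.opV x.1)

/-- The form of `Ĥ₀`. -/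
def effectiveForm (S : StripData n) (a : ℝ) (y x : L2Strip × L2Strip × L2Strip) : ℂ :=
  gradientForm stripMeasure stripMeasure stripMeasure 1 (((a ^ 2)⁻¹ : ℝ) : ℂ) S.mulVeff y x

theorem effectiveForm_apply (y x : L2Strip × L2Strip × L2Strip) :
    S.effectiveForm a y x = inner ℂ y.2.1 x.2.1 + (((a ^ 2)⁻¹ : ℝ) : ℂ) * inner ℂ y.2.2 x.2.2 +
      inner ℂ y.1 (S.mulVeff x.1) := by
  change (1 : ℂ) * inner ℂ y.2.1 x.2.1 + (((a ^ 2)⁻¹ : ℝ) : ℂ) * inner ℂ y.2.2 x.2.2 +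
    inner ℂ y.1 (S.mulVeff x.1) = _
  rw [one_mul]

/-- The form of `H` is carried over to the transformed form; the transverse cross terms are removed
by completing the square with `W = -∂_u f / (2f)`, for which `W² - ∂_u W` is `a²` times the
transformed potential. -/
theorem ThinStrip.gradientForm_eq_transformedForm (T : S.ThinStrip M a) (hak : a * S.supNorm < 1)
    {x x' : S.Hilb a × Lp ℂ 2 (S.measureInv a) × S.Hilb a} {y y' : L2Strip × L2Strip × L2Strip}
    (h : T.Corresponds hak x y) (h' : T.Corresponds hak x' y') (hy : y ∈ stripSobolev)
    (hy' : y' ∈ stripSobolev) :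
    gradientForm (S.measure a) (S.measureInv a) (S.measure a) 1 1 0 x' x =
      T.transformedForm y' y := by
  have ha := T.pos
  have hVb : MemLp (fun p : ℝ × ℝ =>
      ((a ^ 2 * S.transformedPotential (p.1, a * p.2) : ℝ) : ℂ)) ∞ stripMeasure := by
    have := T.memLp_transformedPotential.const_mul ((a ^ 2 : ℝ) : ℂ)
    refine this.congr_norm ?_ ?_
    · exact (this.1.congr (Filter.Eventually.of_forall fun p => by push_cast; rfl))
    · exact Filter.Eventually.of_forall fun p => by push_cast; rfl
  have key := inner_add_mulOp T.continuousOn_transverseShift T.continuousOn_transverseShift'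
    (fun p hp => T.hasDerivAt_transverseShift hp)
    (V := fun p => a ^ 2 * S.transformedPotential (p.1, a * p.2)) (fun p hp => by
      have := T.metricSq_ne hp
      simp only [transverseShift, transverseShift', transformedPotential]
      field_simp
      ring) T.memLp_transverseShift hVb y' hy' y hy
  have hV : mulOp _ hVb y.1 = ((a ^ 2 : ℝ) : ℂ) • T.opV y.1 := by
    refine Lp.ext ?_
    filter_upwards [coeFn_mulOp hVb y.1, Lp.coeFn_smul ((a ^ 2 : ℝ) : ℂ) (T.opV y.1),
      coeFn_mulOp T.memLp_transformedPotential y.1] with p h1 h2 h3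
    have h3' : T.opV y.1 p = (S.transformedPotential (p.1, a * p.2) : ℂ) * y.1 p := h3
    rw [h1, h2, Pi.smul_apply, h3', smul_eq_mul]
    push_cast
    ring
  rw [hV, inner_smul_right] at key
  change 1 * inner ℂ x'.2.1 x.2.1 + 1 * inner ℂ x'.2.2 x.2.2 +
    inner ℂ x'.1 ((0 : S.Hilb a →L[ℂ] S.Hilb a) x.1) = _
  rw [zero_apply, inner_zero_right, add_zero, one_mul, one_mul,
    ← (S.U₁ ha hak).inner_map_map, ← (S.U ha hak).inner_map_map, h.2.1, h'.2.1, h.2.2, h'.2.2,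
    inner_smul_left, inner_smul_right, Complex.conj_ofReal]
  change _ + _ * (_ * inner ℂ (y'.2.2 + mulOp _ T.memLp_transverseShift y'.1)
    (y.2.2 + mulOp _ T.memLp_transverseShift y.1)) = _
  rw [key, transformedForm]
  have hane : (a : ℂ) ≠ 0 := by exact_mod_cast ha.ne'
  push_cast
  field_simp
  ring

/-- The norm in which the two forms are compared; it does not involve the transverse derivative. -/
def longNorm (y : L2Strip × L2Strip × L2Strip) : ℝ := ‖y.1‖ + ‖y.2.1‖

/-- The forms differ by `O(a)`; their singular terms `a⁻² ∂₂` agree and cancel. -/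
theorem ThinStrip.norm_transformedForm_sub_le (T : S.ThinStrip M a)
    (y x : L2Strip × L2Strip × L2Strip) :
    ‖T.transformedForm y x - S.effectiveForm a y x‖ ≤
      58 * M ^ 3 * a * (longNorm y * longNorm x) := by
  have hM := T.one_le
  have hM0 : 0 ≤ M := by linarith
  have hε : 0 ≤ a * M := mul_nonneg T.pos.le hM0
  have hsmall := T.small
  have hd : ∀ w : L2Strip × L2Strip × L2Strip,
      ‖T.opInvJ w.2.1 - T.opShift w.1 - w.2.1‖ ≤ 6 * (a * M) * longNorm w := by
    intro w
    have h1 : ‖T.opInvJ w.2.1 - w.2.1‖ ≤ 6 * (a * M) * ‖w.2.1‖ := by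
      refine norm_mulOp_sub_self_le T.memLp_inv_jacobian ?_ w.2.1
      filter_upwards [ae_mem_strip] with p hp
      exact T.abs_inv_jacobian_sub_one_le ((mem_strip_iff T.pos p).2 hp)
    have h2 : ‖T.opShift w.1‖ ≤ 3 * (a * M) * ‖w.1‖ := by
      refine norm_mulOp_le T.memLp_shift ?_ w.1
      filter_upwards [ae_mem_strip] with p hp
      exact T.abs_shift_le hp
    have e : T.opInvJ w.2.1 - T.opShift w.1 - w.2.1 =
        (T.opInvJ w.2.1 - w.2.1) - T.opShift w.1 := by abel
    rw [e, longNorm]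
    refine (norm_sub_le _ _).trans ?_
    have := mul_nonneg hε (norm_nonneg w.1)
    linarith
  have hV : ‖T.opV x.1 - S.mulVeff x.1‖ ≤ 40 * M ^ 2 * (a * M) * ‖x.1‖ := by
    refine norm_mulOp_sub_le T.memLp_transformedPotential S.memLp_Veff ?_ x.1
    filter_upwards [ae_mem_strip] with p hp
    exact (T.estimates ((mem_strip_iff T.pos p).2 hp)).2.2.2
  have ny : ‖y.2.1‖ ≤ longNorm y := le_add_of_nonneg_left (norm_nonneg _)
  have ny1 : ‖y.1‖ ≤ longNorm y := le_add_of_nonneg_right (norm_nonneg _)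
  have nx : ‖x.2.1‖ ≤ longNorm x := le_add_of_nonneg_left (norm_nonneg _)
  have nx1 : ‖x.1‖ ≤ longNorm x := le_add_of_nonneg_right (norm_nonneg _)
  have ny0 : 0 ≤ longNorm y := (norm_nonneg _).trans ny
  have nx0 : 0 ≤ longNorm x := (norm_nonneg _).trans nx
  have hdy := hd y
  have hdx := hd x
  rw [effectiveForm_apply, transformedForm]
  generalize T.opInvJ y.2.1 - T.opShift y.1 = A at hdy ⊢
  generalize T.opInvJ x.2.1 - T.opShift x.1 = B at hdx ⊢
  have hB : ‖B‖ ≤ 2 * longNorm x := by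
    have h1 : ‖B‖ ≤ ‖B - x.2.1‖ + ‖x.2.1‖ := by
      simpa using norm_add_le (B - x.2.1) x.2.1
    nlinarith
  have e : inner ℂ A B + (((a ^ 2)⁻¹ : ℝ) : ℂ) * inner ℂ y.2.2 x.2.2 + inner ℂ y.1 (T.opV x.1) -
      (inner ℂ y.2.1 x.2.1 + (((a ^ 2)⁻¹ : ℝ) : ℂ) * inner ℂ y.2.2 x.2.2 +
        inner ℂ y.1 (S.mulVeff x.1)) =
      inner ℂ (A - y.2.1) B + inner ℂ y.2.1 (B - x.2.1) +
        inner ℂ y.1 (T.opV x.1 - S.mulVeff x.1) := by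
    rw [inner_sub_left, inner_sub_right, inner_sub_right]
    ring
  rw [e]
  have b1 : ‖(inner ℂ (A - y.2.1) B : ℂ)‖ ≤ 6 * (a * M) * longNorm y * (2 * longNorm x) :=
    (norm_inner_le_norm _ _).trans (mul_le_mul hdy hB (norm_nonneg _) (by positivity))
  have b2 : ‖(inner ℂ y.2.1 (B - x.2.1) : ℂ)‖ ≤ longNorm y * (6 * (a * M) * longNorm x) :=
    (norm_inner_le_norm _ _).trans (mul_le_mul ny hdx (norm_nonneg _) ny0)
  have b3 : ‖(inner ℂ y.1 (T.opV x.1 - S.mulVeff x.1) : ℂ)‖ ≤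
      longNorm y * (40 * M ^ 2 * (a * M) * longNorm x) :=
    (norm_inner_le_norm _ _).trans (mul_le_mul ny1 (hV.trans
      (mul_le_mul_of_nonneg_left nx1 (by positivity))) (norm_nonneg _) ny0)
  refine (norm_add₃_le).trans ((add_le_add (add_le_add b1 b2) b3).trans ?_)
  have hP : 0 ≤ longNorm y * longNorm x * (a * M) := by positivity
  have hM2 : 1 ≤ M ^ 2 := one_le_pow₀ hM
  have e2 : 6 * (a * M) * longNorm y * (2 * longNorm x) +
      longNorm y * (6 * (a * M) * longNorm x) + longNorm y * (40 * M ^ 2 * (a * M) * longNorm x) =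
      (18 + 40 * M ^ 2) * (longNorm y * longNorm x * (a * M)) := by ring
  have e3 : 58 * M ^ 3 * a * (longNorm y * longNorm x) =
      (18 * M ^ 2 + 40 * M ^ 2) * (longNorm y * longNorm x * (a * M)) := by ring
  rw [e2, e3]
  exact mul_le_mul_of_nonneg_right (by linarith) hP

/-- Coercivity of the effective form: the transverse energy is at least `E₁` and the effective
potential at least `z₀`. -/
theorem effectiveForm_coercive (ha : 0 < a) {z c : ℝ} (hc1 : c ≤ 1) (hcz : c ≤ S.z₀ - z)
    {x : L2Strip × L2Strip × L2Strip} (hx : x ∈ stripSobolev) :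
    c * (‖x.1‖ ^ 2 + ‖x.2.1‖ ^ 2) ≤
      (S.effectiveForm a x x - ((E₁ a + z : ℝ) : ℂ) * inner ℂ x.1 x.1).re := by
  have h1 : E₁ a * ‖x.1‖ ^ 2 ≤ (a ^ 2)⁻¹ * ‖x.2.2‖ ^ 2 := by
    have e : E₁ a * ‖x.1‖ ^ 2 = (a ^ 2)⁻¹ * ((Real.pi / 2) ^ 2 * ‖x.1‖ ^ 2) := by
      rw [E₁]
      field_simp
    rw [e]
    exact mul_le_mul_of_nonneg_left (stripSobolev_poincare hx) (by positivity)
  have h2 : S.z₀ * ‖x.1‖ ^ 2 ≤ (inner ℂ x.1 (S.mulVeff x.1)).re :=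
    re_inner_mulOp_ge S.memLp_Veff (Filter.Eventually.of_forall fun p => z₀_le_Veff p.1) x.1
  rw [effectiveForm_apply]
  simp only [Complex.sub_re, Complex.add_re, Complex.re_ofReal_mul, re_inner_self_eq]
  have h3 : c * ‖x.1‖ ^ 2 ≤ (S.z₀ - z) * ‖x.1‖ ^ 2 :=
    mul_le_mul_of_nonneg_right hcz (sq_nonneg _)
  have h4 : c * ‖x.2.1‖ ^ 2 ≤ 1 * ‖x.2.1‖ ^ 2 := mul_le_mul_of_nonneg_right hc1 (sq_nonneg _)
  linarith

theorem half_longNorm_sq_le (x : L2Strip × L2Strip × L2Strip) :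
    1 / 2 * longNorm x ^ 2 ≤ ‖x.1‖ ^ 2 + ‖x.2.1‖ ^ 2 := by
  rw [longNorm]
  nlinarith [sq_nonneg (‖x.1‖ - ‖x.2.1‖)]

/-- Coercivity of the transformed form: the smallness condition on `a` lets the error of the
comparison be absorbed in half of the lower bound of the effective form. -/
theorem ThinStrip.transformedForm_coercive (T : S.ThinStrip M a) {z c : ℝ} (hc0 : 0 < c)
    (hc1 : c ≤ 1) (hcz : c ≤ S.z₀ - z) (hac : 58 * M ^ 3 * a ≤ c / 4)
    {x : L2Strip × L2Strip × L2Strip} (hx : x ∈ stripSobolev) :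
    c / 4 * longNorm x ^ 2 ≤
      (T.transformedForm x x - ((E₁ a + z : ℝ) : ℂ) * inner ℂ x.1 x.1).re := by
  have h1 := S.effectiveForm_coercive T.pos hc1 hcz hx
  have h2 := (abs_le.1 ((Complex.abs_re_le_norm _).trans (T.norm_transformedForm_sub_le x x))).1
  have h3 : 58 * M ^ 3 * a * (longNorm x * longNorm x) ≤ c / 4 * (longNorm x * longNorm x) :=
    mul_le_mul_of_nonneg_right hac (mul_self_nonneg _)
  have h4 := mul_le_mul_of_nonneg_left (half_longNorm_sq_le x) hc0.le
  rw [Complex.sub_re] at h1 h2 ⊢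
  nlinarith

/-! ### The resolvents and their difference -/

theorem ThinStrip.eq_zero_of_forall_inner_formDomain (T : S.ThinStrip M a)
    (hak : a * S.supNorm < 1) (η : S.Hilb a)
    (h : ∀ x ∈ S.formDomain a, inner ℂ x.1 η = 0) : η = 0 := by
  have h1 : S.U T.pos hak η = 0 := by
    refine eq_zero_of_forall_inner_stripSobolev _ fun y hy => ?_
    obtain ⟨x, hx, hxy⟩ := T.exists_mem_formDomain hak hy
    rw [← hxy.1, LinearIsometryEquiv.inner_map_map]
    exact h x hx
  exact (map_eq_zero_iff _ (S.U T.pos hak).injective).1 h1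

theorem ThinStrip.exists_resolvent_H (T : S.ThinStrip M a) (hak : a * S.supNorm < 1) {w c : ℝ}
    (hc : 0 < c) (h : ∀ x ∈ S.formDomain a,
      c * ‖x.1‖ ^ 2 ≤ ‖x.2.1‖ ^ 2 + ‖x.2.2‖ ^ 2 - w * ‖x.1‖ ^ 2) :
    ∃ R : S.Hilb a →L[ℂ] S.Hilb a, IsResolventAt (S.H a) w R ∧
      ∀ F, ∃ p, (R F, p) ∈ S.formDomain a ∧ ∀ y ∈ S.formDomain a,
        gradientForm (S.measure a) (S.measureInv a) (S.measure a) 1 1 0 y (R F, p) -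
          w * inner ℂ y.1 (R F) = inner ℂ y.1 F := by
  have := exists_isResolventAt_gradientForm (O := Ω₀ a) (μ := S.measure a) (μ₁ := S.measureInv a)
    (μ₂ := S.measure a) (α := 1) (β := 1) (z := w) one_pos one_pos hc 0
    (T.eq_zero_of_forall_inner_formDomain hak) (fun x hx => by
      have := h x hx
      simpa using this)
  rw [Complex.ofReal_one] at this
  exact this

theorem exists_resolvent_Hhat₀ (ha : 0 < a) {z c : ℝ} (hc0 : 0 < c) (hc1 : c ≤ 1)
    (hcz : c ≤ S.z₀ - z) :
    ∃ R : L2Strip →L[ℂ] L2Strip, IsResolventAt (S.Hhat₀ a) ((E₁ a + z : ℝ) : ℂ) R ∧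
      ∀ F, ∃ p, (R F, p) ∈ stripSobolev ∧ ∀ y ∈ stripSobolev,
        S.effectiveForm a y (R F, p) - ((E₁ a + z : ℝ) : ℂ) * inner ℂ y.1 (R F) =
          inner ℂ y.1 F := by
  have := exists_isResolventAt_gradientForm (O := strip) (μ := stripMeasure) (μ₁ := stripMeasure)
    (μ₂ := stripMeasure) (α := 1) (β := (a ^ 2)⁻¹) (z := E₁ a + z) one_pos (by positivity) hc0
    S.mulVeff eq_zero_of_forall_inner_stripSobolev (fun x hx => by
      have h1 := S.effectiveForm_coercive ha hc1 hcz hx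
      rw [effectiveForm_apply] at h1
      simp only [Complex.sub_re, Complex.add_re, Complex.re_ofReal_mul, re_inner_self_eq] at h1
      have := mul_nonneg hc0.le (sq_nonneg ‖x.2.1‖)
      linarith)
  rw [Complex.ofReal_one] at this
  exact this

theorem ThinStrip.form_coercive (T : S.ThinStrip M a) (hak : a * S.supNorm < 1) {z c : ℝ}
    (hc0 : 0 < c) (hc1 : c ≤ 1) (hcz : c ≤ S.z₀ - z) (hac : 58 * M ^ 3 * a ≤ c / 4)
    {x : S.Hilb a × Lp ℂ 2 (S.measureInv a) × S.Hilb a} (hx : x ∈ S.formDomain a) :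
    c / 4 * ‖x.1‖ ^ 2 ≤ ‖x.2.1‖ ^ 2 + ‖x.2.2‖ ^ 2 - (E₁ a + z) * ‖x.1‖ ^ 2 := by
  obtain ⟨y, hy, hxy⟩ := T.exists_mem_stripSobolev hak hx
  have h1 := T.transformedForm_coercive hc0 hc1 hcz hac hy
  rw [← T.gradientForm_eq_transformedForm hak hxy hxy hy hy, ← hxy.1,
    LinearIsometryEquiv.inner_map_map] at h1
  have h2 : gradientForm (S.measure a) (S.measureInv a) (S.measure a) 1 1 0 x x =
      1 * inner ℂ x.2.1 x.2.1 + 1 * inner ℂ x.2.2 x.2.2 +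
        inner ℂ x.1 ((0 : S.Hilb a →L[ℂ] S.Hilb a) x.1) := rfl
  rw [h2, zero_apply, inner_zero_right, add_zero, one_mul, one_mul] at h1
  simp only [Complex.sub_re, Complex.add_re, Complex.re_ofReal_mul, re_inner_self_eq] at h1
  refine le_trans (mul_le_mul_of_nonneg_left ?_ (by positivity)) h1
  refine pow_le_pow_left₀ (norm_nonneg _) ?_ 2
  have h3 : ‖x.1‖ = ‖y.1‖ := by rw [← hxy.1, LinearIsometryEquiv.norm_map]
  rw [h3]
  exact le_add_of_nonneg_right (norm_nonneg _)

/-- The estimate of the difference of the two resolvents, by testing the difference of the two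
variational equations with the difference of the solutions. -/
theorem ThinStrip.norm_sub_le_of_solutions (T : S.ThinStrip M a) {z c : ℝ} (hc0 : 0 < c)
    (hc1 : c ≤ 1) (hcz : c ≤ S.z₀ - z) (hac : 58 * M ^ 3 * a ≤ c / 4) {F : L2Strip}
    {x x₀ : L2Strip × L2Strip × L2Strip} (hx : x ∈ stripSobolev) (hx₀ : x₀ ∈ stripSobolev)
    (h : ∀ y ∈ stripSobolev, T.transformedForm y x - ((E₁ a + z : ℝ) : ℂ) * inner ℂ y.1 x.1 =
      inner ℂ y.1 F)
    (h₀ : ∀ y ∈ stripSobolev, S.effectiveForm a y x₀ - ((E₁ a + z : ℝ) : ℂ) * inner ℂ y.1 x₀.1 =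
      inner ℂ y.1 F) : ‖x.1 - x₀.1‖ ≤ 8 * (58 * M ^ 3) / c ^ 2 * a * ‖F‖ := by
  have hM := T.one_le
  have ha := T.pos
  have hN : ∀ y, 0 ≤ longNorm y := fun y => add_nonneg (norm_nonneg _) (norm_nonneg _)
  set K := 58 * M ^ 3 with hK
  have hK0 : 0 < K := by positivity
  -- the a priori bound for the solution of the transformed problem
  have h1 : c / 4 * longNorm x ≤ ‖F‖ := by
    have h2 := T.transformedForm_coercive hc0 hc1 hcz hac hx
    rw [h x hx] at h2
    have h3 : (inner ℂ x.1 F).re ≤ ‖x.1‖ * ‖F‖ := re_inner_le_norm (𝕜 := ℂ) x.1 F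
    have h4 : ‖x.1‖ * ‖F‖ ≤ longNorm x * ‖F‖ :=
      mul_le_mul_of_nonneg_right (le_add_of_nonneg_right (norm_nonneg _)) (norm_nonneg _)
    rcases (hN x).eq_or_lt with h5 | h5
    · rw [← h5, mul_zero]
      exact norm_nonneg F
    · nlinarith
  set δ := x - x₀ with hδ
  have hδm : δ ∈ stripSobolev := Submodule.sub_mem _ hx hx₀
  have h2 : c / 2 * longNorm δ ≤ K * a * longNorm x := by
    have e1 : S.effectiveForm a δ δ - ((E₁ a + z : ℝ) : ℂ) * inner ℂ δ.1 δ.1 =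
        -(T.transformedForm δ x - S.effectiveForm a δ x) := by
      have e2 : S.effectiveForm a δ δ = S.effectiveForm a δ x - S.effectiveForm a δ x₀ :=
        map_sub _ x x₀
      have e3 : (inner ℂ δ.1 δ.1 : ℂ) = inner ℂ δ.1 x.1 - inner ℂ δ.1 x₀.1 :=
        inner_sub_right δ.1 x.1 x₀.1
      rw [e2, e3]
      linear_combination h δ hδm - h₀ δ hδm
    have h3 := S.effectiveForm_coercive ha hc1 hcz hδm
    rw [e1, Complex.neg_re] at h3
    have h4 := (abs_le.1 ((Complex.abs_re_le_norm _).trans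
      (T.norm_transformedForm_sub_le δ x))).1
    have h5 := mul_le_mul_of_nonneg_left (half_longNorm_sq_le δ) hc0.le
    have h6 : c / 2 * longNorm δ * longNorm δ ≤ K * a * longNorm x * longNorm δ := by
      rw [← hK] at h4
      nlinarith
    rcases (hN δ).eq_or_lt with h7 | h7
    · rw [← h7, mul_zero]
      exact mul_nonneg (by positivity) (hN x)
    · exact le_of_mul_le_mul_right h6 h7
  have h3 : ‖x.1 - x₀.1‖ ≤ longNorm δ := le_add_of_nonneg_right (norm_nonneg _)
  have h4 : longNorm x ≤ 4 / c * ‖F‖ := by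
    rw [div_mul_eq_mul_div, le_div_iff₀ hc0]
    linarith
  have h5 : longNorm δ ≤ 2 / c * (K * a * longNorm x) := by
    rw [div_mul_eq_mul_div, le_div_iff₀ hc0]
    linarith
  calc ‖x.1 - x₀.1‖ ≤ 2 / c * (K * a * (4 / c * ‖F‖)) := h3.trans (h5.trans (by gcongr))
    _ = 8 * K / c ^ 2 * a * ‖F‖ := by
      field_simp
      ring

theorem z₀_nonpos (S : StripData n) : S.z₀ ≤ 0 := by
  rw [z₀]
  nlinarith [sq_nonneg S.supNorm]

end StripData

end QuantumStrip

end

/-! ### The norm resolvent estimate -/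

theorem theorem6p1 (n : ℕ) (hn : 1 ≤ n) (S : QuantumStrip.StripData n) (z : ℝ) (hz : z < S.z₀) :
    ∃ a₀ C : ℝ, 0 < a₀ ∧ 0 < C ∧
      ∀ (a : ℝ) (ha : 0 < a) (hak : a * S.supNorm < 1), a ≤ a₀ →
        (z : ℂ) ∈ QuantumStrip.resolventSet (S.Hhat ha hak) ∧
        (z : ℂ) ∈ QuantumStrip.resolventSet
          (QuantumStrip.subScalar (S.Hhat ha hak) (QuantumStrip.E₁ a)) ∧
        (z : ℂ) ∈ QuantumStrip.resolventSet
          (QuantumStrip.subScalar (S.Hhat₀ a) (QuantumStrip.E₁ a)) ∧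
        ‖QuantumStrip.resolvent
            (QuantumStrip.subScalar (S.Hhat ha hak) (QuantumStrip.E₁ a)) (z : ℂ) -
          QuantumStrip.resolvent
            (QuantumStrip.subScalar (S.Hhat₀ a) (QuantumStrip.E₁ a)) (z : ℂ)‖ ≤ C * a := by
  obtain ⟨M, hM⟩ := S.exists_uniformBounds
  have hM1 : 1 ≤ M := hM.one_le
  obtain ⟨c, hc0, hc1, hcz⟩ : ∃ c : ℝ, 0 < c ∧ c ≤ 1 ∧ c ≤ S.z₀ - z :=
    ⟨min 1 (S.z₀ - z), lt_min one_pos (sub_pos.2 hz), min_le_left _ _, min_le_right _ _⟩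
  have hK : 0 < 58 * M ^ 3 := by positivity
  -- below the first bound the metric is close to the Euclidean one, below the second one the
  -- transformed form inherits the coercivity of the effective form
  refine ⟨min (1 / (8 * M)) (c / 4 / (58 * M ^ 3)), 8 * (58 * M ^ 3) / c ^ 2,
    lt_min (by positivity) (by positivity), by positivity, fun a ha hak haa => ?_⟩
  have hsmall : 8 * (a * M) ≤ 1 := by
    have h := haa.trans (min_le_left _ _)
    rw [le_div_iff₀ (by positivity)] at h
    linarith
  have hac : 58 * M ^ 3 * a ≤ c / 4 := by
    have h := haa.trans (min_le_right _ _)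
    rw [le_div_iff₀ hK] at h
    linarith
  have T : S.ThinStrip M a := { hM with pos := ha, small := hsmall }
  have hcast : ((QuantumStrip.E₁ a + z : ℝ) : ℂ) = (QuantumStrip.E₁ a : ℂ) + (z : ℂ) :=
    Complex.ofReal_add _ _
  -- `H` is non-negative and `z < z₀ ≤ 0`
  have hz0 : 0 < -z := by
    have := S.z₀_nonpos
    linarith
  obtain ⟨R₁, hR₁, -⟩ := T.exists_resolvent_H hak (w := z) hz0 fun x _ => by
    have h1 := sq_nonneg ‖x.2.1‖
    have h2 := sq_nonneg ‖x.2.2‖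
    linarith
  obtain ⟨R, hR, hRF⟩ := T.exists_resolvent_H hak (w := QuantumStrip.E₁ a + z) (c := c / 4)
    (by positivity) fun x hx => T.form_coercive hak hc0 hc1 hcz hac hx
  obtain ⟨R₀, hR₀, hRF₀⟩ := QuantumStrip.StripData.exists_resolvent_Hhat₀ (S := S) ha hc0 hc1 hcz
  have r : QuantumStrip.IsResolventAt
      (QuantumStrip.subScalar (S.Hhat ha hak) (QuantumStrip.E₁ a)) z
      (QuantumStrip.conjCLM (S.U ha hak) R) :=
    (hcast ▸ hR.unitaryConj (S.U ha hak)).subScalar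
  have r₀ : QuantumStrip.IsResolventAt
      (QuantumStrip.subScalar (S.Hhat₀ a) (QuantumStrip.E₁ a)) z R₀ :=
    (hcast ▸ hR₀).subScalar
  refine ⟨⟨_, hR₁.unitaryConj (S.U ha hak)⟩, ⟨_, r⟩, ⟨_, r₀⟩, ?_⟩
  rw [r.resolvent_eq, r₀.resolvent_eq]
  refine ContinuousLinearMap.opNorm_le_bound _ (by positivity) fun F => ?_
  obtain ⟨p, hp, hpe⟩ := hRF ((S.U ha hak).symm F)
  obtain ⟨p₀, hp₀, hpe₀⟩ := hRF₀ F
  obtain ⟨x, hx, hpx⟩ := T.exists_mem_stripSobolev hak hp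
  have hx1 : S.U ha hak (R ((S.U ha hak).symm F)) = x.1 := hpx.1
  have hmain := T.norm_sub_le_of_solutions hc0 hc1 hcz hac hx hp₀ (F := F) (fun y hy => by
    obtain ⟨w, hw, hwy⟩ := T.exists_mem_formDomain hak hy
    have hwy1 : S.U ha hak w.1 = y.1 := hwy.1
    have h := hpe w hw
    rw [T.gradientForm_eq_transformedForm hak hpx hwy hx hy] at h
    rw [← hx1, ← hwy1, LinearIsometryEquiv.inner_map_map, hwy1, h,
      ← LinearIsometryEquiv.inner_map_map (S.U ha hak), LinearIsometryEquiv.apply_symm_apply, hwy1])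
    hpe₀
  rw [sub_apply, QuantumStrip.conjCLM_apply, hx1]
  exact hmain
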